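/- Let $\beta>0$. There is a constant $K>0$, depending only on $\beta$, with the following property. Let $g$ be a standard Gaussian random variable and let $f:\mathbb{R}\to\mathbb{R}$ be an absolutely continuous function (that is, absolutely continuous on every compact interval; $f$ need not be monotone), with almost everywhere defined derivative $f'$, such that $h=f(g)$ satisfies $\mathbb{E}h=0$, $\mathbb{E}h^2=1$ and $\mathbb{E}|f'(g)|^3<\infty$. For every integer $N\ge 2$, let $(h_{ij})_{1\le i,j\le N}$ be i.i.d. copies of $h$ and let $$F_N(\beta)=\log\sum_{\sigma\in\{-1,1\}^N}\exp\Bigl(\frac{\beta}{\sqrt N}\sum_{i,j=1}^N h_{ij}\sigma_i\sigma_j\Bigr)$$ be the free energy of the Sherrington-Kirkpatrick model with disorder $h$. Then $F_N(\beta)$ is square integrable and $$\mathrm{Var}(F_N(\beta))\le K\Bigl(1+\bigl(\mathbb{E}|f'(g)|^3\bigr)^2\Bigr)\frac{N}{\log N}.$$ -/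

import Mathlib

open MeasureTheory ProbabilityTheory

noncomputable section

namespace SK

/-- The spin configurations `{-1, 1}^N`. -/
def configs (N : ℕ) : Finset (Fin N → ℝ) :=
  Fintype.piFinset fun _ => ({-1, 1} : Finset ℝ)

/-- The Hamiltonian `H_N(σ)` of the Sherrington-Kirkpatrick model at inverse temperature `β`
with disorder matrix `x`, i.e. `-H_N(σ) = (β / √N) ∑_{i,j} x_{ij} σ_i σ_j`. -/
def hamiltonian (β : ℝ) (N : ℕ) (x : Fin N → Fin N → ℝ) (σ : Fin N → ℝ) : ℝ :=
  -(β / Real.sqrt N * ∑ i, ∑ j, x i j * σ i * σ j)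

/-- The free energy `F_N(β) = log ∑_σ exp (-H_N(σ))` as a function of the disorder matrix. -/
def freeEnergy (β : ℝ) (N : ℕ) (x : Fin N → Fin N → ℝ) : ℝ :=
  Real.log (∑ σ ∈ configs N, Real.exp (-hamiltonian β N x σ))

/-- A function on the whole line is absolutely continuous if it is so on every compact
interval (so that, for instance, every polynomial is absolutely continuous). -/
def AbsCont (f : ℝ → ℝ) : Prop :=
  ∀ a b : ℝ, AbsolutelyContinuousOnInterval f a b

end SK

end

open MeasureTheory ProbabilityTheory

noncomputable section

set_option linter.unusedSectionVars false

namespace SK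

/-! The argument uses a law `μ` only through its mean zero, its unit variance and a bound `M` on its
third absolute moment. The derivative of `f` enters only at the end, through a Gaussian Hardy
inequality that bounds `E|h|³` by a multiple of `E|f'(g)|³`.

Superconcentration is obtained from noise stability (`variance_le_of_noise`). Let `x'` keep each
coordinate of `x` with probability `r` and redraw it otherwise. By the Hoeffding decomposition `E
F(x) F(x')` is a polynomial `∑ p_k r^k` with `p_k ≥ 0`, and `r p'(r)` is the sum over coordinates of
the correlations of the one-coordinate fluctuations of `F` at `x` and `x'` (`exists_polynomial`).
The variance is `∑_{k≥1} p_k`. Levels up to `m` are controlled by `ρ^{-m} ∑ k p_k ρ^k`, higher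
levels by `m⁻¹ ∑ k p_k`. The last sum is at most `4β²N`. If the noisy sum is `O(M√N)` at some fixed
`ρ < 1`, then `m` of order `log N` gives the theorem.

For the noisy sum, put `b = β/√N`. The fluctuation of the free energy in the bond `e` is `b x_e
⟨σ_e⟩ + O(b²)`, so up to `N²` errors of size `b³M` the sum equals `b²ρ` times the total mean bond
overlap of two systems with disorders `x, x'` (`pairInt_dif_free_le`). By convexity this is at most
the increase of the two-copy free energy when a direct coupling of strength `ρ` is switched on
(`sum_overlap_le`).

A Lindeberg-type interpolation, which changes the one-bond law through mixtures, then replaces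
correlation `ρ` and coupling `ρ` by correlation `0` and coupling `2ρ` (`integral_pairEnergy_le`). To
second order the two-copy free energy can only increase, because the sum over bonds of `⟨σ_e⟩⟨τ_e⟩`
is an average of squares. The same step replaces the second disorder by Rademacher signs. Gauge
symmetry of these signs makes the second configuration uniform relative to the first, so the
coupling costs at most `log(2N+1)` once `2β²ρ ≤ 1/2` (`integral_gibbs_exp_le`). -/

/-- The Gibbs average of `φ` on the finite set `T` with energy `E`. -/
def gibbs {α : Type*} (T : Finset α) (E φ : α → ℝ) : ℝ :=
  (∑ a ∈ T, Real.exp (E a) * φ a) / ∑ a ∈ T, Real.exp (E a)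

/-- The logarithm of the partition function on the finite set `T` with energy `E`. -/
def logZ {α : Type*} (T : Finset α) (E : α → ℝ) : ℝ :=
  Real.log (∑ a ∈ T, Real.exp (E a))

/-! ### Taylor expansion of the log-partition function along a perturbation of the energy. -/

section Gibbs

variable {α : Type*} {T : Finset α}

lemma partition_pos (hT : T.Nonempty) (E : α → ℝ) : 0 < ∑ a ∈ T, Real.exp (E a) :=
  Finset.sum_pos (fun _ _ => Real.exp_pos _) hT

lemma gibbs_add (E φ ψ : α → ℝ) :
    gibbs T E (fun a => φ a + ψ a) = gibbs T E φ + gibbs T E ψ := by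
  simp only [gibbs, mul_add, Finset.sum_add_distrib, add_div]

lemma gibbs_const_mul (E φ : α → ℝ) (c : ℝ) :
    gibbs T E (fun a => c * φ a) = c * gibbs T E φ := by
  simp only [gibbs, Finset.mul_sum, mul_div_assoc']
  congr 1
  exact Finset.sum_congr rfl fun a _ => by ring

lemma gibbs_const (hT : T.Nonempty) (E : α → ℝ) (c : ℝ) : gibbs T E (fun _ => c) = c := by
  simp only [gibbs, ← Finset.sum_mul]
  have := partition_pos hT E
  field_simp

lemma gibbs_sum {κ : Type*} (E : α → ℝ) (s : Finset κ) (φ : κ → α → ℝ) :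
    gibbs T E (fun a => ∑ k ∈ s, φ k a) = ∑ k ∈ s, gibbs T E (φ k) := by
  simp only [gibbs, Finset.mul_sum]
  rw [Finset.sum_comm, Finset.sum_div]

lemma gibbs_mono (E : α → ℝ) {φ ψ : α → ℝ} (h : ∀ a ∈ T, φ a ≤ ψ a) :
    gibbs T E φ ≤ gibbs T E ψ := by
  unfold gibbs
  gcongr with a ha
  exact h a ha

lemma abs_gibbs_le (hT : T.Nonempty) (E : α → ℝ) {φ : α → ℝ} {K : ℝ}
    (h : ∀ a ∈ T, |φ a| ≤ K) : |gibbs T E φ| ≤ K := by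
  rw [abs_le]
  constructor
  · rw [← gibbs_const (T := T) hT E (-K)]
    exact gibbs_mono E fun a ha => (abs_le.1 (h a ha)).1
  · rw [← gibbs_const (T := T) hT E K]
    exact gibbs_mono E fun a ha => (abs_le.1 (h a ha)).2

lemma hasDerivAt_partition (E X φ : α → ℝ) (t : ℝ) :
    HasDerivAt (fun t => ∑ a ∈ T, Real.exp (E a + t * X a) * φ a)
      (∑ a ∈ T, Real.exp (E a + t * X a) * (X a * φ a)) t := by
  refine (HasDerivAt.fun_sum (A' := fun a => Real.exp (E a + t * X a) * (X a * φ a))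
    fun a _ => ?_)
  have h1 : HasDerivAt (fun t => E a + t * X a) (X a) t := by
    simpa using ((hasDerivAt_id t).mul_const (X a)).const_add (E a)
  exact (h1.exp.mul_const (φ a)).congr_deriv (by ring)

lemma hasDerivAt_logZ (hT : T.Nonempty) (E X : α → ℝ) (t : ℝ) :
    HasDerivAt (fun t => logZ T (fun a => E a + t * X a))
      (gibbs T (fun a => E a + t * X a) X) t := by
  have h := hasDerivAt_partition (T := T) E X (fun _ => 1) t
  simp only [mul_one] at h
  exact h.log (partition_pos hT _).ne'

lemma hasDerivAt_gibbs (hT : T.Nonempty) (E X φ : α → ℝ) (t : ℝ) :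
    HasDerivAt (fun t => gibbs T (fun a => E a + t * X a) φ)
      (gibbs T (fun a => E a + t * X a) (fun a => X a * φ a)
        - gibbs T (fun a => E a + t * X a) X * gibbs T (fun a => E a + t * X a) φ) t := by
  have h := hasDerivAt_partition (T := T) E X (fun _ => 1) t
  simp only [mul_one] at h
  have hp := (partition_pos hT (fun a => E a + t * X a)).ne'
  refine ((hasDerivAt_partition (T := T) E X φ t).fun_div h hp).congr_deriv ?_
  unfold gibbs
  field_simp

/-- The factor `t` of the mean value inequality is given up. Iterating the lemma therefore gives
Taylor remainders without factorials, which is harmless since only the power of the perturbation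
size matters. -/
lemma abs_sub_le_of_hasDerivAt {g g' : ℝ → ℝ} (hg : ∀ t, HasDerivAt g (g' t) t) {C : ℝ}
    (hC : ∀ t, 0 ≤ t → t ≤ 1 → |g' t| ≤ C) {t : ℝ} (h0 : 0 ≤ t) (h1 : t ≤ 1) :
    |g t - g 0| ≤ C := by
  have hC0 : 0 ≤ C := (abs_nonneg _).trans (hC 0 le_rfl zero_le_one)
  have := (convex_Icc (0 : ℝ) 1).norm_image_sub_le_of_norm_hasDerivWithin_le
    (f := g) (f' := g') (C := C) (fun x _ => (hg x).hasDerivWithinAt)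
    (fun x hx => hC x hx.1 hx.2) (x := 0) (y := t) (by simp) ⟨h0, h1⟩
  simp only [Real.norm_eq_abs, sub_zero, abs_of_nonneg h0] at this
  nlinarith

variable (hT : T.Nonempty) (E : α → ℝ) {X : α → ℝ} {K : ℝ} (hX : ∀ a ∈ T, |X a| ≤ K)
include hT hX

lemma abs_logZ_sub_le : |logZ T (fun a => E a + X a) - logZ T E| ≤ K := by
  have := abs_sub_le_of_hasDerivAt (hasDerivAt_logZ hT E X) (C := K)
    (fun t _ _ => abs_gibbs_le hT _ hX) zero_le_one le_rfl
  simpa using this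

/-- The derivative along `E + t X` is the Gibbs covariance of `X` and `φ`, which is at most `2K`. -/
lemma abs_gibbs_sub_le {φ : α → ℝ} (hφ : ∀ a ∈ T, |φ a| ≤ 1) :
    |gibbs T (fun a => E a + X a) φ - gibbs T E φ| ≤ 2 * K := by
  have := abs_sub_le_of_hasDerivAt (hasDerivAt_gibbs hT E X φ) (C := 2 * K)
    (fun t _ _ => ?_) zero_le_one le_rfl
  · simpa using this
  have h1 : |gibbs T (fun a => E a + t * X a) (fun a => X a * φ a)| ≤ K := by
    refine abs_gibbs_le hT _ fun a ha => ?_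
    rw [abs_mul]
    nlinarith [hX a ha, hφ a ha, abs_nonneg (X a), abs_nonneg (φ a)]
  have h2 := abs_gibbs_le hT (fun a => E a + t * X a) hX
  have h3 := abs_gibbs_le hT (fun a => E a + t * X a) hφ
  have h4 : |gibbs T (fun a => E a + t * X a) X * gibbs T (fun a => E a + t * X a) φ| ≤ K := by
    rw [abs_mul]
    nlinarith [abs_nonneg (gibbs T (fun a => E a + t * X a) X),
      abs_nonneg (gibbs T (fun a => E a + t * X a) φ)]
  have := abs_sub (gibbs T (fun a => E a + t * X a) (fun a => X a * φ a))
    (gibbs T (fun a => E a + t * X a) X * gibbs T (fun a => E a + t * X a) φ)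
  linarith

lemma gibbs_cumulants_abs_le :
    |gibbs T E (fun a => X a * X a)| ≤ K ^ 2 ∧
      |gibbs T E (fun a => X a * (X a * X a))| ≤ K ^ 3 ∧ |gibbs T E X| ≤ K := by
  refine ⟨abs_gibbs_le hT _ fun a ha => ?_, abs_gibbs_le hT _ fun a ha => ?_,
    abs_gibbs_le hT _ hX⟩
  · rw [abs_mul, ← sq]
    exact pow_le_pow_left₀ (abs_nonneg _) (hX a ha) 2
  · rw [abs_mul, abs_mul, show |X a| * (|X a| * |X a|) = |X a| ^ 3 by ring]
    exact pow_le_pow_left₀ (abs_nonneg _) (hX a ha) 3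

lemma abs_logZ_sub_gibbs_le :
    |logZ T (fun a => E a + X a) - logZ T E - gibbs T E X| ≤ 2 * K ^ 2 := by
  have hder : ∀ t, HasDerivAt (fun t => logZ T (fun a => E a + t * X a) - t * gibbs T E X)
      (gibbs T (fun a => E a + t * X a) X - gibbs T E X) t := fun t => by
    simpa using (hasDerivAt_logZ hT E X t).fun_sub ((hasDerivAt_id t).mul_const (gibbs T E X))
  have key : ∀ t, 0 ≤ t → t ≤ 1 →
      |gibbs T (fun a => E a + t * X a) X - gibbs T E X| ≤ 2 * K ^ 2 := fun t h0 h1 => by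
    have := abs_sub_le_of_hasDerivAt (hasDerivAt_gibbs hT E X X) (C := 2 * K ^ 2)
      (fun t _ _ => ?_) h0 h1
    · simpa using this
    obtain ⟨h1, -, h2⟩ := gibbs_cumulants_abs_le hT (fun a => E a + t * X a) hX
    have h3 : |gibbs T (fun a => E a + t * X a) X * gibbs T (fun a => E a + t * X a) X|
        ≤ K ^ 2 := by
      rw [abs_mul, ← sq]
      exact pow_le_pow_left₀ (abs_nonneg _) h2 2
    exact (abs_sub _ _).trans (by linarith)
  have := abs_sub_le_of_hasDerivAt hder key zero_le_one le_rfl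
  simp only [one_mul, zero_mul, add_zero, sub_zero] at this
  rwa [show logZ T (fun a => E a + X a) - logZ T E - gibbs T E X
    = logZ T (fun a => E a + X a) - gibbs T E X - logZ T E by ring]

/-- The successive derivatives of `logZ` along `E + t X` are the Gibbs cumulants of `X`. The third
one is `m₃ - 3 m₁m₂ + 2 m₁³`, so it is at most `(1 + 3 + 2) K³`. Three applications of the mean
value bound follow, with the quadratic Taylor polynomial subtracted. -/
lemma abs_logZ_sub_cumulants_le :
    |logZ T (fun a => E a + X a) - logZ T E - gibbs T E X
      - (gibbs T E (fun a => X a * X a) - gibbs T E X * gibbs T E X) / 2| ≤ 6 * K ^ 3 := by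
  set v : ℝ → ℝ := fun t => gibbs T (fun a => E a + t * X a) (fun a => X a * X a)
    - gibbs T (fun a => E a + t * X a) X * gibbs T (fun a => E a + t * X a) X with hv
  have hder2 : ∀ t, HasDerivAt v
      (gibbs T (fun a => E a + t * X a) (fun a => X a * (X a * X a))
        - gibbs T (fun a => E a + t * X a) X * gibbs T (fun a => E a + t * X a) (fun a => X a * X a)
        - (v t * gibbs T (fun a => E a + t * X a) X
          + gibbs T (fun a => E a + t * X a) X * v t)) t := fun t =>
    (hasDerivAt_gibbs hT E X (fun a => X a * X a) t).sub
      ((hasDerivAt_gibbs hT E X X t).mul (hasDerivAt_gibbs hT E X X t))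
  have key2 : ∀ t, 0 ≤ t → t ≤ 1 → |v t - v 0| ≤ 6 * K ^ 3 := fun t h0 h1 => by
    refine abs_sub_le_of_hasDerivAt hder2 (fun t _ _ => ?_) h0 h1
    obtain ⟨h2, h3, h1⟩ := gibbs_cumulants_abs_le hT (fun a => E a + t * X a) hX
    simp only [hv]
    set m1 := gibbs T (fun a => E a + t * X a) X
    set m2 := gibbs T (fun a => E a + t * X a) (fun a => X a * X a)
    set m3 := gibbs T (fun a => E a + t * X a) (fun a => X a * (X a * X a))
    have hK : 0 ≤ K := (abs_nonneg _).trans h1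
    have h12 : |m1 * m2| ≤ K ^ 3 := by
      rw [abs_mul, show K ^ 3 = K * K ^ 2 by ring]
      exact mul_le_mul h1 h2 (abs_nonneg _) hK
    have h111 : |m1 ^ 3| ≤ K ^ 3 := by
      rw [abs_pow]
      exact pow_le_pow_left₀ (abs_nonneg _) h1 3
    rw [show m3 - m1 * m2 - ((m2 - m1 * m1) * m1 + m1 * (m2 - m1 * m1))
      = m3 - 3 * (m1 * m2) + 2 * m1 ^ 3 by ring]
    rw [abs_le] at *
    constructor <;> linarith
  have hder1 : ∀ t, HasDerivAt
      (fun t => gibbs T (fun a => E a + t * X a) X - t * v 0) (v t - v 0) t := fun t => by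
    simpa [hv] using (hasDerivAt_gibbs hT E X X t).fun_sub ((hasDerivAt_id t).mul_const (v 0))
  have key1 : ∀ t, 0 ≤ t → t ≤ 1 →
      |gibbs T (fun a => E a + t * X a) X - gibbs T E X - t * v 0| ≤ 6 * K ^ 3 :=
      fun t h0 h1 => by
    have := abs_sub_le_of_hasDerivAt hder1 key2 h0 h1
    simp only [zero_mul, add_zero, sub_zero] at this
    rwa [sub_right_comm] at this
  have hder0 : ∀ t, HasDerivAt
      (fun t => logZ T (fun a => E a + t * X a) - t * gibbs T E X - t ^ 2 * (v 0 / 2))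
      (gibbs T (fun a => E a + t * X a) X - gibbs T E X - t * v 0) t := fun t => by
    have := ((hasDerivAt_logZ hT E X t).sub ((hasDerivAt_id t).mul_const (gibbs T E X))).sub
      ((hasDerivAt_pow 2 t).mul_const (v 0 / 2))
    refine this.congr_deriv ?_
    simp
    ring
  have := abs_sub_le_of_hasDerivAt hder0 key1 zero_le_one le_rfl
  simp only [hv, one_mul, zero_mul, add_zero, sub_zero, one_pow, ne_eq, OfNat.ofNat_ne_zero,
    not_false_eq_true, zero_pow] at this
  convert this using 2
  ring

end Gibbs

/-! ### Product measures: redrawing one coordinate, and mixtures of one-coordinate laws. -/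

section Product

variable {ι : Type*} [Fintype ι] {E : Type*} [NormedAddCommGroup E] [MeasurableSpace E]

/-- Measurable functions of finitely many variables of polynomial growth of degree `k`. -/
def Growth (k : ℕ) (G : (ι → E) → ℝ) : Prop :=
  Measurable G ∧ ∃ C : ℝ, 0 ≤ C ∧ ∀ z, |G z| ≤ C * (1 + ∑ i, ‖z i‖) ^ k

lemma one_le_one_add_sum (z : ι → E) : 1 ≤ 1 + ∑ i, ‖z i‖ :=
  le_add_of_nonneg_right (Finset.sum_nonneg fun _ _ => norm_nonneg _)

lemma Growth.sub {k : ℕ} {F G : (ι → E) → ℝ} (hF : Growth k F) (hG : Growth k G) :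
    Growth k (fun z => F z - G z) := by
  obtain ⟨mF, C, hC, hFb⟩ := hF
  obtain ⟨mG, D, hD, hGb⟩ := hG
  refine ⟨mF.sub mG, C + D, by positivity, fun z => (abs_sub _ _).trans ?_⟩
  rw [add_mul]
  exact add_le_add (hFb z) (hGb z)

lemma Growth.add {k : ℕ} {F G : (ι → E) → ℝ} (hF : Growth k F) (hG : Growth k G) :
    Growth k (fun z => F z + G z) := by
  obtain ⟨mF, C, hC, hFb⟩ := hF
  obtain ⟨mG, D, hD, hGb⟩ := hG
  refine ⟨mF.add mG, C + D, by positivity, fun z => (abs_add_le _ _).trans ?_⟩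
  rw [add_mul]
  exact add_le_add (hFb z) (hGb z)

lemma Growth.mul {k l : ℕ} {F G : (ι → E) → ℝ} (hF : Growth k F) (hG : Growth l G) :
    Growth (k + l) (fun z => F z * G z) := by
  obtain ⟨mF, C, hC, hFb⟩ := hF
  obtain ⟨mG, D, hD, hGb⟩ := hG
  refine ⟨mF.mul mG, C * D, by positivity, fun z => ?_⟩
  rw [abs_mul, pow_add, mul_mul_mul_comm]
  exact mul_le_mul (hFb z) (hGb z) (abs_nonneg _) ((abs_nonneg _).trans (hFb z))

lemma Growth.mono {k l : ℕ} (hkl : k ≤ l) {F : (ι → E) → ℝ} (hF : Growth k F) : Growth l F := by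
  obtain ⟨mF, C, hC, hFb⟩ := hF
  exact ⟨mF, C, hC, fun z => (hFb z).trans
    (mul_le_mul_of_nonneg_left (pow_le_pow_right₀ (one_le_one_add_sum z) hkl) hC)⟩

lemma Growth.of_bounded {F : (ι → E) → ℝ} (hF : Measurable F) {C : ℝ} (h : ∀ z, |F z| ≤ C) :
    Growth 0 F :=
  ⟨hF, C, (abs_nonneg _).trans (h 0), fun z => by simpa using h z⟩

/-- A probability measure with a finite second moment. -/
def SecondMoment (ξ : Measure E) : Prop :=
  IsProbabilityMeasure ξ ∧ MemLp (fun w : E => ‖w‖) 2 ξ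

variable {ν : ι → Measure E}

lemma Growth.integrable {k : ℕ} (hk : k ≤ 2) {G : (ι → E) → ℝ} (hG : Growth k G)
    (hν : ∀ i, SecondMoment (ν i)) : Integrable G (Measure.pi ν) := by
  have := fun i => (hν i).1
  obtain ⟨mG, C, hC, hGb⟩ := hG.mono hk
  have h1 : MemLp (fun z : ι → E => 1 + ∑ i, ‖z i‖) 2 (Measure.pi ν) :=
    (memLp_const (1 : ℝ)).add <| memLp_finsetSum _ fun i _ =>
      (hν i).2.comp_measurePreserving (measurePreserving_eval ν i)
  refine (h1.integrable_sq.const_mul C).mono' mG.aestronglyMeasurable (.of_forall fun z => ?_)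
  exact hGb z

variable [DecidableEq ι]

lemma isProbabilityMeasure_update (hν : ∀ i, IsProbabilityMeasure (ν i)) (i : ι) (ξ : Measure E)
    [IsProbabilityMeasure ξ] (j : ι) : IsProbabilityMeasure (Function.update ν i ξ j) := by
  rcases eq_or_ne j i with rfl | h
  · simpa
  · simpa [h] using hν j

lemma SecondMoment.update (hν : ∀ i, SecondMoment (ν i)) (i : ι) {ξ : Measure E}
    (hξ : SecondMoment ξ) (j : ι) : SecondMoment (Function.update ν i ξ j) := by
  rcases eq_or_ne j i with rfl | h
  · simpa
  · simpa [h] using hν j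

lemma measurable_update_pair (i : ι) :
    Measurable (fun p : (ι → E) × E => Function.update p.1 i p.2) := by
  refine measurable_pi_lambda _ fun j => ?_
  rcases eq_or_ne j i with rfl | h
  · simpa using measurable_snd
  · simpa [h, Function.comp_def] using (measurable_pi_apply j).comp measurable_fst

/-- Overwriting coordinate `i` by an independent draw forgets the old law there. This turns an
integral against a modified product into an iterated integral over the original one. -/
lemma pi_prod_map_update [∀ i, IsProbabilityMeasure (ν i)] (i : ι) (ξ : Measure E)
    [IsProbabilityMeasure ξ] :
    ((Measure.pi ν).prod ξ).map (fun p => Function.update p.1 i p.2)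
      = Measure.pi (Function.update ν i ξ) := by
  have := isProbabilityMeasure_update (ν := ν) inferInstance i ξ
  symm
  refine Measure.pi_eq fun s hs => ?_
  rw [Measure.map_apply (measurable_update_pair i) (.univ_pi hs)]
  have : (fun p : (ι → E) × E => Function.update p.1 i p.2) ⁻¹' (Set.univ.pi s)
      = (Set.univ.pi (Function.update s i Set.univ)) ×ˢ s i := by
    ext p
    simp only [Set.mem_preimage, Set.mem_univ_pi, Set.mem_prod]
    constructor
    · intro h
      refine ⟨fun j => ?_, by simpa using h i⟩
      rcases eq_or_ne j i with rfl | hj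
      · simp
      · simpa [hj] using h j
    · rintro ⟨h, hi⟩ j
      rcases eq_or_ne j i with rfl | hj
      · simpa
      · simpa [hj] using h j
  rw [this, Measure.prod_prod, Measure.pi_pi, ← Finset.mul_prod_erase _ _ (Finset.mem_univ i),
    ← Finset.mul_prod_erase (a := i) Finset.univ _ (Finset.mem_univ i)]
  simp only [Function.update_self, measure_univ, one_mul]
  rw [mul_comm]
  congr 1
  refine Finset.prod_congr rfl fun j hj => ?_
  simp [Finset.ne_of_mem_erase hj]

lemma integral_pi_update {k : ℕ} (hk : k ≤ 2) {G : (ι → E) → ℝ} (hG : Growth k G)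
    (hν : ∀ i, SecondMoment (ν i)) (i : ι) {ξ : Measure E} (hξ : SecondMoment ξ) :
    ∫ z, G z ∂Measure.pi (Function.update ν i ξ)
      = ∫ z, ∫ w, G (Function.update z i w) ∂ξ ∂Measure.pi ν := by
  have := fun i => (hν i).1
  have := hξ.1
  have hint := hG.integrable hk (SecondMoment.update hν i hξ)
  rw [← pi_prod_map_update] at hint ⊢
  have hm := measurable_update_pair (E := E) i
  rw [integral_map hm.aemeasurable hint.aestronglyMeasurable]
  rw [integrable_map_measure hint.aestronglyMeasurable hm.aemeasurable] at hint
  exact integral_prod _ hint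

lemma one_add_sum_update_le (z : ι → E) (i : ι) (w : E) :
    1 + ∑ j, ‖Function.update z i w j‖ ≤ (1 + ∑ j, ‖z j‖) * (1 + ‖w‖) := by
  have h1 : ∑ j, ‖Function.update z i w j‖ ≤ ∑ j, ‖z j‖ + ‖w‖ := by
    rw [← Finset.add_sum_erase _ _ (Finset.mem_univ i),
      ← Finset.add_sum_erase Finset.univ (fun j => ‖z j‖) (Finset.mem_univ i)]
    have : ∑ j ∈ Finset.univ.erase i, ‖Function.update z i w j‖
        = ∑ j ∈ Finset.univ.erase i, ‖z j‖ :=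
      Finset.sum_congr rfl fun j hj => by simp [Finset.ne_of_mem_erase hj]
    rw [this, Function.update_self]
    linarith [norm_nonneg (z i)]
  have h2 : 0 ≤ ∑ j, ‖z j‖ := Finset.sum_nonneg fun _ _ => norm_nonneg _
  nlinarith [norm_nonneg w]

lemma Growth.update {k : ℕ} {G : (ι → E) → ℝ} (hG : Growth k G) (i : ι) (w : E) :
    Growth k (fun z => G (Function.update z i w)) := by
  obtain ⟨mG, C, hC, hGb⟩ := hG
  refine ⟨mG.comp ((measurable_update_pair i).comp (measurable_id.prodMk measurable_const)),
    C * (1 + ‖w‖) ^ k, by positivity, fun z => (hGb _).trans ?_⟩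
  rw [mul_assoc, ← mul_pow, mul_comm (1 + ‖w‖)]
  have := one_add_sum_update_le z i w
  have := one_le_one_add_sum (Function.update z i w)
  gcongr

lemma SecondMoment.integrable_pow {ξ : Measure E} (hξ : SecondMoment ξ) {k : ℕ} (hk : k ≤ 2) :
    Integrable (fun w : E => (1 + ‖w‖) ^ k) ξ := by
  have := hξ.1
  have h2 : MemLp (fun w : E => 1 + ‖w‖) 2 ξ := (memLp_const (1 : ℝ)).add hξ.2
  have h := h2.integrable_sq
  refine h.mono' (h2.aestronglyMeasurable.pow k) (.of_forall fun w => ?_)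
  rw [Real.norm_eq_abs, abs_of_nonneg (by positivity)]
  exact pow_le_pow_right₀ (by linarith [norm_nonneg w]) hk

lemma Growth.integrable_update {k : ℕ} (hk : k ≤ 2) {G : (ι → E) → ℝ} (hG : Growth k G) (i : ι)
    {ξ : Measure E} (hξ : SecondMoment ξ) (z : ι → E) :
    Integrable (fun w => G (Function.update z i w)) ξ := by
  obtain ⟨mG, C, hC, hGb⟩ := hG
  refine ((hξ.integrable_pow hk).const_mul (C * (1 + ∑ j, ‖z j‖) ^ k)).mono'
    (mG.comp (measurable_update z)).aestronglyMeasurable (.of_forall fun w => ?_)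
  refine (hGb _).trans ?_
  rw [mul_assoc, ← mul_pow]
  have := one_add_sum_update_le z i w
  have := one_le_one_add_sum (Function.update z i w)
  gcongr

lemma Growth.integral_update {k : ℕ} (hk : k ≤ 2) {G : (ι → E) → ℝ} (hG : Growth k G) (i : ι)
    {ξ : Measure E} (hξ : SecondMoment ξ) :
    Growth k (fun z => ∫ w, G (Function.update z i w) ∂ξ) := by
  have := hξ.1
  obtain ⟨mG, C, hC, hGb⟩ := hG
  have hm : StronglyMeasurable (Function.uncurry fun z w => G (Function.update z i w)) :=
    (mG.comp (measurable_update_pair i)).stronglyMeasurable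
  refine ⟨hm.integral_prod_right.measurable,
    C * ∫ w, (1 + ‖w‖) ^ k ∂ξ, ?_, fun z => ?_⟩
  · exact mul_nonneg hC (integral_nonneg fun w => by positivity)
  · rw [mul_assoc, mul_comm (∫ w, (1 + ‖w‖) ^ k ∂ξ), ← mul_assoc, ← integral_const_mul]
    rw [← Real.norm_eq_abs]
    refine norm_integral_le_of_norm_le ((hξ.integrable_pow hk).const_mul _)
      (.of_forall fun w => ?_)
    refine (hGb _).trans ?_
    rw [mul_assoc, ← mul_pow]
    have := one_add_sum_update_le z i w
    have := one_le_one_add_sum (Function.update z i w)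
    gcongr

/-- The mixture `(1 - t) ν₀ + t ν₁` of two measures. -/
def mix {E : Type*} [MeasurableSpace E] (ν₀ ν₁ : Measure E) (t : ℝ) : Measure E :=
  ENNReal.ofReal (1 - t) • ν₀ + ENNReal.ofReal t • ν₁

@[simp] lemma mix_zero {E : Type*} [MeasurableSpace E] (ν₀ ν₁ : Measure E) :
    mix ν₀ ν₁ 0 = ν₀ := by simp [mix]

@[simp] lemma mix_one {E : Type*} [MeasurableSpace E] (ν₀ ν₁ : Measure E) :
    mix ν₀ ν₁ 1 = ν₁ := by simp [mix]

lemma isProbabilityMeasure_mix {E : Type*} [MeasurableSpace E] (ν₀ ν₁ : Measure E)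
    [IsProbabilityMeasure ν₀] [IsProbabilityMeasure ν₁] {t : ℝ} (h0 : 0 ≤ t) (h1 : t ≤ 1) :
    IsProbabilityMeasure (mix ν₀ ν₁ t) := by
  constructor
  simp only [mix, Measure.coe_add, Measure.coe_smul, Pi.add_apply, Pi.smul_apply, measure_univ,
    smul_eq_mul, mul_one]
  rw [← ENNReal.ofReal_add (by linarith) h0]
  simp

lemma SecondMoment.mix {ν₀ ν₁ : Measure E} (h₀ : SecondMoment ν₀) (h₁ : SecondMoment ν₁) {t : ℝ}
    (h0 : 0 ≤ t) (h1 : t ≤ 1) : SecondMoment (mix ν₀ ν₁ t) := by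
  have := h₀.1
  have := h₁.1
  refine ⟨isProbabilityMeasure_mix _ _ h0 h1, ?_⟩
  have a0 := h₀.2.integrable_sq.smul_measure (ENNReal.ofReal_ne_top (r := 1 - t))
  have a1 := h₁.2.integrable_sq.smul_measure (ENNReal.ofReal_ne_top (r := t))
  refine (memLp_two_iff_integrable_sq ?_).2 (a0.add_measure a1)
  exact (h₀.2.aestronglyMeasurable.smul_measure _).add_measure
    (h₁.2.aestronglyMeasurable.smul_measure _)

lemma integral_mix {E : Type*} [MeasurableSpace E] {ν₀ ν₁ : Measure E} {f : E → ℝ}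
    (h₀ : Integrable f ν₀) (h₁ : Integrable f ν₁) {t : ℝ} (h0 : 0 ≤ t) (h1 : t ≤ 1) :
    ∫ w, f w ∂mix ν₀ ν₁ t = (1 - t) * ∫ w, f w ∂ν₀ + t * ∫ w, f w ∂ν₁ := by
  rw [mix, integral_add_measure (h₀.smul_measure ENNReal.ofReal_ne_top)
    (h₁.smul_measure ENNReal.ofReal_ne_top), integral_smul_measure, integral_smul_measure,
    ENNReal.toReal_ofReal (by linarith), ENNReal.toReal_ofReal h0]
  simp

/-- Each coordinate chooses its law independently: expand the product of sums over the set `S` of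
coordinates drawn from `ν₀`. -/
lemma pi_mix (ν₀ ν₁ : Measure E) [IsProbabilityMeasure ν₀] [IsProbabilityMeasure ν₁] {t : ι → ℝ}
    (h0 : ∀ i, 0 ≤ t i) (h1 : ∀ i, t i ≤ 1) :
    Measure.pi (fun i => mix ν₀ ν₁ (t i))
      = ∑ S ∈ (Finset.univ : Finset ι).powerset,
        ENNReal.ofReal ((∏ i ∈ S, (1 - t i)) * ∏ i ∈ Finset.univ \ S, t i) •
          Measure.pi (fun i => if i ∈ S then ν₀ else ν₁) := by
  have := fun i => isProbabilityMeasure_mix ν₀ ν₁ (h0 i) (h1 i)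
  have hp : ∀ (S : Finset ι) (i : ι), IsProbabilityMeasure (if i ∈ S then ν₀ else ν₁) := by
    intro S i
    split_ifs <;> infer_instance
  refine Measure.pi_eq fun s hs => ?_
  simp only [Measure.coe_finsetSum, Finset.sum_apply, Measure.smul_apply, smul_eq_mul, mix,
    Measure.coe_add, Pi.add_apply, Finset.prod_add]
  refine Finset.sum_congr rfl fun S _ => ?_
  rw [Measure.pi_pi, ← Finset.prod_sdiff (Finset.subset_univ S), ENNReal.ofReal_mul
    (Finset.prod_nonneg fun i _ => by linarith [h1 i]),
    ENNReal.ofReal_prod_of_nonneg fun i _ => by linarith [h1 i],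
    ENNReal.ofReal_prod_of_nonneg fun i _ => h0 i, Finset.prod_mul_distrib, Finset.prod_mul_distrib]
  have e1 : ∏ i ∈ S, (if i ∈ S then ν₀ else ν₁) (s i) = ∏ i ∈ S, ν₀ (s i) :=
    Finset.prod_congr rfl fun i hi => by simp [hi]
  have e2 : ∏ i ∈ Finset.univ \ S, (if i ∈ S then ν₀ else ν₁) (s i)
      = ∏ i ∈ Finset.univ \ S, ν₁ (s i) :=
    Finset.prod_congr rfl fun i hi => by simp [(Finset.mem_sdiff.1 hi).2]
  rw [e1, e2]
  ring

/-- The integral of `G` under a product of mixtures, as a polynomial in the mixing weights. -/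
def mixPoly (J : Finset ι → ℝ) (t : ι → ℝ) : ℝ :=
  ∑ S ∈ (Finset.univ : Finset ι).powerset,
    ((∏ i ∈ S, (1 - t i)) * ∏ i ∈ Finset.univ \ S, t i) * J S

lemma integral_pi_mix {k : ℕ} (hk : k ≤ 2) {G : (ι → E) → ℝ} (hG : Growth k G)
    {ν₀ ν₁ : Measure E} (h₀ : SecondMoment ν₀) (h₁ : SecondMoment ν₁) {t : ι → ℝ}
    (h0 : ∀ i, 0 ≤ t i) (h1 : ∀ i, t i ≤ 1) :
    ∫ z, G z ∂Measure.pi (fun i => mix ν₀ ν₁ (t i))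
      = mixPoly (fun S => ∫ z, G z ∂Measure.pi (fun i => if i ∈ S then ν₀ else ν₁)) t := by
  have := h₀.1
  have := h₁.1
  have hS : ∀ S : Finset ι, Integrable G (Measure.pi (fun i => if i ∈ S then ν₀ else ν₁)) :=
    fun S => hG.integrable hk fun i => by split_ifs <;> assumption
  rw [pi_mix ν₀ ν₁ h0 h1, integral_finsetSum_measure fun S _ =>
    (hS S).smul_measure ENNReal.ofReal_ne_top]
  refine Finset.sum_congr rfl fun S _ => ?_
  rw [integral_smul_measure, ENNReal.toReal_ofReal, smul_eq_mul]
  exact mul_nonneg (Finset.prod_nonneg fun i _ => by linarith [h1 i])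
    (Finset.prod_nonneg fun i _ => h0 i)

lemma mixPoly_update (J : Finset ι → ℝ) (t : ι → ℝ) (i : ι) (r : ℝ) :
    mixPoly J (Function.update t i r)
      = (1 - r) * mixPoly J (Function.update t i 0) + r * mixPoly J (Function.update t i 1) := by
  simp only [mixPoly, Finset.mul_sum, ← Finset.sum_add_distrib]
  refine Finset.sum_congr rfl fun S _ => ?_
  by_cases hi : i ∈ S
  · have e1 : ∀ r, ∏ j ∈ Finset.univ \ S, Function.update t i r j
        = ∏ j ∈ Finset.univ \ S, t j := fun r => Finset.prod_congr rfl fun j hj => by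
      rw [Function.update_of_ne]
      rintro rfl
      exact (Finset.mem_sdiff.1 hj).2 hi
    have e2 : ∀ r, ∏ j ∈ S, (1 - Function.update t i r j)
        = (1 - r) * ∏ j ∈ S.erase i, (1 - t j) := fun r => by
      rw [← Finset.mul_prod_erase _ _ hi, Function.update_self]
      congr 1
      exact Finset.prod_congr rfl fun j hj => by
        rw [Function.update_of_ne (Finset.ne_of_mem_erase hj)]
    simp only [e1, e2]
    ring
  · have hi' : i ∈ Finset.univ \ S := by simpa using hi
    have e1 : ∀ r, ∏ j ∈ S, (1 - Function.update t i r j)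
        = ∏ j ∈ S, (1 - t j) := fun r => Finset.prod_congr rfl fun j hj => by
      rw [Function.update_of_ne]
      rintro rfl
      exact hi hj
    have e2 : ∀ r, ∏ j ∈ Finset.univ \ S, Function.update t i r j
        = r * ∏ j ∈ (Finset.univ \ S).erase i, t j := fun r => by
      rw [← Finset.mul_prod_erase _ _ hi', Function.update_self]
      congr 1
      exact Finset.prod_congr rfl fun j hj => by
        rw [Function.update_of_ne (Finset.ne_of_mem_erase hj)]
    simp only [e1, e2]
    ring

lemma differentiable_mixPoly (J : Finset ι → ℝ) : Differentiable ℝ (mixPoly J) := by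
  unfold mixPoly
  fun_prop

/-- A Russo-type formula. The polynomial is affine in each weight separately, so a partial
derivative is a difference of endpoint values, and the chain rule along the diagonal sums them. -/
lemma hasDerivAt_mixPoly (J : Finset ι → ℝ) (t : ℝ) :
    HasDerivAt (fun r => mixPoly J (fun _ => r))
      (∑ i, (mixPoly J (Function.update (fun _ => t) i 1)
        - mixPoly J (Function.update (fun _ => t) i 0))) t := by
  set D := fderiv ℝ (mixPoly J) (fun _ => t) with hD
  have hF : HasFDerivAt (mixPoly J) D (fun _ => t) := (differentiable_mixPoly J _).hasFDerivAt
  have h1 : HasDerivAt (fun r : ℝ => (fun _ : ι => r)) (fun _ => (1 : ℝ)) t :=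
    hasDerivAt_pi.2 fun _ => hasDerivAt_id t
  have h2 := hF.comp_hasDerivAt t h1
  refine h2.congr_deriv ?_
  rw [show (fun _ : ι => (1 : ℝ)) = ∑ i, Pi.single i 1 from (Finset.univ_sum_single _).symm, map_sum]
  refine Finset.sum_congr rfl fun i _ => ?_
  have h3 : HasDerivAt (fun r => Function.update (fun _ : ι => t) i r) (Pi.single i 1) t :=
    hasDerivAt_update _ _ _
  have hF' : HasFDerivAt (mixPoly J) D (Function.update (fun _ : ι => t) i t) := by
    rwa [Function.update_eq_self_iff.2 rfl]
  have h4 := hF'.comp_hasDerivAt t h3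
  have h5 : HasDerivAt (fun r => mixPoly J (Function.update (fun _ => t) i r))
      (mixPoly J (Function.update (fun _ => t) i 1)
        - mixPoly J (Function.update (fun _ => t) i 0)) t := by
    have := (((hasDerivAt_id t).const_sub 1).mul_const
      (mixPoly J (Function.update (fun _ => t) i 0))).fun_add
      ((hasDerivAt_id t).mul_const (mixPoly J (Function.update (fun _ => t) i 1)))
    refine (this.congr_of_eventuallyEq (.of_forall fun r => mixPoly_update J _ i r)).congr_deriv ?_
    ring
  exact h4.unique h5

/-- Comparison of two product measures through the product of their mixtures. -/
lemma integral_pi_le_of_mix {k : ℕ} (hk : k ≤ 2) {G : (ι → E) → ℝ} (hG : Growth k G)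
    {ν₀ ν₁ : Measure E} (h₀ : SecondMoment ν₀) (h₁ : SecondMoment ν₁) {ε : ℝ}
    (h : ∀ t, 0 ≤ t → t ≤ 1 → -ε ≤ ∑ i, ∫ z, (∫ w, G (Function.update z i w) ∂ν₁
      - ∫ w, G (Function.update z i w) ∂ν₀) ∂Measure.pi (fun _ => mix ν₀ ν₁ t)) :
    ∫ z, G z ∂Measure.pi (fun _ => ν₀) ≤ ∫ z, G z ∂Measure.pi (fun _ => ν₁) + ε := by
  set J : Finset ι → ℝ := fun S => ∫ z, G z ∂Measure.pi (fun i => if i ∈ S then ν₀ else ν₁)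
  have hJ : ∀ t : ι → ℝ, (∀ i, 0 ≤ t i) → (∀ i, t i ≤ 1) →
      ∫ z, G z ∂Measure.pi (fun i => mix ν₀ ν₁ (t i)) = mixPoly J t :=
    fun t => integral_pi_mix hk hG h₀ h₁
  have hu : ∀ t, 0 ≤ t → t ≤ 1 → ∀ i, ∀ r, 0 ≤ r → r ≤ 1 →
      mixPoly J (Function.update (fun _ => t) i r)
        = ∫ z, ∫ w, G (Function.update z i w) ∂mix ν₀ ν₁ r
          ∂Measure.pi (fun _ => mix ν₀ ν₁ t) := fun t h0 h1 i r hr0 hr1 => by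
    rw [← hJ, ← integral_pi_update hk hG (fun _ => h₀.mix h₁ h0 h1) i (h₀.mix h₁ hr0 hr1)]
    · congr 2
      ext1 j
      rcases eq_or_ne j i with rfl | hj <;> simp [*]
    · intro j
      rcases eq_or_ne j i with rfl | hj <;> simp [*]
    · intro j
      rcases eq_or_ne j i with rfl | hj <;> simp [*]
  have hd : ∀ t, 0 ≤ t → t ≤ 1 → -ε ≤ ∑ i, (mixPoly J (Function.update (fun _ => t) i 1)
        - mixPoly J (Function.update (fun _ => t) i 0)) := fun t h0 h1 => by
    refine (h t h0 h1).trans_eq (Finset.sum_congr rfl fun i _ => ?_)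
    rw [hu t h0 h1 i 1 zero_le_one le_rfl, hu t h0 h1 i 0 le_rfl zero_le_one, mix_one, mix_zero]
    have hm : ∀ _ : ι, SecondMoment (mix ν₀ ν₁ t) := fun _ => h₀.mix h₁ h0 h1
    exact integral_sub ((hG.integral_update hk i h₁).integrable hk hm)
      ((hG.integral_update hk i h₀).integrable hk hm)
  -- The hypothesis says that the derivative in the common mixing weight is at least `-ε`; the mean
  -- value inequality on `[0, 1]` compares the two endpoints.
  have h01 := (convex_Icc (0 : ℝ) 1).mul_sub_le_image_sub_of_le_deriv
    (f := fun r => mixPoly J (fun _ => r)) (C := -ε)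
    (fun t _ => (hasDerivAt_mixPoly J t).continuousAt.continuousWithinAt)
    (fun t _ => (hasDerivAt_mixPoly J t).differentiableAt.differentiableWithinAt)
    (fun t ht => by
      rw [interior_Icc] at ht
      rw [(hasDerivAt_mixPoly J t).deriv]
      exact hd t ht.1.le ht.2.le) 0 (by simp) 1 (by simp) zero_le_one
  have e0 := hJ (fun _ => 0) (fun _ => le_rfl) (fun _ => zero_le_one)
  have e1 := hJ (fun _ => 1) (fun _ => zero_le_one) (fun _ => le_rfl)
  simp only [mix_zero, mix_one] at e0 e1
  rw [e0, e1]
  linarith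

end Product

/-! ### Hoeffding decomposition under resampling, and the variance bound from noise stability. -/

section Hoeffding

variable {ι : Type*} [Fintype ι]

lemma SecondMoment.of_fst_snd {ξ : Measure (ℝ × ℝ)} [IsProbabilityMeasure ξ]
    (h1 : MemLp (fun w : ℝ × ℝ => w.1) 2 ξ) (h2 : MemLp (fun w : ℝ × ℝ => w.2) 2 ξ) :
    SecondMoment ξ := by
  refine ⟨inferInstance, (h1.norm.add h2.norm).mono' (by fun_prop) (.of_forall fun w => ?_)⟩
  rw [norm_norm, Prod.norm_def]
  exact max_le_add_of_nonneg (norm_nonneg _) (norm_nonneg _)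

lemma SecondMoment.memLp_id {μ : Measure ℝ} (h : SecondMoment μ) :
    MemLp (fun a : ℝ => a) 2 μ :=
  (memLp_norm_iff (by fun_prop)).1 h.2

lemma SecondMoment.prod {μ μ' : Measure ℝ} (h : SecondMoment μ) (h' : SecondMoment μ') :
    SecondMoment (μ.prod μ') := by
  have := h.1
  have := h'.1
  exact .of_fst_snd (h.memLp_id.comp_measurePreserving measurePreserving_fst)
    (h'.memLp_id.comp_measurePreserving measurePreserving_snd)

lemma measurable_diag : Measurable (fun a : ℝ => (a, a)) := by fun_prop

lemma SecondMoment.diag {μ : Measure ℝ} (h : SecondMoment μ) :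
    SecondMoment (μ.map fun a => (a, a)) := by
  have := h.1
  have := Measure.isProbabilityMeasure_map (μ := μ) measurable_diag.aemeasurable
  have hp : MeasurePreserving (fun a : ℝ => (a, a)) μ (μ.map fun a => (a, a)) :=
    ⟨measurable_diag, rfl⟩
  refine .of_fst_snd ?_ ?_
  · rw [memLp_map_measure_iff (by fun_prop) (by fun_prop)]
    exact h.memLp_id
  · rw [memLp_map_measure_iff (by fun_prop) (by fun_prop)]
    exact h.memLp_id

/-- The law of `(h, h')`, where `h'` equals `h` with probability `r` and is an independent copy of
`h` otherwise. -/
def coupl (μ : Measure ℝ) (r : ℝ) : Measure (ℝ × ℝ) :=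
  mix (μ.prod μ) (μ.map fun a => (a, a)) r

lemma secondMoment_coupl {μ : Measure ℝ} (h : SecondMoment μ) {r : ℝ} (h0 : 0 ≤ r) (h1 : r ≤ 1) :
    SecondMoment (coupl μ r) :=
  (h.prod h).mix h.diag h0 h1

lemma integral_coupl {μ : Measure ℝ} [SFinite μ] {f : ℝ × ℝ → ℝ} (hf : Measurable f)
    (h1 : Integrable f (μ.prod μ)) (h2 : Integrable (fun a => f (a, a)) μ) {r : ℝ} (hr0 : 0 ≤ r)
    (hr1 : r ≤ 1) :
    ∫ w, f w ∂coupl μ r = (1 - r) * ∫ w, f w ∂μ.prod μ + r * ∫ a, f (a, a) ∂μ := by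
  rw [coupl, integral_mix h1 _ hr0 hr1, integral_map (by fun_prop) hf.aestronglyMeasurable]
  rw [integrable_map_measure hf.aestronglyMeasurable (by fun_prop)]
  exact h2

lemma Growth.comp_lipschitz {E E' : Type*} [NormedAddCommGroup E] [MeasurableSpace E]
    [NormedAddCommGroup E'] [MeasurableSpace E'] {k : ℕ} {F : (ι → E') → ℝ} (hF : Growth k F)
    {p : E → E'} (hp : Measurable p) (hn : ∀ w, ‖p w‖ ≤ ‖w‖) :
    Growth k (fun z : ι → E => F (fun i => p (z i))) := by
  obtain ⟨mF, C, hC, hFb⟩ := hF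
  refine ⟨mF.comp (measurable_pi_lambda _ fun i => hp.comp (measurable_pi_apply i)), C, hC,
    fun z => (hFb _).trans ?_⟩
  have : ∑ i, ‖p (z i)‖ ≤ ∑ i, ‖z i‖ := Finset.sum_le_sum fun i _ => hn _
  have : 0 ≤ ∑ i, ‖p (z i)‖ := Finset.sum_nonneg fun i _ => norm_nonneg _
  gcongr

lemma Growth.comp_fst {k : ℕ} {F : (ι → ℝ) → ℝ} (hF : Growth k F) :
    Growth k (fun z : ι → ℝ × ℝ => F (fun i => (z i).1)) :=
  hF.comp_lipschitz measurable_fst norm_fst_le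

lemma Growth.comp_snd {k : ℕ} {F : (ι → ℝ) → ℝ} (hF : Growth k F) :
    Growth k (fun z : ι → ℝ × ℝ => F (fun i => (z i).2)) :=
  hF.comp_lipschitz measurable_snd norm_snd_le

/-- The expectation of `F(x) F(x')` when the coordinates of `(x, x')` are independent with
laws `ν i`. -/
def pairInt (ν : ι → Measure (ℝ × ℝ)) (F : (ι → ℝ) → ℝ) : ℝ :=
  ∫ z, F (fun i => (z i).1) * F (fun i => (z i).2) ∂Measure.pi ν

variable [DecidableEq ι]

lemma fst_update (z : ι → ℝ × ℝ) (i : ι) (w : ℝ × ℝ) :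
    (fun j => (Function.update z i w j).1) = Function.update (fun j => (z j).1) i w.1 := by
  ext j
  rcases eq_or_ne j i with rfl | hj <;> simp [*]

lemma snd_update (z : ι → ℝ × ℝ) (i : ι) (w : ℝ × ℝ) :
    (fun j => (Function.update z i w j).2) = Function.update (fun j => (z j).2) i w.2 := by
  ext j
  rcases eq_or_ne j i with rfl | hj <;> simp [*]

variable (μ : Measure ℝ)

/-- Integration over the coordinate `i`. -/
def avg (i : ι) (F : (ι → ℝ) → ℝ) (x : ι → ℝ) : ℝ := ∫ a, F (Function.update x i a) ∂μ

/-- The fluctuation of `F` in the coordinate `i`. -/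
def dif (i : ι) (F : (ι → ℝ) → ℝ) (x : ι → ℝ) : ℝ := F x - avg μ i F x

variable {μ} (hμ : SecondMoment μ)
include hμ

lemma Growth.avg {F : (ι → ℝ) → ℝ} (hF : Growth 1 F) (i : ι) : Growth 1 (avg μ i F) :=
  hF.integral_update one_le_two i hμ

lemma Growth.dif {F : (ι → ℝ) → ℝ} (hF : Growth 1 F) (i : ι) : Growth 1 (dif μ i F) :=
  hF.sub (hF.avg hμ i)

omit hμ in
lemma avg_update (F : (ι → ℝ) → ℝ) (i : ι) (x : ι → ℝ) (a : ℝ) :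
    avg μ i F (Function.update x i a) = avg μ i F x := by
  simp [avg]

lemma avg_avg_self (F : (ι → ℝ) → ℝ) (i : ι) : avg μ i (avg μ i F) = avg μ i F := by
  have := hμ.1
  ext x
  rw [avg]
  simp [avg_update]

lemma avg_dif {F : (ι → ℝ) → ℝ} (hF : Growth 1 F) (i j : ι) :
    avg μ i (dif μ j F) = fun x => avg μ i F x - avg μ i (avg μ j F) x := by
  ext x
  exact integral_sub (hF.integrable_update one_le_two i hμ x)
    ((hF.avg hμ j).integrable_update one_le_two i hμ x)

lemma avg_avg_comm {F : (ι → ℝ) → ℝ} (hF : Growth 1 F) {i j : ι} (hij : i ≠ j) :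
    avg μ i (avg μ j F) = avg μ j (avg μ i F) := by
  have := hμ.1
  ext x
  have hint : Integrable (Function.uncurry fun a b =>
      F (Function.update (Function.update x i a) j b)) (μ.prod μ) := by
    obtain ⟨mF, C, hC, hFb⟩ := hF
    have hm : Measurable (Function.uncurry fun a b =>
        Function.update (Function.update x i a) j b) :=
      (measurable_update_pair j).comp
        (((measurable_update x).comp measurable_fst).prodMk measurable_snd)
    have h2 : Integrable (fun p : ℝ × ℝ =>
        C * (1 + ∑ k, ‖x k‖) * ((1 + ‖p.1‖) * (1 + ‖p.2‖))) (μ.prod μ) := by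
      refine Integrable.const_mul (Integrable.mul_prod (f := fun a : ℝ => 1 + ‖a‖)
        (g := fun a : ℝ => 1 + ‖a‖) ?_ ?_) _ <;>
      simpa using hμ.integrable_pow one_le_two
    refine h2.mono' (mF.comp hm).aestronglyMeasurable (.of_forall fun p => (hFb _).trans ?_)
    rw [pow_one, mul_assoc]
    refine mul_le_mul_of_nonneg_left ((one_add_sum_update_le _ _ _).trans ?_) hC
    rw [← mul_assoc]
    exact mul_le_mul_of_nonneg_right (one_add_sum_update_le _ _ _) (by positivity)
  have := integral_integral_swap hint
  simp only [avg]
  rw [this]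
  simp_rw [Function.update_comm hij]

lemma avg_dif_comm {F : (ι → ℝ) → ℝ} (hF : Growth 1 F) {i j : ι} (hij : i ≠ j) :
    avg μ i (dif μ j F) = dif μ j (avg μ i F) := by
  rw [avg_dif hμ hF, avg_avg_comm hμ hF hij]
  rfl

lemma dif_dif_comm {F : (ι → ℝ) → ℝ} (hF : Growth 1 F) {i j : ι} (hij : i ≠ j) :
    dif μ i (dif μ j F) = dif μ j (dif μ i F) := by
  ext x
  have h1 := congrFun (avg_dif_comm hμ hF hij) x
  have h2 := congrFun (avg_dif_comm hμ hF hij.symm) x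
  have h3 := congrFun (avg_avg_comm hμ hF hij) x
  simp only [dif] at h1 h2 ⊢
  linarith

lemma avg_dif_self {F : (ι → ℝ) → ℝ} (hF : Growth 1 F) (i : ι) :
    avg μ i (dif μ i F) = fun _ => 0 := by
  rw [avg_dif hμ hF, avg_avg_self hμ]
  simp

lemma dif_dif_self {F : (ι → ℝ) → ℝ} (hF : Growth 1 F) (i : ι) :
    dif μ i (dif μ i F) = dif μ i F := by
  ext x
  rw [dif, avg_dif_self hμ hF, sub_zero]

variable {ν : ι → Measure (ℝ × ℝ)} (hν : ∀ i, SecondMoment (ν i))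
include hν

lemma Growth.memLp_update {F : (ι → ℝ) → ℝ} (hF : Growth 1 F) (i : ι) (x : ι → ℝ) :
    MemLp (fun a => F (Function.update x i a)) 2 μ := by
  refine (memLp_two_iff_integrable_sq
    (hF.1.comp (measurable_update x)).aestronglyMeasurable).2 ?_
  have := (hF.mul hF).integrable_update le_rfl i hμ x
  simpa [sq] using this

lemma pairInt_update_coupl {F : (ι → ℝ) → ℝ} (hF : Growth 1 F) (i : ι) {r : ℝ} (h0 : 0 ≤ r)
    (h1 : r ≤ 1) :
    pairInt (Function.update ν i (coupl μ r)) F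
      = ∫ z, ((1 - r) * (avg μ i F (fun j => (z j).1) * avg μ i F (fun j => (z j).2))
        + r * ∫ a, F (Function.update (fun j => (z j).1) i a)
          * F (Function.update (fun j => (z j).2) i a) ∂μ) ∂Measure.pi ν := by
  have := hμ.1
  rw [pairInt, integral_pi_update le_rfl (hF.comp_fst.mul hF.comp_snd) hν i
    (secondMoment_coupl hμ h0 h1)]
  congr 1
  ext z
  simp only [fst_update, snd_update]
  have m1 := hF.1.comp (measurable_update (fun j => (z j).1) (a := i))
  have m2 := hF.1.comp (measurable_update (fun j => (z j).2) (a := i))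
  have m12 : Measurable fun w : ℝ × ℝ => F (Function.update (fun j => (z j).1) i w.1)
      * F (Function.update (fun j => (z j).2) i w.2) :=
    (m1.comp measurable_fst).mul (m2.comp measurable_snd)
  rw [integral_coupl m12 _ _ h0 h1]
  · simp only [avg]
    rw [← integral_prod_mul (fun a => F (Function.update (fun j => (z j).1) i a))
      (fun a => F (Function.update (fun j => (z j).2) i a))]
  · exact (hF.integrable_update one_le_two i hμ _).mul_prod
      (hF.integrable_update one_le_two i hμ _)
  · exact (hF.memLp_update hμ hν i _).integrable_mul (hF.memLp_update hμ hν i _)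

/-- Split `F` into `avg` and `dif` in coordinate `i`. If the coordinate is redrawn, the `dif` parts
are independent of mean zero and drop out; if it is kept, which has probability `r`, they contribute
their product. The cross terms vanish in both cases. For `avg` the law at `i` is irrelevant, so
`coupl μ 1` can be used in both terms. -/
lemma pairInt_update {F : (ι → ℝ) → ℝ} (hF : Growth 1 F) (i : ι) {r : ℝ} (h0 : 0 ≤ r)
    (h1 : r ≤ 1) :
    pairInt (Function.update ν i (coupl μ r)) F
      = pairInt (Function.update ν i (coupl μ 1)) (avg μ i F)
        + r * pairInt (Function.update ν i (coupl μ 1)) (dif μ i F) := by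
  have := hμ.1
  rw [pairInt_update_coupl hμ hν hF i h0 h1,
    pairInt_update_coupl hμ hν (hF.avg hμ i) i zero_le_one le_rfl,
    pairInt_update_coupl hμ hν (hF.dif hμ i) i zero_le_one le_rfl]
  have hG : Growth 2 (fun z : ι → ℝ × ℝ => ∫ a, F (Function.update (fun j => (z j).1) i a)
          * F (Function.update (fun j => (z j).2) i a) ∂μ) := by
    have := (hF.comp_fst.mul hF.comp_snd).integral_update le_rfl i hμ.diag
    refine (congrArg (Growth 2) (funext fun z => ?_)).mp this
    have hm : Measurable fun w : ℝ × ℝ => F (fun j => (Function.update z i w j).1)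
        * F (fun j => (Function.update z i w j).2) :=
      (hF.comp_fst.mul hF.comp_snd).1.comp (measurable_update z)
    rw [integral_map (by fun_prop) hm.aestronglyMeasurable]
    simp only [fst_update, snd_update]
  have hA : Growth 2 (fun z : ι → ℝ × ℝ => avg μ i F (fun j => (z j).1)
      * avg μ i F (fun j => (z j).2)) := (hF.avg hμ i).comp_fst.mul (hF.avg hμ i).comp_snd
  have hz : ∀ x x' : ι → ℝ, ∫ a, dif μ i F (Function.update x i a)
      * dif μ i F (Function.update x' i a) ∂μ
      = ∫ a, F (Function.update x i a) * F (Function.update x' i a) ∂μ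
        - avg μ i F x * avg μ i F x' := fun x x' => by
    simp only [dif, avg_update]
    have i1 := hF.integrable_update one_le_two i hμ x
    have i2 := hF.integrable_update one_le_two i hμ x'
    have i3 := (hF.memLp_update hμ hν i x).integrable_mul (hF.memLp_update hμ hν i x')
    have e : ∀ a, (F (Function.update x i a) - avg μ i F x)
        * (F (Function.update x' i a) - avg μ i F x')
        = F (Function.update x i a) * F (Function.update x' i a)
          - (avg μ i F x * F (Function.update x' i a) + avg μ i F x' * F (Function.update x i a))
          + avg μ i F x * avg μ i F x' := fun a => by ring
    simp only [e]
    have i4 := (i2.const_mul (avg μ i F x)).add (i1.const_mul (avg μ i F x'))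
    rw [integral_add, integral_sub, integral_add, integral_const_mul, integral_const_mul]
    · simp only [integral_const, probReal_univ, smul_eq_mul, one_mul]
      simp only [avg]
      ring
    exacts [i2.const_mul _, i1.const_mul _, i3, i4, i3.sub i4, integrable_const _]
  simp only [sub_self, zero_mul, one_mul, zero_add, avg_update, hz]
  simp only [integral_const, probReal_univ, smul_eq_mul, one_mul]
  have iG := hG.integrable le_rfl hν
  have iA := hA.integrable le_rfl hν
  rw [integral_add (iA.const_mul _) (iG.const_mul _), integral_sub iG iA, integral_const_mul,
    integral_const_mul]
  ring

lemma pairInt_update_dif {F : (ι → ℝ) → ℝ} (hF : Growth 1 F) (i : ι) {r : ℝ} (h0 : 0 ≤ r)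
    (h1 : r ≤ 1) :
    pairInt (Function.update ν i (coupl μ r)) (dif μ i F)
      = r * pairInt (Function.update ν i (coupl μ 1)) (dif μ i F) := by
  rw [pairInt_update hμ hν (hF.dif hμ i) i h0 h1, avg_dif_self hμ hF, dif_dif_self hμ hF]
  simp [pairInt]

omit hν

omit [DecidableEq ι] in
lemma pi_diag : Measure.pi (fun _ : ι => coupl μ 1)
    = (Measure.pi fun _ : ι => μ).map (fun x i => (x i, x i)) := by
  have := hμ.1
  have : ∀ _ : ι, SigmaFinite (μ.map fun a => (a, a)) := fun _ => by
    have := hμ.diag.1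
    infer_instance
  simp only [coupl, mix_one]
  exact (Measure.pi_map_pi (f := fun (_ : ι) (a : ℝ) => (a, a)) (μ := fun _ => μ)
    (fun i => by fun_prop)).symm

lemma pairInt_diag {F : (ι → ℝ) → ℝ} (hF : Growth 1 F) :
    pairInt (fun _ => coupl μ 1) F = ∫ x, F x ^ 2 ∂Measure.pi fun _ => μ := by
  rw [pairInt, pi_diag hμ, integral_map (by fun_prop)
    (hF.comp_fst.mul hF.comp_snd).1.aestronglyMeasurable]
  simp only [sq]

/-- Coordinates outside `J` are shared by the two copies, so the induction starts from the constant
`∫ F²`, which is nonnegative. Inserting `i` gives `p + X q`, with `p` from `avg μ i F` and `q` from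
`dif μ i F`, and nonnegativity persists. The power of `r` counts the coordinates in `J` on which a
Hoeffding component depends, and the sum of the `dif μ j F` weights each component by this count. -/
theorem exists_polynomial {J : Finset ι} : ∀ {F : (ι → ℝ) → ℝ}, Growth 1 F →
    ∃ p : Polynomial ℝ, (∀ k, 0 ≤ p.coeff k) ∧ ∀ r, 0 ≤ r → r ≤ 1 →
      pairInt (fun j => if j ∈ J then coupl μ r else coupl μ 1) F = p.eval r ∧
      ∑ j ∈ J, pairInt (fun j => if j ∈ J then coupl μ r else coupl μ 1) (dif μ j F)
        = r * p.derivative.eval r := by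
  induction J using Finset.induction_on with
  | empty =>
    intro F hF
    refine ⟨Polynomial.C (∫ x, F x ^ 2 ∂Measure.pi fun _ => μ), fun k => ?_, fun r _ _ => ?_⟩
    · rw [Polynomial.coeff_C]
      split_ifs
      · exact integral_nonneg fun x => sq_nonneg _
      · exact le_rfl
    · simp [pairInt_diag hμ hF]
  | insert i J hi ih =>
    intro F hF
    obtain ⟨p, hp, hpe⟩ := ih (hF.avg hμ i)
    obtain ⟨q, hq, hqe⟩ := ih (hF.dif hμ i)
    refine ⟨p + Polynomial.X * q, fun k => ?_, fun r h0 h1 => ?_⟩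
    · rw [Polynomial.coeff_add]
      refine add_nonneg (hp k) ?_
      cases k with
      | zero => simp
      | succ k => simpa using hq k
    set ν : ι → Measure (ℝ × ℝ) := fun j => if j ∈ J then coupl μ r else coupl μ 1 with hνdef
    have hν : ∀ j, SecondMoment (ν j) := fun j => by
      simp only [hνdef]
      split_ifs
      exacts [secondMoment_coupl hμ h0 h1, secondMoment_coupl hμ zero_le_one le_rfl]
    have e1 : (fun j => if j ∈ insert i J then coupl μ r else coupl μ 1)
        = Function.update ν i (coupl μ r) := by
      ext1 j
      rcases eq_or_ne j i with rfl | hj <;> simp [*]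
    have e2 : Function.update ν i (coupl μ 1) = ν := by
      rw [Function.update_eq_self_iff]
      simp [hνdef, hi]
    obtain ⟨hp1, hp2⟩ := hpe r h0 h1
    obtain ⟨hq1, hq2⟩ := hqe r h0 h1
    rw [e1, Finset.sum_insert hi]
    constructor
    · rw [pairInt_update hμ hν hF i h0 h1, e2, hp1, hq1]
      simp
    · rw [pairInt_update_dif hμ hν hF i h0 h1, e2, hq1]
      -- In `r (p + X q)' = r p' + r q + r² q'`, the term `r q` comes from the new coordinate `i`.
      -- The other two come from the old coordinates, since operators in distinct coordinates
      -- commute.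
      have : ∀ j ∈ J, pairInt (Function.update ν i (coupl μ r)) (dif μ j F)
          = pairInt ν (dif μ j (avg μ i F)) + r * pairInt ν (dif μ j (dif μ i F)) := by
        intro j hj
        have hij : i ≠ j := by
          rintro rfl
          exact hi hj
        rw [pairInt_update hμ hν (hF.dif hμ j) i h0 h1, e2, avg_dif_comm hμ hF hij,
          dif_dif_comm hμ hF hij]
      rw [Finset.sum_congr rfl this, Finset.sum_add_distrib, ← Finset.mul_sum, hp2, hq2]
      simp
      ring

omit [DecidableEq ι] in
lemma pairInt_indep (F : (ι → ℝ) → ℝ) :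
    pairInt (fun _ => coupl μ 0) F = (∫ x, F x ∂Measure.pi fun _ => μ) ^ 2 := by
  have := hμ.1
  have h := measurePreserving_arrowProdEquivProdArrow ℝ ℝ ι (fun _ => μ) (fun _ => μ)
  simp only [coupl, mix_zero, pairInt]
  have := h.integral_comp (MeasurableEquiv.measurableEmbedding _) (fun p => F p.1 * F p.2)
  rw [integral_prod_mul, ← sq] at this
  exact this

/-- The variance is the sum of the coefficients `p_k` with `k ≥ 1`. For `k ≤ m` use `1 ≤ k ρ^k /
ρ^m`, and for `k > m` use `1 ≤ k / m`; positivity of the coefficients lets each level ignore the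
other bound. -/
theorem variance_le_of_noise {F : (ι → ℝ) → ℝ} (hF : Growth 1 F) {ρ : ℝ} (h0 : 0 < ρ) (h1 : ρ ≤ 1)
    {m : ℕ} (hm : 0 < m) :
    variance F (Measure.pi fun _ => μ)
      ≤ (ρ ^ m)⁻¹ * ∑ i, pairInt (fun _ => coupl μ ρ) (dif μ i F)
        + (m : ℝ)⁻¹ * ∑ i, pairInt (fun _ => coupl μ 1) (dif μ i F) := by
  have := hμ.1
  obtain ⟨p, hp, hpe⟩ := exists_polynomial (J := Finset.univ) hμ hF
  simp only [Finset.mem_univ, if_true] at hpe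
  have hmem : MemLp F 2 (Measure.pi fun _ : ι => μ) := by
    refine (memLp_two_iff_integrable_sq hF.1.aestronglyMeasurable).2 ?_
    simpa [sq] using (hF.mul hF).integrable le_rfl (fun _ : ι => hμ)
  rw [variance_eq_sub hmem]
  have hv1 := (hpe 1 zero_le_one le_rfl).1
  have hv0 := (hpe 0 le_rfl zero_le_one).1
  rw [pairInt_diag hμ hF] at hv1
  rw [pairInt_indep hμ F] at hv0
  rw [(hpe ρ h0.le h1).2, (hpe 1 zero_le_one le_rfl).2]
  have hd : ∀ r : ℝ, r * p.derivative.eval r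
      = ∑ k ∈ Finset.range (p.natDegree + 1), k * p.coeff k * r ^ k := fun r => by
    rw [Polynomial.derivative_eval, Polynomial.sum_over_range _ (by simp), Finset.mul_sum]
    refine Finset.sum_congr rfl fun k _ => ?_
    cases k with
    | zero => simp
    | succ k => simp; ring
  have hv : ∫ x, F x ^ 2 ∂(Measure.pi fun _ => μ) - (∫ x, F x ∂Measure.pi fun _ => μ) ^ 2
      = ∑ k ∈ Finset.range (p.natDegree + 1), (p.coeff k * 1 ^ k - p.coeff k * 0 ^ k) := by
    rw [hv1, hv0, Polynomial.eval_eq_sum_range, Polynomial.eval_eq_sum_range,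
      Finset.sum_sub_distrib]
  simp only [Pi.pow_apply]
  rw [hv, hd, hd, Finset.mul_sum, Finset.mul_sum, ← Finset.sum_add_distrib]
  refine Finset.sum_le_sum fun k _ => ?_
  have hk := hp k
  have hm' : (0 : ℝ) < m := by exact_mod_cast hm
  rcases Nat.eq_zero_or_pos k with rfl | hkp
  · simp
  have hk1 : (1 : ℝ) ≤ k := by exact_mod_cast hkp
  rw [zero_pow hkp.ne']
  rcases le_or_gt k m with hkm | hkm
  · have h2 : ρ ^ m ≤ ρ ^ k := pow_le_pow_of_le_one h0.le h1 hkm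
    have h3 : 1 ≤ (ρ ^ m)⁻¹ * ρ ^ k := by
      rw [inv_mul_eq_div, one_le_div (by positivity)]
      exact h2
    have h4 : p.coeff k ≤ (ρ ^ m)⁻¹ * (k * p.coeff k * ρ ^ k) := by
      calc p.coeff k = p.coeff k * 1 * 1 := by ring
        _ ≤ p.coeff k * k * ((ρ ^ m)⁻¹ * ρ ^ k) := by gcongr
        _ = _ := by ring
    have h5 : 0 ≤ (m : ℝ)⁻¹ * (k * p.coeff k * 1 ^ k) := by positivity
    simpa using h4.trans (le_add_of_nonneg_right h5)
  · have h3 : (1 : ℝ) ≤ (m : ℝ)⁻¹ * k := by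
      rw [inv_mul_eq_div, one_le_div hm']
      exact_mod_cast hkm.le
    have h4 : p.coeff k ≤ (m : ℝ)⁻¹ * (k * p.coeff k * 1 ^ k) := by
      calc p.coeff k = 1 * p.coeff k := by ring
        _ ≤ ((m : ℝ)⁻¹ * k) * p.coeff k := by gcongr
        _ = _ := by ring
    have h5 : 0 ≤ (ρ ^ m)⁻¹ * (k * p.coeff k * ρ ^ k) := by positivity
    simpa using h4.trans (le_add_of_nonneg_left h5)

end Hoeffding

/-! ### One-bond laws and pair laws, with their moment bounds. -/

/-- A centred probability law of unit variance with third absolute moment at most `M`. -/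
structure IsLaw (μ : Measure ℝ) (M : ℝ) : Prop where
  prob : IsProbabilityMeasure μ
  integrable_cube : Integrable (fun a : ℝ => |a| ^ 3) μ
  cube_le : ∫ a, |a| ^ 3 ∂μ ≤ M
  mean : ∫ a, a ∂μ = 0
  var : ∫ a, a ^ 2 ∂μ = 1

lemma pow_le_one_add_cube (x : ℝ) (hx : 0 ≤ x) : x ≤ 1 + x ^ 3 ∧ x ^ 2 ≤ 1 + x ^ 3 := by
  rcases le_total x 1 with h | h
  · have := pow_nonneg hx 3
    constructor <;> nlinarith
  · have h2 : x ^ 2 ≤ x ^ 3 := pow_le_pow_right₀ h (by norm_num)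
    constructor <;> nlinarith

namespace IsLaw

variable {μ : Measure ℝ} {M : ℝ} (h : IsLaw μ M)
include h

lemma integrable_abs : Integrable (fun a : ℝ => |a|) μ := by
  have := h.prob
  refine ((integrable_const (1 : ℝ)).add h.integrable_cube).mono' (by fun_prop)
    (.of_forall fun a => ?_)
  simpa using (pow_le_one_add_cube |a| (abs_nonneg a)).1

lemma integrable_sq : Integrable (fun a : ℝ => a ^ 2) μ := by
  have := h.prob
  refine ((integrable_const (1 : ℝ)).add h.integrable_cube).mono' (by fun_prop)
    (.of_forall fun a => ?_)
  simpa using (pow_le_one_add_cube |a| (abs_nonneg a)).2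

lemma integrable_id : Integrable (fun a : ℝ => a) μ :=
  (integrable_norm_iff (by fun_prop)).1 h.integrable_abs

lemma secondMoment : SecondMoment μ :=
  ⟨h.prob, (memLp_two_iff_integrable_sq (by fun_prop)).2 (by simpa using h.integrable_sq)⟩

lemma abs_le_one : ∫ a, |a| ∂μ ≤ 1 := by
  have := h.prob
  have h1 : ∫ a, |a| ∂μ ≤ ∫ a, (1 + a ^ 2) / 2 ∂μ := by
    refine integral_mono h.integrable_abs
      (((integrable_const _).add h.integrable_sq).div_const _) fun a => ?_
    simp only
    nlinarith [sq_nonneg (|a| - 1), sq_abs a]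
  rw [integral_div, integral_add (integrable_const _) h.integrable_sq, h.var] at h1
  simpa using h1

/-- Integrate `3a² ≤ 1 + 2|a|³`. This is what allows errors without a third moment to be absorbed
into multiples of `M`. -/
lemma one_le : 1 ≤ M := by
  have := h.prob
  have h1 : ∫ a, a ^ 2 ∂μ ≤ ∫ a, (1 + 2 * |a| ^ 3) / 3 ∂μ := by
    refine integral_mono h.integrable_sq
      (((integrable_const _).add (h.integrable_cube.const_mul 2)).div_const _) fun a => ?_
    simp only
    rw [← sq_abs]
    nlinarith [mul_nonneg (sq_nonneg (|a| - 1)) (abs_nonneg a), sq_nonneg (|a| - 1)]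
  rw [integral_div, integral_add (integrable_const _) (h.integrable_cube.const_mul 2), h.var,
    integral_const_mul] at h1
  simp at h1
  linarith [h.cube_le]

end IsLaw

/-- The law of a pair of centred variables with unit variances, covariance `ρ`, and third absolute
moments at most `M`. -/
structure IsPairLaw (ξ : Measure (ℝ × ℝ)) (ρ M : ℝ) : Prop where
  fst : IsLaw (ξ.map Prod.fst) M
  snd : IsLaw (ξ.map Prod.snd) M
  cov : ∫ w, w.1 * w.2 ∂ξ = ρ

namespace IsPairLaw

variable {ξ : Measure (ℝ × ℝ)} {ρ M : ℝ} (h : IsPairLaw ξ ρ M)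
include h

lemma prob : IsProbabilityMeasure ξ := by
  have := h.fst.prob
  exact Measure.isProbabilityMeasure_of_map (μ := ξ) Prod.fst

lemma integrable_fst {f : ℝ → ℝ} (hf : Integrable f (ξ.map Prod.fst)) :
    Integrable (fun w => f w.1) ξ :=
  hf.comp_measurable measurable_fst

lemma integrable_snd {f : ℝ → ℝ} (hf : Integrable f (ξ.map Prod.snd)) :
    Integrable (fun w => f w.2) ξ :=
  hf.comp_measurable measurable_snd

omit h in
lemma integral_fst {f : ℝ → ℝ} (hf : Measurable f) :
    ∫ w, f w.1 ∂ξ = ∫ a, f a ∂ξ.map Prod.fst :=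
  (integral_map (by fun_prop) hf.aestronglyMeasurable).symm

omit h in
lemma integral_snd {f : ℝ → ℝ} (hf : Measurable f) :
    ∫ w, f w.2 ∂ξ = ∫ a, f a ∂ξ.map Prod.snd :=
  (integral_map (by fun_prop) hf.aestronglyMeasurable).symm

lemma secondMoment : SecondMoment ξ := by
  have := h.prob
  refine .of_fst_snd ?_ ?_
  · exact h.fst.secondMoment.memLp_id.comp_measurePreserving ⟨measurable_fst, rfl⟩
  · exact h.snd.secondMoment.memLp_id.comp_measurePreserving ⟨measurable_snd, rfl⟩

lemma integrable_mul : Integrable (fun w : ℝ × ℝ => w.1 * w.2) ξ :=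
  (h.fst.secondMoment.memLp_id.comp_measurePreserving (f := Prod.fst)
    ⟨measurable_fst, rfl⟩).integrable_mul
    (h.snd.secondMoment.memLp_id.comp_measurePreserving (f := Prod.snd) ⟨measurable_snd, rfl⟩)

lemma integrable_cubes : Integrable (fun w : ℝ × ℝ => 1 + |w.1| ^ 3 + |w.2| ^ 3) ξ := by
  have := h.prob
  exact ((integrable_const _).add (h.integrable_fst h.fst.integrable_cube)).add
    (h.integrable_snd h.snd.integrable_cube)

lemma cubes_le : ∫ w, (1 + |w.1| ^ 3 + |w.2| ^ 3) ∂ξ ≤ 3 * M := by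
  have := h.prob
  have i1 := h.integrable_fst h.fst.integrable_cube
  have i2 := h.integrable_snd h.snd.integrable_cube
  rw [integral_add, integral_add, integral_fst (f := fun a => |a| ^ 3) (by fun_prop),
    integral_snd (f := fun a => |a| ^ 3) (by fun_prop)]
  · have := h.fst.cube_le
    have := h.snd.cube_le
    have := h.fst.one_le
    simp
    linarith
  exacts [integrable_const _, i1, (integrable_const _).add i1, i2]

lemma abs_le : ∫ w, (|w.1| + |w.2|) ∂ξ ≤ 2 := by
  rw [integral_add (h.integrable_fst h.fst.integrable_abs)
    (h.integrable_snd h.snd.integrable_abs), integral_fst (f := fun a => |a|) (by fun_prop),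
    integral_snd (f := fun a => |a|) (by fun_prop)]
  linarith [h.fst.abs_le_one, h.snd.abs_le_one]

end IsPairLaw

/-- Here `u, v` play the role of the fluctuations of the two copies in one bond, `a, c` the disorder
there, and `m, n` the bond averages. Replacing `u` and then `v` by its linear part costs two terms
with coefficient `2b³`, and `key` brings in a factor `3` for each: `12 = (2 + 2) · 3`. -/
lemma mul_error_le {b a c u v m n : ℝ} (hb : 0 ≤ b) (hv' : |v| ≤ b * (|c| + 1))
    (hu : |u - b * a * m| ≤ 2 * b ^ 2 * (a ^ 2 + 1))
    (hv : |v - b * c * n| ≤ 2 * b ^ 2 * (c ^ 2 + 1)) (hm : |m| ≤ 1) :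
    u * v ≤ b ^ 2 * (m * n) * (a * c) + 12 * b ^ 3 * (1 + |a| ^ 3 + |c| ^ 3) := by
  have e : u * v = b ^ 2 * (m * n) * (a * c) + ((u - b * a * m) * v + b * a * m * (v - b * c * n)) := by
    ring
  rw [e]
  gcongr
  have h1 : (u - b * a * m) * v ≤ 2 * b ^ 2 * (a ^ 2 + 1) * (b * (|c| + 1)) := by
    refine (le_abs_self _).trans ?_
    rw [abs_mul]
    gcongr
  have h2 : b * a * m * (v - b * c * n) ≤ b * |a| * 1 * (2 * b ^ 2 * (c ^ 2 + 1)) := by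
    refine (le_abs_self _).trans ?_
    rw [abs_mul, abs_mul, abs_mul, abs_of_nonneg hb]
    gcongr
  have key : ∀ p q : ℝ, 0 ≤ p → 0 ≤ q → (p ^ 2 + 1) * (q + 1) ≤ 3 * (1 + p ^ 3 + q ^ 3) := by
    intro p q hp hq
    have := pow_le_one_add_cube p hp
    have := pow_le_one_add_cube q hq
    have : p ^ 2 * q ≤ p ^ 3 + q ^ 3 := by
      rcases le_total p q with h | h
      · have := mul_le_mul_of_nonneg_right (pow_le_pow_left₀ hp h 2) hq
        nlinarith [pow_nonneg hp 3]
      · have := mul_le_mul_of_nonneg_left h (pow_nonneg hp 2)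
        nlinarith [pow_nonneg hq 3]
    nlinarith [pow_nonneg hp 3, pow_nonneg hq 3]
  have k1 := key |a| |c| (abs_nonneg _) (abs_nonneg _)
  have k2 := key |c| |a| (abs_nonneg _) (abs_nonneg _)
  rw [sq_abs] at k1 k2
  have hb3 : 0 ≤ b ^ 3 := pow_nonneg hb 3
  have k1' := mul_le_mul_of_nonneg_left k1 hb3
  have k2' := mul_le_mul_of_nonneg_left k2 hb3
  have : b ^ 3 * (|a| * (c ^ 2 + 1)) ≤ b ^ 3 * ((c ^ 2 + 1) * (|a| + 1)) :=
    mul_le_mul_of_nonneg_left (by nlinarith [sq_nonneg c]) hb3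
  nlinarith

/-! ### One-bond fluctuations of the free energy, and their correlations in terms of overlaps. -/

section FreeEnergy

variable {ι α : Type*} [Fintype ι]

/-- The energy of `σ` for the disorder `x` and the interactions `s`. -/
def energy (s : ι → α → ℝ) (b : ℝ) (x : ι → ℝ) (σ : α) : ℝ := b * ∑ i, x i * s i σ

/-- The free energy for the disorder `x` and the interactions `s`. -/
def free (T : Finset α) (s : ι → α → ℝ) (b : ℝ) (x : ι → ℝ) : ℝ := logZ T (energy s b x)

/-- The Gibbs average of the interaction `s i` for the disorder `x`. -/
def spin (T : Finset α) (s : ι → α → ℝ) (b : ℝ) (i : ι) (x : ι → ℝ) : ℝ :=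
  gibbs T (energy s b x) (s i)

/-- The mean overlap of the interaction `i` for two copies of the disorder. -/
def overlap (T : Finset α) (s : ι → α → ℝ) (b : ℝ) (ξ : Measure (ℝ × ℝ)) (i : ι) : ℝ :=
  ∫ z, spin T s b i (fun j => (z j).1) * spin T s b i (fun j => (z j).2)
    ∂Measure.pi fun _ : ι => ξ

variable {T : Finset α} (hT : T.Nonempty) {s : ι → α → ℝ} (hs : ∀ i, ∀ σ ∈ T, |s i σ| ≤ 1)
  {b : ℝ} (hb : 0 ≤ b)

lemma measurable_free : Measurable (free T s b) := by
  unfold free logZ energy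
  fun_prop

lemma measurable_spin (i : ι) : Measurable (spin T s b i) := by
  unfold spin gibbs energy
  fun_prop

include hT hs

lemma abs_spin_le (i : ι) (x : ι → ℝ) : |spin T s b i x| ≤ 1 := abs_gibbs_le hT _ (hs i)

lemma growth_spin (i : ι) : Growth 0 (spin T s b i) :=
  .of_bounded (measurable_spin i) (abs_spin_le hT hs i)

include hb

lemma growth_free : Growth 1 (free T s b) := by
  refine ⟨measurable_free, |logZ T fun _ => 0| + b, by positivity, fun x => ?_⟩
  have hx : ∀ σ ∈ T, |energy s b x σ| ≤ b * ∑ i, ‖x i‖ := fun σ hσ => by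
    rw [energy, abs_mul, abs_of_nonneg hb]
    gcongr
    refine (Finset.abs_sum_le_sum_abs _ _).trans (Finset.sum_le_sum fun i _ => ?_)
    rw [abs_mul]
    exact mul_le_of_le_one_right (abs_nonneg _) (hs i σ hσ)
  have h := abs_logZ_sub_le hT (fun _ => 0) hx
  simp only [zero_add] at h
  have h0 : 0 ≤ ∑ i, ‖x i‖ := Finset.sum_nonneg fun _ _ => norm_nonneg _
  have h1 := abs_sub_abs_le_abs_sub (logZ T (energy s b x)) (logZ T fun _ => 0)
  have h2 := mul_nonneg (abs_nonneg (logZ T fun _ => 0)) h0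
  change |logZ T (energy s b x)| ≤ _
  change |logZ T (energy s b x) - _| ≤ _ at h
  linarith

variable [DecidableEq ι]

omit hT hs hb in
lemma energy_update (x : ι → ℝ) (i : ι) (a : ℝ) :
    energy s b (Function.update x i a)
      = fun σ => energy s b (Function.update x i 0) σ + b * a * s i σ := by
  ext σ
  have : ∀ a, ∑ j, Function.update x i a j * s j σ
      = a * s i σ + ∑ j ∈ Finset.univ.erase i, x j * s j σ := fun a => by
    rw [← Finset.add_sum_erase _ _ (Finset.mem_univ i), Function.update_self]
    congr 1
    exact Finset.sum_congr rfl fun j hj => by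
      rw [Function.update_of_ne (Finset.ne_of_mem_erase hj)]
  simp only [energy, this]
  ring

lemma abs_edge_le (i : ι) (a : ℝ) : ∀ σ ∈ T, |b * a * s i σ| ≤ b * |a| := fun σ hσ => by
  rw [abs_mul, abs_mul, abs_of_nonneg hb]
  exact mul_le_of_le_one_right (by positivity) (hs i σ hσ)

lemma abs_free_update_sub_le (x : ι → ℝ) (i : ι) (a : ℝ) :
    |free T s b (Function.update x i a) - free T s b (Function.update x i 0)| ≤ b * |a| := by
  rw [free, free, energy_update]
  exact abs_logZ_sub_le hT _ (abs_edge_le hT hs hb i a)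

lemma abs_free_update_sub_spin_le (x : ι → ℝ) (i : ι) (a : ℝ) :
    |free T s b (Function.update x i a) - free T s b (Function.update x i 0)
      - b * a * spin T s b i (Function.update x i 0)| ≤ 2 * b ^ 2 * a ^ 2 := by
  rw [free, free, energy_update, spin, ← gibbs_const_mul]
  refine (abs_logZ_sub_gibbs_le hT _ (abs_edge_le hT hs hb i a)).trans_eq ?_
  rw [mul_pow, sq_abs]
  ring

lemma abs_spin_update_sub_le (x : ι → ℝ) (i : ι) :
    |spin T s b i x - spin T s b i (Function.update x i 0)| ≤ 2 * (b * |x i|) := by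
  have : spin T s b i x = spin T s b i (Function.update x i (x i)) := by
    rw [Function.update_eq_self]
  rw [this, spin, energy_update]
  exact abs_gibbs_sub_le hT _ (abs_edge_le hT hs hb i (x i)) (hs i)

variable {μ : Measure ℝ} {M : ℝ} (hμ : IsLaw μ M)
include hμ

/-- Compare everything with the disorder in which bond `i` is set to `0`. The linear term `b a m`
integrates to zero because `μ` is centred, so the average over the bond differs from that reference
by at most `b`, and also by at most `2b²`. -/
lemma dif_free_update_bounds (x : ι → ℝ) (i : ι) (a : ℝ) :
    |dif μ i (free T s b) (Function.update x i a)| ≤ b * (|a| + 1) ∧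
    |dif μ i (free T s b) (Function.update x i a) - b * a * spin T s b i (Function.update x i 0)|
      ≤ 2 * b ^ 2 * (a ^ 2 + 1) := by
  have := hμ.prob
  set f0 := free T s b (Function.update x i 0)
  set m := spin T s b i (Function.update x i 0)
  have hint := (growth_free hT hs hb).integrable_update one_le_two i hμ.secondMoment x
  have hL : avg μ i (free T s b) x - f0 = ∫ a, (free T s b (Function.update x i a) - f0) ∂μ := by
    rw [integral_sub hint (integrable_const _)]
    simp [avg]
  have h1 : |avg μ i (free T s b) x - f0| ≤ b := by
    rw [hL, ← Real.norm_eq_abs]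
    refine (norm_integral_le_of_norm_le (hμ.integrable_abs.const_mul b)
      (.of_forall fun a => abs_free_update_sub_le hT hs hb x i a)).trans ?_
    rw [integral_const_mul]
    exact mul_le_of_le_one_right hb hμ.abs_le_one
  have h2 : |avg μ i (free T s b) x - f0| ≤ 2 * b ^ 2 := by
    have : avg μ i (free T s b) x - f0
        = ∫ a, (free T s b (Function.update x i a) - f0 - b * a * m) ∂μ := by
      rw [integral_sub, hL, integral_mul_const, integral_const_mul, hμ.mean]
      · simp
      exacts [hint.sub (integrable_const _), (hμ.integrable_id.const_mul b).mul_const m]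
    rw [this, ← Real.norm_eq_abs]
    refine (norm_integral_le_of_norm_le (hμ.integrable_sq.const_mul (2 * b ^ 2))
      (.of_forall fun a => abs_free_update_sub_spin_le hT hs hb x i a)).trans ?_
    rw [integral_const_mul, hμ.var, mul_one]
  have h3 := abs_free_update_sub_le hT hs hb x i a
  have h4 := abs_free_update_sub_spin_le hT hs hb x i a
  simp only [dif, avg_update]
  rw [abs_le, abs_le]
  rw [abs_le] at h1 h2 h3 h4
  constructor <;> constructor <;> linarith

lemma pairInt_diag_dif_free_le (i : ι) :
    pairInt (fun _ => coupl μ 1) (dif μ i (free T s b)) ≤ 4 * b ^ 2 := by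
  have := hμ.prob
  have hG := (growth_free hT hs hb).dif hμ.secondMoment i
  rw [pairInt_diag hμ.secondMoment hG]
  have hG2 : Growth 2 (fun x => dif μ i (free T s b) x ^ 2) := by
    simpa [sq] using hG.mul hG
  have hm := measurePreserving_eval (fun _ : ι => μ) i
  have hi : Integrable (fun a : ℝ => b ^ 2 * (2 * a ^ 2 + 2)) μ :=
    ((hμ.integrable_sq.const_mul 2).add (integrable_const _)).const_mul _
  calc ∫ x, dif μ i (free T s b) x ^ 2 ∂Measure.pi (fun _ => μ)
      ≤ ∫ x, b ^ 2 * (2 * (x i) ^ 2 + 2) ∂Measure.pi (fun _ => μ) := by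
        refine integral_mono (hG2.integrable le_rfl fun _ => hμ.secondMoment)
          (hm.integrable_comp_of_integrable hi) fun x => ?_
        have h1 := (dif_free_update_bounds hT hs hb hμ x i (x i)).1
        rw [Function.update_eq_self] at h1
        have h2 := pow_le_pow_left₀ (abs_nonneg _) h1 2
        rw [sq_abs, mul_pow] at h2
        refine h2.trans (mul_le_mul_of_nonneg_left ?_ (sq_nonneg b))
        nlinarith [sq_nonneg (|x i| - 1), sq_abs (x i)]
    _ = ∫ a, b ^ 2 * (2 * a ^ 2 + 2) ∂μ := by
        exact integral_comp_eval (μ := fun _ : ι => μ) (i := i)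
          (f := fun a : ℝ => b ^ 2 * (2 * a ^ 2 + 2)) (by fun_prop)
    _ = 4 * b ^ 2 := by
        rw [integral_const_mul, integral_add (hμ.integrable_sq.const_mul 2) (integrable_const _),
          integral_const_mul, hμ.var]
        simp
        ring

/-- The bond average is taken with disorder `0` in bond `i`, hence does not depend on the redrawn
pair `w`. The leading term `b² w.1 w.2 m m'` then integrates to `b² ρ m m'`. The error `40` is `12 ·
3` from the cubic moments and `4` from putting bond `i` back into the averages. -/
lemma pairInt_dif_free_le {ξ : Measure (ℝ × ℝ)} {ρ : ℝ} (hρ0 : 0 ≤ ρ) (hρ1 : ρ ≤ 1)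
    (hξ : IsPairLaw ξ ρ M) (i : ι) :
    pairInt (fun _ => ξ) (dif μ i (free T s b))
      ≤ b ^ 2 * ρ * overlap T s b ξ i + 40 * b ^ 3 * M := by
  have := hμ.prob
  have := hξ.prob
  have hG := (growth_free hT hs hb).dif hμ.secondMoment i
  have hG2 := hG.comp_fst.mul hG.comp_snd
  have hξ2 := fun _ : ι => hξ.secondMoment
  set m : (ι → ℝ) → ℝ := fun x => spin T s b i (Function.update x i 0)
  have hm1 : ∀ x, |m x| ≤ 1 := fun x => abs_spin_le hT hs i _
  have hmG : Growth 0 m := (growth_spin hT hs i).update i 0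
  have e : ∀ (z : ι → ℝ × ℝ) (w : ℝ × ℝ), dif μ i (free T s b) (fun j => (Function.update z i w j).1)
        * dif μ i (free T s b) (fun j => (Function.update z i w j).2)
      = dif μ i (free T s b) (Function.update (fun j => (z j).1) i w.1)
        * dif μ i (free T s b) (Function.update (fun j => (z j).2) i w.2) := fun z w => by
    rw [fst_update, snd_update]
  have step := integral_pi_update le_rfl hG2 hξ2 i hξ.secondMoment
  rw [Function.update_eq_self_iff.2 rfl] at step
  have hC : ∀ z : ι → ℝ × ℝ, ∫ w, dif μ i (free T s b) (fun j => (Function.update z i w j).1)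
        * dif μ i (free T s b) (fun j => (Function.update z i w j).2) ∂ξ
      ≤ b ^ 2 * ρ * (m (fun j => (z j).1) * m (fun j => (z j).2)) + 36 * b ^ 3 * M := fun z => by
    have i1 := hξ.integrable_mul.const_mul
      (b ^ 2 * (m (fun j => (z j).1) * m (fun j => (z j).2)))
    have i2 := hξ.integrable_cubes.const_mul (12 * b ^ 3)
    have i3 := hG2.integrable_update le_rfl i hξ.secondMoment z
    refine (integral_mono i3 (i1.add i2) fun w => ?_).trans ?_
    · simp only [e]
      obtain ⟨-, h2⟩ := dif_free_update_bounds hT hs hb hμ (fun j => (z j).1) i w.1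
      obtain ⟨h3, h4⟩ := dif_free_update_bounds hT hs hb hμ (fun j => (z j).2) i w.2
      exact mul_error_le hb h3 h2 h4 (hm1 _)
    · simp only [Pi.add_apply]
      rw [integral_add i1 i2, integral_const_mul, integral_const_mul, hξ.cov]
      have := mul_le_mul_of_nonneg_left hξ.cubes_le (by positivity : 0 ≤ 12 * b ^ 3)
      linarith
  have hm2 : Growth 0 fun z : ι → ℝ × ℝ => m (fun j => (z j).1) * m (fun j => (z j).2) :=
    hmG.comp_fst.mul hmG.comp_snd
  have hs2 : Growth 0 fun z : ι → ℝ × ℝ =>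
      spin T s b i (fun j => (z j).1) * spin T s b i (fun j => (z j).2) :=
    (growth_spin hT hs i).comp_fst.mul (growth_spin hT hs i).comp_snd
  have im2 := hm2.integrable zero_le_two hξ2
  have is2 := hs2.integrable zero_le_two hξ2
  have hev := measurePreserving_eval (fun _ : ι => ξ) i
  have habs : Integrable (fun w : ℝ × ℝ => |w.1| + |w.2|) ξ :=
    (hξ.integrable_fst hξ.fst.integrable_abs).add (hξ.integrable_snd hξ.snd.integrable_abs)
  have iabs : Integrable (fun z : ι → ℝ × ℝ => |(z i).1| + |(z i).2|) (Measure.pi fun _ => ξ) :=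
    hev.integrable_comp_of_integrable habs
  have hov : ∫ z, m (fun j => (z j).1) * m (fun j => (z j).2) ∂Measure.pi (fun _ : ι => ξ)
      ≤ overlap T s b ξ i + 4 * b := by
    have h1 : ∫ z, m (fun j => (z j).1) * m (fun j => (z j).2) ∂Measure.pi (fun _ : ι => ξ)
        ≤ ∫ z, (spin T s b i (fun j => (z j).1) * spin T s b i (fun j => (z j).2)
          + 2 * b * (|(z i).1| + |(z i).2|)) ∂Measure.pi (fun _ : ι => ξ) := by
      refine integral_mono im2 (is2.add (iabs.const_mul _)) fun z => ?_
      have a1 := abs_spin_update_sub_le hT hs hb (fun j => (z j).1) i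
      have a2 := abs_spin_update_sub_le hT hs hb (fun j => (z j).2) i
      have a3 := abs_spin_le hT hs (b := b) i (fun j => (z j).1)
      have a4 := hm1 (fun j => (z j).2)
      have : m (fun j => (z j).1) * m (fun j => (z j).2)
          - spin T s b i (fun j => (z j).1) * spin T s b i (fun j => (z j).2)
          = -((spin T s b i (fun j => (z j).1) - m (fun j => (z j).1)) * m (fun j => (z j).2))
            + -((spin T s b i (fun j => (z j).2) - m (fun j => (z j).2))
              * spin T s b i (fun j => (z j).1)) := by ring
      have b1 := neg_le_abs ((spin T s b i (fun j => (z j).1) - m (fun j => (z j).1))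
        * m (fun j => (z j).2))
      have b2 := neg_le_abs ((spin T s b i (fun j => (z j).2) - m (fun j => (z j).2))
              * spin T s b i (fun j => (z j).1))
      rw [abs_mul] at b1 b2
      have c1 := mul_le_mul a1 a4 (abs_nonneg _) (by positivity)
      have c2 := mul_le_mul a2 a3 (abs_nonneg _) (by positivity)
      simp only
      linarith
    refine h1.trans ?_
    rw [integral_add is2 (iabs.const_mul _), integral_const_mul]
    have h2 : ∫ z, (|(z i).1| + |(z i).2|) ∂Measure.pi (fun _ : ι => ξ) ≤ 2 := by
      refine le_trans (le_of_eq ?_) hξ.abs_le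
      exact integral_comp_eval (μ := fun _ : ι => ξ) (i := i)
        (f := fun w : ℝ × ℝ => |w.1| + |w.2|) (by fun_prop)
    have := mul_le_mul_of_nonneg_left h2 (mul_nonneg zero_le_two hb)
    rw [overlap]
    linarith
  have hI := (hG2.integral_update le_rfl i hξ.secondMoment).integrable le_rfl hξ2
  have i4 := im2.const_mul (b ^ 2 * ρ)
  rw [pairInt, step]
  refine (integral_mono hI (i4.add (integrable_const _)) hC).trans ?_
  simp only [Pi.add_apply]
  rw [integral_add i4 (integrable_const _), integral_const_mul]
  simp only [integral_const, probReal_univ, smul_eq_mul, one_mul]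
  have h1 := mul_le_mul_of_nonneg_left hov (by positivity : 0 ≤ b ^ 2 * ρ)
  have h2 : b ^ 2 * ρ * (4 * b) ≤ 4 * b ^ 3 * M := by
    have := hμ.one_le
    calc b ^ 2 * ρ * (4 * b) = 4 * b ^ 3 * ρ := by ring
      _ ≤ 4 * b ^ 3 * M := by gcongr; linarith
  linarith

end FreeEnergy

/-- `V` is the first-order part of the perturbation and `Y`, the direct coupling, is already of
second order. Every contribution of `Y` to the second cumulant therefore goes into the error. -/
lemma abs_logZ_add_sub_le {α : Type*} {T : Finset α} (hT : T.Nonempty) (E : α → ℝ) {V Y : α → ℝ}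
    {p q : ℝ} (hV : ∀ σ ∈ T, |V σ| ≤ p) (hY : ∀ σ ∈ T, |Y σ| ≤ q) :
    |logZ T (fun σ => E σ + (V σ + Y σ)) - logZ T E - (gibbs T E V + gibbs T E Y)
      - (gibbs T E (fun σ => V σ * V σ) - gibbs T E V * gibbs T E V) / 2|
      ≤ 6 * (p + q) ^ 3 + 2 * p * q + q ^ 2 := by
  have b1 := abs_gibbs_le hT E hV
  have b2 := abs_gibbs_le hT E hY
  have hp : 0 ≤ p := (abs_nonneg _).trans b1
  have hq : 0 ≤ q := (abs_nonneg _).trans b2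
  have hmain := abs_logZ_sub_cumulants_le hT E (X := fun σ => V σ + Y σ) (K := p + q)
    fun σ hσ => (abs_add_le _ _).trans (add_le_add (hV σ hσ) (hY σ hσ))
  have g4 : gibbs T E (fun σ => (V σ + Y σ) * (V σ + Y σ)) = gibbs T E (fun σ => V σ * V σ)
      + 2 * gibbs T E (fun σ => V σ * Y σ) + gibbs T E (fun σ => Y σ * Y σ) := by
    have : (fun σ => (V σ + Y σ) * (V σ + Y σ))
        = fun σ => (V σ * V σ + 2 * (V σ * Y σ)) + Y σ * Y σ := by
      ext σ
      ring
    rw [this, gibbs_add, gibbs_add, gibbs_const_mul]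
  have b3 : |gibbs T E (fun σ => V σ * Y σ)| ≤ p * q :=
    abs_gibbs_le hT E fun σ hσ => by
      rw [abs_mul]
      exact mul_le_mul (hV σ hσ) (hY σ hσ) (abs_nonneg _) hp
  have b4 : |gibbs T E (fun σ => Y σ * Y σ)| ≤ q ^ 2 :=
    abs_gibbs_le hT E fun σ hσ => by
      rw [abs_mul, sq]
      exact mul_le_mul (hY σ hσ) (hY σ hσ) (abs_nonneg _) hq
  have b5 : |gibbs T E V * gibbs T E Y| ≤ p * q := by
    rw [abs_mul]
    exact mul_le_mul b1 b2 (abs_nonneg _) hp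
  have b6 : |gibbs T E Y * gibbs T E Y| ≤ q ^ 2 := by
    rw [abs_mul, sq]
    exact mul_le_mul b2 b2 (abs_nonneg _) hq
  rw [gibbs_add, g4] at hmain
  generalize 6 * (p + q) ^ 3 = r at *
  rw [abs_le] at hmain b3 b4 b5 b6 ⊢
  constructor <;> linarith

/-! ### Interpolation: exchanging correlation of the disorders for a direct coupling. -/

section Interpolation

variable {ι α : Type*} [Fintype ι]

/-- The energy for two families of interactions `u` and `v` coupled through their products. -/
def pairEnergy (u v : ι → α → ℝ) (b : ℝ) (z : ι → ℝ × ℝ × ℝ) (σ : α) : ℝ :=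
  ∑ i, (b * ((z i).1 * u i σ + (z i).2.1 * v i σ) + b ^ 2 * ((z i).2.2 * (u i σ * v i σ)))

/-- The law `ξ` of a pair, completed by the constant `c`. -/
def withConst (ξ : Measure (ℝ × ℝ)) (c : ℝ) : Measure (ℝ × ℝ × ℝ) :=
  ξ.map fun w => (w.1, w.2, c)

lemma measurable_withConst (c : ℝ) : Measurable fun w : ℝ × ℝ => (w.1, w.2, c) := by fun_prop

lemma integral_withConst {ξ : Measure (ℝ × ℝ)} {c : ℝ} {f : ℝ × ℝ × ℝ → ℝ} (hf : Measurable f) :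
    ∫ w, f w ∂withConst ξ c = ∫ w, f (w.1, w.2, c) ∂ξ :=
  integral_map (measurable_withConst c).aemeasurable hf.aestronglyMeasurable

lemma integrable_withConst {ξ : Measure (ℝ × ℝ)} {c : ℝ} {f : ℝ × ℝ × ℝ → ℝ} (hf : Measurable f) :
    Integrable f (withConst ξ c) ↔ Integrable (fun w => f (w.1, w.2, c)) ξ :=
  integrable_map_measure hf.aestronglyMeasurable (measurable_withConst c).aemeasurable

lemma IsPairLaw.secondMoment_withConst {ξ : Measure (ℝ × ℝ)} {ρ M : ℝ} (h : IsPairLaw ξ ρ M)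
    (c : ℝ) : SecondMoment (withConst ξ c) := by
  have := h.prob
  refine ⟨Measure.isProbabilityMeasure_map (measurable_withConst c).aemeasurable, ?_⟩
  rw [withConst, memLp_map_measure_iff (by fun_prop) (by fun_prop)]
  refine (h.secondMoment.2.add (memLp_const |c|)).mono' (by fun_prop) (.of_forall fun w => ?_)
  change ‖‖(w.1, w.2, c)‖‖ ≤ ‖w‖ + |c|
  rw [norm_norm]
  exact max_le ((norm_fst_le w).trans (le_add_of_nonneg_right (abs_nonneg c)))
    (max_le ((norm_snd_le w).trans (le_add_of_nonneg_right (abs_nonneg c)))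
      (le_add_of_nonneg_left (norm_nonneg w)))

/-- To second order a pair law is visible only through its covariance, since means and variances are
fixed. This is why the laws themselves may be exchanged. -/
lemma IsPairLaw.integral_quadratic {ξ : Measure (ℝ × ℝ)} {ρ M : ℝ} (hξ : IsPairLaw ξ ρ M)
    (k0 k1 k2 k3 k4 k5 : ℝ) :
    Integrable (fun w : ℝ × ℝ => k0 + k1 * w.1 + k2 * w.2 + k3 * w.1 ^ 2 + k4 * w.2 ^ 2
      + k5 * (w.1 * w.2)) ξ ∧
    ∫ w, (k0 + k1 * w.1 + k2 * w.2 + k3 * w.1 ^ 2 + k4 * w.2 ^ 2 + k5 * (w.1 * w.2)) ∂ξ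
      = k0 + k3 + k4 + k5 * ρ := by
  have := hξ.prob
  have hx := (hξ.integrable_fst hξ.fst.integrable_id).const_mul k1
  have hy := (hξ.integrable_snd hξ.snd.integrable_id).const_mul k2
  have hxx := (hξ.integrable_fst hξ.fst.integrable_sq).const_mul k3
  have hyy := (hξ.integrable_snd hξ.snd.integrable_sq).const_mul k4
  have hxy := hξ.integrable_mul.const_mul k5
  have ex : ∫ w, w.1 ∂ξ = 0 := (IsPairLaw.integral_fst (f := fun a => a) (by fun_prop)).trans
    hξ.fst.mean
  have ey : ∫ w, w.2 ∂ξ = 0 := (IsPairLaw.integral_snd (f := fun a => a) (by fun_prop)).trans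
    hξ.snd.mean
  have exx : ∫ w, w.1 ^ 2 ∂ξ = 1 :=
    (IsPairLaw.integral_fst (f := fun a => a ^ 2) (by fun_prop)).trans hξ.fst.var
  have eyy : ∫ w, w.2 ^ 2 ∂ξ = 1 :=
    (IsPairLaw.integral_snd (f := fun a => a ^ 2) (by fun_prop)).trans hξ.snd.var
  have i1 := (integrable_const (μ := ξ) k0).add hx
  have i2 := i1.add hy
  have i3 := i2.add hxx
  have i4 := i3.add hyy
  refine ⟨i4.add hxy, ?_⟩
  rw [integral_add, integral_add, integral_add, integral_add, integral_add]
  · simp only [integral_const_mul, ex, ey, exx, eyy, hξ.cov]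
    simp
  exacts [integrable_const _, hx, i1, hy, i2, hxx, i3, hyy, i4, hxy]

variable {T : Finset α} (hT : T.Nonempty) {u v : ι → α → ℝ} (hu : ∀ i, ∀ σ ∈ T, |u i σ| ≤ 1)
  (hv : ∀ i, ∀ σ ∈ T, |v i σ| ≤ 1) {b : ℝ} (hb : 0 ≤ b)

lemma measurable_logZ_pairEnergy : Measurable fun z => logZ T (pairEnergy u v b z) := by
  unfold logZ pairEnergy
  fun_prop

lemma measurable_gibbs_pairEnergy (φ : α → ℝ) :
    Measurable fun z => gibbs T (pairEnergy u v b z) φ := by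
  unfold gibbs pairEnergy
  fun_prop

include hu hv hb in
lemma abs_pairEdge_le (i : ι) (w : ℝ × ℝ × ℝ) : ∀ σ ∈ T,
    |b * (w.1 * u i σ + w.2.1 * v i σ) + b ^ 2 * (w.2.2 * (u i σ * v i σ))|
      ≤ b * (|w.1| + |w.2.1|) + b ^ 2 * |w.2.2| := fun σ hσ => by
  have h1 := hu i σ hσ
  have h2 := hv i σ hσ
  have h3 : |u i σ * v i σ| ≤ 1 := by
    rw [abs_mul]
    exact mul_le_one₀ h1 (abs_nonneg _) h2
  refine (abs_add_le _ _).trans ?_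
  rw [abs_mul, abs_mul, abs_of_nonneg hb, abs_of_nonneg (sq_nonneg b)]
  refine add_le_add (mul_le_mul_of_nonneg_left ((abs_add_le _ _).trans ?_) hb)
    (mul_le_mul_of_nonneg_left ?_ (sq_nonneg b))
  · rw [abs_mul, abs_mul]
    exact add_le_add (mul_le_of_le_one_right (abs_nonneg _) h1)
      (mul_le_of_le_one_right (abs_nonneg _) h2)
  · rw [abs_mul]
    exact mul_le_of_le_one_right (abs_nonneg _) h3

include hT hu hv hb in
lemma growth_logZ_pairEnergy : Growth 1 fun z => logZ T (pairEnergy u v b z) := by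
  refine ⟨measurable_logZ_pairEnergy, |logZ T fun _ => 0| + (2 * b + b ^ 2), by positivity,
    fun z => ?_⟩
  have hx : ∀ σ ∈ T, |pairEnergy u v b z σ| ≤ (2 * b + b ^ 2) * ∑ i, ‖z i‖ := fun σ hσ => by
    rw [pairEnergy, Finset.mul_sum]
    refine (Finset.abs_sum_le_sum_abs _ _).trans (Finset.sum_le_sum fun i _ => ?_)
    refine (abs_pairEdge_le hu hv hb i (z i) σ hσ).trans ?_
    have h1 : |(z i).1| ≤ ‖z i‖ := norm_fst_le (z i)
    have h2 : |(z i).2.1| ≤ ‖z i‖ := (norm_fst_le (z i).2).trans (norm_snd_le (z i))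
    have h3 : |(z i).2.2| ≤ ‖z i‖ := (norm_snd_le (z i).2).trans (norm_snd_le (z i))
    have h4 := mul_le_mul_of_nonneg_left (add_le_add h1 h2) hb
    have h5 := mul_le_mul_of_nonneg_left h3 (sq_nonneg b)
    linarith
  have h := abs_logZ_sub_le hT (fun _ => 0) hx
  simp only [zero_add] at h
  have h0 : 0 ≤ ∑ i, ‖z i‖ := Finset.sum_nonneg fun _ _ => norm_nonneg _
  have h1 := abs_sub_abs_le_abs_sub (logZ T (pairEnergy u v b z)) (logZ T fun _ => 0)
  have h2 := mul_nonneg (abs_nonneg (logZ T fun _ => 0)) h0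
  change |logZ T (pairEnergy u v b z) - _| ≤ _ at h
  have : 0 ≤ 2 * b + b ^ 2 := by positivity
  linarith

variable [DecidableEq ι]

lemma pairEnergy_update (z : ι → ℝ × ℝ × ℝ) (i : ι) (w : ℝ × ℝ × ℝ) :
    pairEnergy u v b (Function.update z i w) = fun σ => pairEnergy u v b (Function.update z i 0) σ
      + (b * (w.1 * u i σ + w.2.1 * v i σ) + b ^ 2 * (w.2.2 * (u i σ * v i σ))) := by
  ext σ
  have : ∀ w, pairEnergy u v b (Function.update z i w) σ
      = (b * (w.1 * u i σ + w.2.1 * v i σ) + b ^ 2 * (w.2.2 * (u i σ * v i σ)))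
        + ∑ j ∈ Finset.univ.erase i, (b * ((z j).1 * u j σ + (z j).2.1 * v j σ)
          + b ^ 2 * ((z j).2.2 * (u j σ * v j σ))) := fun w => by
    rw [pairEnergy, ← Finset.add_sum_erase _ _ (Finset.mem_univ i), Function.update_self]
    congr 1
    exact Finset.sum_congr rfl fun j hj => by
      rw [Function.update_of_ne (Finset.ne_of_mem_erase hj)]
  rw [this w, this 0]
  simp
  ring

/-- A constant for the error terms of the interpolation. -/
def taylorConst (B : ℝ) : ℝ := 54 * (1 + B ^ 3) + 4 + B

/-- Everything is cubic in `b` once spare powers of `b` are bounded by `B`. The summands of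
`taylorConst` come from the three terms: `54 = 6 · 9` with `(p+q+B)³ ≤ 9(p³+q³+B³)`, then `4` from
the cross term, then `B` from the square of the coupling. -/
lemma taylor_error_le {B p q c : ℝ} (hb : 0 ≤ b) (hbB : b ≤ B) (hp : 0 ≤ p) (hq : 0 ≤ q)
    (hc0 : 0 ≤ c) (hc1 : c ≤ 1) :
    6 * (b * (p + q) + b ^ 2 * c) ^ 3 + 2 * (b * (p + q)) * (b ^ 2 * c) + (b ^ 2 * c) ^ 2
      ≤ taylorConst B * b ^ 3 * (1 + p ^ 3 + q ^ 3) := by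
  have hB : 0 ≤ B := hb.trans hbB
  have h1 : b * (p + q) + b ^ 2 * c ≤ b * (p + q + B) := by
    have : b * (b * c) ≤ b * (B * 1) := by gcongr
    nlinarith
  have h2 : (p + q + B) ^ 3 ≤ 9 * (p ^ 3 + q ^ 3 + B ^ 3) := by
    nlinarith [mul_nonneg (add_nonneg hp hq) (sq_nonneg (p - q)),
      mul_nonneg (add_nonneg hp hB) (sq_nonneg (p - B)),
      mul_nonneg (add_nonneg hq hB) (sq_nonneg (q - B)),
      mul_nonneg (add_nonneg (add_nonneg hp hq) hB) (sq_nonneg (p - q)),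
      mul_nonneg (add_nonneg (add_nonneg hp hq) hB) (sq_nonneg (p - B)),
      mul_nonneg (add_nonneg (add_nonneg hp hq) hB) (sq_nonneg (q - B))]
  have hp3 := pow_nonneg hp 3
  have hq3 := pow_nonneg hq 3
  have hB3 := pow_nonneg hB 3
  have hb3 := pow_nonneg hb 3
  have h3 : (b * (p + q) + b ^ 2 * c) ^ 3 ≤ b ^ 3 * (9 * (p ^ 3 + q ^ 3 + B ^ 3)) := by
    refine (pow_le_pow_left₀ (by positivity) h1 3).trans ?_
    rw [mul_pow]
    gcongr
  have h4 : p ^ 3 + q ^ 3 + B ^ 3 ≤ (1 + B ^ 3) * (1 + p ^ 3 + q ^ 3) := by nlinarith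
  have h5 : 2 * (b * (p + q)) * (b ^ 2 * c) ≤ b ^ 3 * (4 * (1 + p ^ 3 + q ^ 3)) := by
    have := (pow_le_one_add_cube p hp).1
    have := (pow_le_one_add_cube q hq).1
    have : (p + q) * c ≤ (2 * (1 + p ^ 3 + q ^ 3)) * 1 := by gcongr; linarith
    have := mul_le_mul_of_nonneg_left this hb3
    linarith
  have h6 : (b ^ 2 * c) ^ 2 ≤ b ^ 3 * (B * (1 + p ^ 3 + q ^ 3)) := by
    have : b * c ^ 2 ≤ B * (1 + p ^ 3 + q ^ 3) := by
      gcongr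
      have : c ^ 2 ≤ 1 := pow_le_one₀ hc0 hc1
      linarith
    have := mul_le_mul_of_nonneg_left this hb3
    linarith
  have h7 := mul_le_mul_of_nonneg_left h4 hb3
  unfold taylorConst
  linarith

/-- The second order expansion of the free energy in one coordinate. -/
def coordPoly (T : Finset α) (u v : ι → α → ℝ) (b : ℝ) (z : ι → ℝ × ℝ × ℝ) (i : ι)
    (c x y xx yy xy : ℝ) : ℝ :=
  logZ T (pairEnergy u v b z)
    + b ^ 2 * c * gibbs T (pairEnergy u v b z) (fun σ => u i σ * v i σ)
    + b * gibbs T (pairEnergy u v b z) (u i) * x + b * gibbs T (pairEnergy u v b z) (v i) * y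
    + b ^ 2 / 2 * ((gibbs T (pairEnergy u v b z) (fun σ => u i σ * u i σ)
        - gibbs T (pairEnergy u v b z) (u i) * gibbs T (pairEnergy u v b z) (u i)) * xx
      + (gibbs T (pairEnergy u v b z) (fun σ => v i σ * v i σ)
        - gibbs T (pairEnergy u v b z) (v i) * gibbs T (pairEnergy u v b z) (v i)) * yy
      + 2 * (gibbs T (pairEnergy u v b z) (fun σ => u i σ * v i σ)
        - gibbs T (pairEnergy u v b z) (u i) * gibbs T (pairEnergy u v b z) (v i)) * xy)

include hT hu hv hb in
lemma abs_logZ_update_sub_coordPoly_le {B : ℝ} (hbB : b ≤ B) (z : ι → ℝ × ℝ × ℝ) (i : ι)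
    (x y : ℝ) {c : ℝ} (hc0 : 0 ≤ c) (hc1 : c ≤ 1) :
    |logZ T (pairEnergy u v b (Function.update z i (x, y, c)))
      - coordPoly T u v b (Function.update z i 0) i c x y (x ^ 2) (y ^ 2) (x * y)|
      ≤ taylorConst B * b ^ 3 * (1 + |x| ^ 3 + |y| ^ 3) := by
  rw [pairEnergy_update, coordPoly]
  generalize pairEnergy u v b (Function.update z i 0) = E
  have hV : ∀ σ ∈ T, |b * (x * u i σ + y * v i σ)| ≤ b * (|x| + |y|) := fun σ hσ => by
    simpa using abs_pairEdge_le hu hv hb i (x, y, 0) σ hσ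
  have hY : ∀ σ ∈ T, |b ^ 2 * (c * (u i σ * v i σ))| ≤ b ^ 2 * c := fun σ hσ => by
    simpa [abs_of_nonneg hc0] using abs_pairEdge_le hu hv hb i (0, 0, c) σ hσ
  have hmain := (abs_logZ_add_sub_le hT E hV hY).trans
    (taylor_error_le hb hbB (abs_nonneg x) (abs_nonneg y) hc0 hc1)
  have g3 : gibbs T E (fun σ => b * (x * u i σ + y * v i σ) * (b * (x * u i σ + y * v i σ)))
      = b ^ 2 * (gibbs T E (fun σ => u i σ * u i σ) * x ^ 2
      + gibbs T E (fun σ => v i σ * v i σ) * y ^ 2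
      + 2 * gibbs T E (fun σ => u i σ * v i σ) * (x * y)) := by
    have : (fun σ => b * (x * u i σ + y * v i σ) * (b * (x * u i σ + y * v i σ)))
        = fun σ => (b ^ 2 * x ^ 2 * (u i σ * u i σ)
        + b ^ 2 * y ^ 2 * (v i σ * v i σ)) + 2 * b ^ 2 * (x * y) * (u i σ * v i σ) := by
      ext σ
      ring
    rw [this, gibbs_add, gibbs_add, gibbs_const_mul, gibbs_const_mul, gibbs_const_mul]
    ring
  rw [g3, gibbs_const_mul, gibbs_const_mul, gibbs_const_mul, gibbs_add, gibbs_const_mul,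
    gibbs_const_mul] at hmain
  refine le_of_eq_of_le (congrArg abs ?_) hmain
  ring

include hT hu hv hb in
lemma abs_integral_update_sub_coordPoly_le {B : ℝ} (hbB : b ≤ B) (z : ι → ℝ × ℝ × ℝ) (i : ι)
    {c : ℝ} (hc0 : 0 ≤ c) (hc1 : c ≤ 1) {ξ : Measure (ℝ × ℝ)} {ρ M : ℝ} (hξ : IsPairLaw ξ ρ M) :
    |∫ w, logZ T (pairEnergy u v b (Function.update z i w)) ∂withConst ξ c
      - coordPoly T u v b (Function.update z i 0) i c 0 0 1 1 ρ|
      ≤ taylorConst B * b ^ 3 * (3 * M) := by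
  have := hξ.prob
  have hm : Measurable fun w => logZ T (pairEnergy u v b (Function.update z i w)) :=
    measurable_logZ_pairEnergy.comp (measurable_update z)
  have hint := (growth_logZ_pairEnergy hT hu hv hb).integrable_update one_le_two i
    (hξ.secondMoment_withConst c) z
  rw [integral_withConst hm]
  rw [integrable_withConst hm] at hint
  set P := coordPoly T u v b (Function.update z i 0) i c
  -- `P` is affine in the five formal monomials, so its coefficients are read off by evaluating it
  -- at zero and at unit vectors.
  obtain ⟨hPi, hPint⟩ := hξ.integral_quadratic (P 0 0 0 0 0) (P 1 0 0 0 0 - P 0 0 0 0 0)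
    (P 0 1 0 0 0 - P 0 0 0 0 0) (P 0 0 1 0 0 - P 0 0 0 0 0) (P 0 0 0 1 0 - P 0 0 0 0 0)
    (P 0 0 0 0 1 - P 0 0 0 0 0)
  have hP : ∀ x y xx yy xy, P 0 0 0 0 0 + (P 1 0 0 0 0 - P 0 0 0 0 0) * x
      + (P 0 1 0 0 0 - P 0 0 0 0 0) * y + (P 0 0 1 0 0 - P 0 0 0 0 0) * xx
      + (P 0 0 0 1 0 - P 0 0 0 0 0) * yy + (P 0 0 0 0 1 - P 0 0 0 0 0) * xy
      = P x y xx yy xy := fun x y xx yy xy => by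
    simp only [P, coordPoly]
    ring
  have hP1 := hP 0 0 1 1 ρ
  simp only [mul_zero, add_zero, mul_one] at hP1
  simp only [hP, hP1] at hPi hPint
  rw [← hPint, ← integral_sub hint hPi, ← Real.norm_eq_abs]
  have hC : 0 ≤ taylorConst B * b ^ 3 := by
    have : 0 ≤ B := hb.trans hbB
    unfold taylorConst
    positivity
  refine (norm_integral_le_of_norm_le (hξ.integrable_cubes.const_mul _) (.of_forall fun w =>
    abs_logZ_update_sub_coordPoly_le hT hu hv hb hbB z i w.1 w.2 hc0 hc1)).trans ?_
  rw [integral_const_mul]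
  exact mul_le_mul_of_nonneg_left hξ.cubes_le hC

include hT hu hv hb in
lemma abs_gibbs_pairEnergy_sub_le {φ : α → ℝ} (hφ : ∀ σ ∈ T, |φ σ| ≤ 1) (z : ι → ℝ × ℝ × ℝ)
    (i : ι) :
    |gibbs T (pairEnergy u v b z) φ - gibbs T (pairEnergy u v b (Function.update z i 0)) φ|
      ≤ 2 * (b * (|(z i).1| + |(z i).2.1|) + b ^ 2 * |(z i).2.2|) := by
  have : pairEnergy u v b z = pairEnergy u v b (Function.update z i (z i)) := by
    rw [Function.update_eq_self]
  rw [this, pairEnergy_update]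
  exact abs_gibbs_sub_le hT _ (abs_pairEdge_le hu hv hb i (z i)) hφ

/-- The constant in the error term of `integral_pairEnergy_le`. -/
def interpConst (B : ℝ) : ℝ := 4 * (2 + B) + 6 * taylorConst B

include hT hu hv hb in
/-- Trading the correlation of the disorders for a direct coupling increases the free energy, up
to an error of third order. -/
theorem integral_pairEnergy_le {B : ℝ} (hbB : b ≤ B)
    (hpos : ∀ E : α → ℝ, 0 ≤ ∑ i, gibbs T E (u i) * gibbs T E (v i))
    {c₀ c₁ ρ₀ ρ₁ M : ℝ} (hc₀ : 0 ≤ c₀) (hc₀' : c₀ ≤ 1) (hc₁ : 0 ≤ c₁) (hc₁' : c₁ ≤ 1)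
    (hρ : ρ₁ ≤ ρ₀) (hρc : c₀ + ρ₀ = c₁ + ρ₁)
    {ξ₀ ξ₁ : Measure (ℝ × ℝ)} (hξ₀ : IsPairLaw ξ₀ ρ₀ M) (hξ₁ : IsPairLaw ξ₁ ρ₁ M) :
    ∫ z, logZ T (pairEnergy u v b z) ∂Measure.pi (fun _ => withConst ξ₀ c₀)
      ≤ ∫ z, logZ T (pairEnergy u v b z) ∂Measure.pi (fun _ => withConst ξ₁ c₁)
        + Fintype.card ι * (interpConst B * b ^ 3 * M) := by
  have hM := hξ₀.fst.one_le
  have hB : 0 ≤ B := hb.trans hbB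
  have hG := growth_logZ_pairEnergy (ι := ι) hT hu hv hb
  have s₀ := hξ₀.secondMoment_withConst c₀
  have s₁ := hξ₁.secondMoment_withConst c₁
  -- The coupling constant is carried as a third component of the bond variable, so mixing the bond
  -- laws moves correlation and coupling together.
  refine integral_pi_le_of_mix one_le_two hG s₀ s₁ fun t ht0 ht1 => ?_
  have sm := s₀.mix s₁ ht0 ht1
  have := sm.1
  set π := Measure.pi (fun _ : ι => mix (withConst ξ₀ c₀) (withConst ξ₁ c₁) t)
  have growthProd : ∀ i, Growth 0 fun z : ι → ℝ × ℝ × ℝ =>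
      gibbs T (pairEnergy u v b z) (u i) * gibbs T (pairEnergy u v b z) (v i) := fun i =>
    (Growth.of_bounded (measurable_gibbs_pairEnergy (u i)) fun z =>
      abs_gibbs_le hT _ (hu i)).mul (Growth.of_bounded (measurable_gibbs_pairEnergy (v i)) fun z =>
      abs_gibbs_le hT _ (hv i))
  have iProd := fun i => (growthProd i).integrable zero_le_two (fun _ : ι => sm)
  set κ : ℝ × ℝ × ℝ → ℝ := fun w => b * (|w.1| + |w.2.1|) + b ^ 2 * |w.2.2| with hκ
  have hκm : Measurable κ := by fun_prop
  have iκ : ∀ {ξ : Measure (ℝ × ℝ)} {ρ c : ℝ}, IsPairLaw ξ ρ M → 0 ≤ c → c ≤ 1 →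
      Integrable κ (withConst ξ c) ∧ ∫ w, κ w ∂withConst ξ c ≤ b * (2 + B) := by
    intro ξ ρ c hξ h0 h1
    have := hξ.prob
    have ia : Integrable (fun w : ℝ × ℝ => |w.1| + |w.2|) ξ :=
      (hξ.integrable_fst hξ.fst.integrable_abs).add (hξ.integrable_snd hξ.snd.integrable_abs)
    rw [integrable_withConst hκm, integral_withConst hκm]
    refine ⟨(ia.const_mul b).add (integrable_const (b ^ 2 * |c|)), ?_⟩
    simp only [hκ]
    rw [integral_add (ia.const_mul b) (integrable_const (b ^ 2 * |c|)), integral_const_mul]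
    have h2 := mul_le_mul_of_nonneg_left hξ.abs_le hb
    have h3 : b ^ 2 * |c| ≤ b * B := by
      rw [abs_of_nonneg h0, sq, mul_assoc]
      refine mul_le_mul_of_nonneg_left ?_ hb
      nlinarith
    simp only [integral_const, probReal_univ, smul_eq_mul, one_mul]
    linarith
  obtain ⟨iκ₀, lκ₀⟩ := iκ hξ₀ hc₀ hc₀'
  obtain ⟨iκ₁, lκ₁⟩ := iκ hξ₁ hc₁ hc₁'
  have iκm : Integrable κ (mix (withConst ξ₀ c₀) (withConst ξ₁ c₁) t) :=
    (iκ₀.smul_measure ENNReal.ofReal_ne_top).add_measure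
      (iκ₁.smul_measure ENNReal.ofReal_ne_top)
  have lκ : ∫ w, κ w ∂mix (withConst ξ₀ c₀) (withConst ξ₁ c₁) t ≤ b * (2 + B) := by
    rw [integral_mix iκ₀ iκ₁ ht0 ht1]
    nlinarith
  have iκz : ∀ i, Integrable (fun z : ι → ℝ × ℝ × ℝ => κ (z i)) π := fun i =>
    integrable_comp_eval iκm
  have lκz : ∀ i, ∫ z, κ (z i) ∂π ≤ b * (2 + B) := fun i => by
    refine le_trans (le_of_eq ?_) lκ
    exact integral_comp_eval (μ := fun _ : ι => mix (withConst ξ₀ c₀) (withConst ξ₁ c₁) t)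
      (i := i) (f := κ) hκm.aestronglyMeasurable
  set Δ := b ^ 2 * (ρ₀ - ρ₁)
  have hΔ : 0 ≤ Δ := mul_nonneg (sq_nonneg b) (by linarith)
  have hΔ' : Δ ≤ b ^ 2 * 1 := mul_le_mul_of_nonneg_left (by linarith) (sq_nonneg b)
  -- Changing the law at bond `i` gains `b²(c₁ - c₀)⟨uv⟩` and loses `b²(ρ₀ - ρ₁)(⟨uv⟩ - ⟨u⟩⟨v⟩)`.
  -- Since `c₁ - c₀ = ρ₀ - ρ₁`, only `Δ ⟨u⟩⟨v⟩` is left at second order, and its sum over the bonds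
  -- is nonnegative by `hpos`.
  have hterm : ∀ i, Δ * ∫ z, gibbs T (pairEnergy u v b z) (u i)
        * gibbs T (pairEnergy u v b z) (v i) ∂π - interpConst B * b ^ 3 * M
      ≤ ∫ z, (∫ w, logZ T (pairEnergy u v b (Function.update z i w)) ∂withConst ξ₁ c₁
        - ∫ w, logZ T (pairEnergy u v b (Function.update z i w)) ∂withConst ξ₀ c₀) ∂π := fun i => by
    have iL := ((hG.integral_update one_le_two i s₁).sub
      (hG.integral_update one_le_two i s₀)).integrable one_le_two (fun _ : ι => sm)
    have iR := (((iProd i).const_mul Δ).sub ((iκz i).const_mul (4 * b ^ 2))).sub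
      (integrable_const (μ := π) (6 * taylorConst B * b ^ 3 * M))
    refine le_trans ?_ (integral_mono iR iL fun z => ?_)
    · simp only [Pi.sub_apply]
      rw [integral_sub, integral_sub, integral_const_mul, integral_const_mul]
      · simp only [integral_const, probReal_univ, smul_eq_mul, one_mul]
        have h1 := mul_le_mul_of_nonneg_left (lκz i) (by positivity : 0 ≤ 4 * b ^ 2)
        have h2 : 4 * b ^ 2 * (b * (2 + B)) * 1 ≤ 4 * b ^ 2 * (b * (2 + B)) * M := by gcongr
        unfold interpConst
        linarith
      exacts [(iProd i).const_mul Δ, (iκz i).const_mul (4 * b ^ 2),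
        ((iProd i).const_mul Δ).sub ((iκz i).const_mul (4 * b ^ 2)), integrable_const _]
    · have h1 := abs_integral_update_sub_coordPoly_le hT hu hv hb hbB z i hc₁ hc₁' hξ₁
      have h0 := abs_integral_update_sub_coordPoly_le hT hu hv hb hbB z i hc₀ hc₀' hξ₀
      have a1 := abs_gibbs_pairEnergy_sub_le hT hu hv hb (hu i) z i
      have a2 := abs_gibbs_pairEnergy_sub_le hT hu hv hb (hv i) z i
      simp only [Pi.sub_apply]
      simp only [coordPoly] at h1 h0
      set z0 := Function.update z i 0
      set mu := gibbs T (pairEnergy u v b z) (u i)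
      set mv := gibbs T (pairEnergy u v b z) (v i)
      set mu0 := gibbs T (pairEnergy u v b z0) (u i)
      set mv0 := gibbs T (pairEnergy u v b z0) (v i)
      have k1 : |mu0| ≤ 1 := abs_gibbs_le hT _ (hu i)
      have k2 : |mv| ≤ 1 := abs_gibbs_le hT _ (hv i)
      have hK : 0 ≤ κ (z i) := by positivity
      -- The expansion is around the disorder with bond `i` removed, whereas `hpos` concerns the
      -- full Gibbs averages; each of the two factors changes by at most `2 κ (z i)`.
      have key : mu * mv - 4 * κ (z i) ≤ mu0 * mv0 := by
        have e : mu * mv - mu0 * mv0 = (mu - mu0) * mv + mu0 * (mv - mv0) := by ring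
        have b1 := le_abs_self ((mu - mu0) * mv)
        have b2 := le_abs_self (mu0 * (mv - mv0))
        rw [abs_mul] at b1 b2
        have d1 := mul_le_mul a1 k2 (abs_nonneg _) (by positivity)
        have d2 := mul_le_mul k1 a2 (abs_nonneg _) zero_le_one
        simp only [hκ]
        linarith
      have key2 := mul_le_mul_of_nonneg_left key hΔ
      have key3 := mul_le_mul_of_nonneg_right hΔ' (by positivity : 0 ≤ 4 * κ (z i))
      rw [abs_le] at h1 h0
      have hc : c₁ = c₀ + ρ₀ - ρ₁ := by linarith
      have hΔe : Δ = b ^ 2 * (ρ₀ - ρ₁) := rfl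
      have hcg := congrArg (fun c => b ^ 2 * c
        * gibbs T (pairEnergy u v b z0) fun σ => u i σ * v i σ) hc
      rw [hΔe] at key2 key3 ⊢
      linarith [h1.1, h0.2]
  refine le_trans ?_ (Finset.sum_le_sum fun i _ => hterm i)
  rw [Finset.sum_sub_distrib, ← Finset.mul_sum, ← integral_finsetSum _ fun i _ => iProd i]
  have : 0 ≤ ∫ z, ∑ i, gibbs T (pairEnergy u v b z) (u i)
      * gibbs T (pairEnergy u v b z) (v i) ∂π := integral_nonneg fun z => hpos _
  have := mul_nonneg hΔ this
  simp only [Finset.sum_const, Finset.card_univ, nsmul_eq_mul]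
  linarith

end Interpolation

/-! ### The pair laws used: resampled pairs, and a second disorder made of independent signs. -/

section Laws

lemma mix_self {E : Type*} [MeasurableSpace E] (ν : Measure E) {t : ℝ} (h0 : 0 ≤ t) (h1 : t ≤ 1) :
    mix ν ν t = ν := by
  rw [mix, ← add_smul, ← ENNReal.ofReal_add (by linarith) h0]
  simp

lemma map_mix {E E' : Type*} [MeasurableSpace E] [MeasurableSpace E'] (ν₀ ν₁ : Measure E) (t : ℝ)
    {f : E → E'} (hf : Measurable f) : (mix ν₀ ν₁ t).map f = mix (ν₀.map f) (ν₁.map f) t := by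
  rw [mix, Measure.map_add _ _ hf, Measure.map_smul, Measure.map_smul, mix]

lemma coupl_map_fst {μ : Measure ℝ} [IsProbabilityMeasure μ] {r : ℝ} (h0 : 0 ≤ r) (h1 : r ≤ 1) :
    (coupl μ r).map Prod.fst = μ := by
  rw [coupl, map_mix _ _ _ measurable_fst, Measure.map_map measurable_fst measurable_diag]
  simp [Function.comp_def, mix_self _ h0 h1]

lemma coupl_map_snd {μ : Measure ℝ} [IsProbabilityMeasure μ] {r : ℝ} (h0 : 0 ≤ r) (h1 : r ≤ 1) :
    (coupl μ r).map Prod.snd = μ := by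
  rw [coupl, map_mix _ _ _ measurable_snd, Measure.map_map measurable_snd measurable_diag]
  simp [Function.comp_def, mix_self _ h0 h1]

lemma isPairLaw_coupl {μ : Measure ℝ} {M : ℝ} (h : IsLaw μ M) {r : ℝ} (h0 : 0 ≤ r) (h1 : r ≤ 1) :
    IsPairLaw (coupl μ r) r M := by
  have := h.prob
  refine ⟨by rwa [coupl_map_fst h0 h1], by rwa [coupl_map_snd h0 h1], ?_⟩
  rw [integral_coupl (by fun_prop) (h.integrable_id.mul_prod h.integrable_id)
    (by simpa [sq] using h.integrable_sq) h0 h1, integral_prod_mul (fun a => a) (fun a => a), h.mean]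
  have := h.var
  simp only [sq] at this
  simp [this]

/-- The Rademacher law. -/
def rademacher : Measure ℝ := mix (Measure.dirac 1) (Measure.dirac (-1)) (1 / 2)

lemma integral_rademacher (f : ℝ → ℝ) : ∫ a, f a ∂rademacher = (f 1 + f (-1)) / 2 := by
  rw [rademacher, integral_mix (integrable_dirac (by finiteness)) (integrable_dirac (by finiteness))
    (by norm_num) (by norm_num)]
  simp
  ring

lemma isLaw_rademacher {M : ℝ} (hM : 1 ≤ M) : IsLaw rademacher M := by
  refine ⟨isProbabilityMeasure_mix _ _ (by norm_num) (by norm_num), ?_, ?_, ?_, ?_⟩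
  · exact ((integrable_dirac (by finiteness)).smul_measure ENNReal.ofReal_ne_top).add_measure
      ((integrable_dirac (by finiteness)).smul_measure ENNReal.ofReal_ne_top)
  · rw [integral_rademacher]
    simpa using hM
  · rw [integral_rademacher]
    simp
  · rw [integral_rademacher]
    norm_num

/-- `μ` need not be symmetric, so the gauge argument cannot be run on it. Random signs have the same
first two moments, and the interpolation does not require the marginals to agree. -/
lemma isPairLaw_prod_rademacher {μ : Measure ℝ} {M : ℝ} (h : IsLaw μ M) :
    IsPairLaw (μ.prod rademacher) 0 M := by
  have hr := isLaw_rademacher h.one_le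
  have := h.prob
  have := hr.prob
  refine ⟨by simpa using h, by simpa using hr, ?_⟩
  rw [integral_prod_mul (fun a => a) (fun a => a), h.mean, zero_mul]

lemma map_mul_rademacher {η : ℝ} (hη : η = 1 ∨ η = -1) :
    rademacher.map (fun a => η * a) = rademacher := by
  have hm : Measurable fun a : ℝ => η * a := by fun_prop
  rw [rademacher, map_mix _ _ _ hm, Measure.map_dirac' hm, Measure.map_dirac' hm]
  rcases hη with rfl | rfl
  · simp
  · simp only [mix]
    norm_num
    rw [add_comm]

lemma map_prod_rademacher (μ : Measure ℝ) [SFinite μ] {η : ℝ} (hη : η = 1 ∨ η = -1) :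
    (μ.prod rademacher).map (fun w => (w.1, η * w.2)) = μ.prod rademacher := by
  have : IsProbabilityMeasure rademacher := (isLaw_rademacher le_rfl).prob
  have := Measure.map_prod_map μ rademacher (f := fun a => a) (g := fun a => η * a)
    (by fun_prop) (by fun_prop)
  rw [map_mul_rademacher hη, Measure.map_id'] at this
  exact this.symm

end Laws

/-! ### Lower and upper bounds for the effect of a perturbation on `logZ`. -/

section Jensen

variable {α : Type*} {T : Finset α}

/-- Jensen for the exponential, through its tangent `exp Y ≥ exp m (1 + (Y - m))` at the mean `m`.
-/
lemma gibbs_le_logZ_sub (hT : T.Nonempty) (E Y : α → ℝ) :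
    gibbs T E Y ≤ logZ T (fun σ => E σ + Y σ) - logZ T E := by
  have hp := partition_pos hT E
  set m := gibbs T E Y with hm
  have h1 : Real.exp m * ∑ σ ∈ T, Real.exp (E σ) ≤ ∑ σ ∈ T, Real.exp (E σ + Y σ) := by
    have h2 : ∑ σ ∈ T, Real.exp (E σ) * (Real.exp m * (1 + (Y σ - m)))
        = Real.exp m * ∑ σ ∈ T, Real.exp (E σ) := by
      have h3 : (∑ σ ∈ T, Real.exp (E σ) * Y σ) = m * ∑ σ ∈ T, Real.exp (E σ) := by
        rw [hm, gibbs]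
        field_simp
      have : ∀ σ, Real.exp (E σ) * (Real.exp m * (1 + (Y σ - m)))
          = Real.exp m * (Real.exp (E σ) * Y σ) + Real.exp m * (1 - m) * Real.exp (E σ) :=
        fun σ => by ring
      simp only [this]
      rw [Finset.sum_add_distrib, ← Finset.mul_sum, ← Finset.mul_sum, h3]
      ring
    rw [← h2]
    refine Finset.sum_le_sum fun σ _ => ?_
    rw [Real.exp_add]
    refine mul_le_mul_of_nonneg_left ?_ (Real.exp_pos _).le
    have : Real.exp (Y σ) = Real.exp m * Real.exp (Y σ - m) := by
      rw [← Real.exp_add]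
      ring_nf
    rw [this]
    refine mul_le_mul_of_nonneg_left ?_ (Real.exp_pos _).le
    linarith [Real.add_one_le_exp (Y σ - m)]
  have h4 := Real.log_le_log (by positivity) h1
  rw [Real.log_mul (Real.exp_pos m).ne' hp.ne', Real.log_exp] at h4
  simp only [logZ]
  linarith

/-- The concavity bound `log y ≤ y / C + log C - 1` is affine in the Gibbs average `y`, so it can be
integrated over the disorder with one fixed `C`. -/
lemma logZ_sub_le (hT : T.Nonempty) (E Y : α → ℝ) {C : ℝ} (hC : 0 < C) :
    logZ T (fun σ => E σ + Y σ) - logZ T E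
      ≤ gibbs T E (fun σ => Real.exp (Y σ)) / C + Real.log C - 1 := by
  have hp := partition_pos hT E
  have hp' := partition_pos hT fun σ => E σ + Y σ
  have e : gibbs T E (fun σ => Real.exp (Y σ))
      = (∑ σ ∈ T, Real.exp (E σ + Y σ)) / ∑ σ ∈ T, Real.exp (E σ) := by
    simp only [gibbs, Real.exp_add]
  have hg : 0 < gibbs T E (fun σ => Real.exp (Y σ)) := by
    rw [e]
    positivity
  rw [logZ, logZ, ← Real.log_div hp'.ne' hp.ne', ← e]
  have := Real.log_le_sub_one_of_pos (div_pos hg hC)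
  rw [Real.log_div hg.ne' hC.ne'] at this
  linarith

end Jensen

/-! ### Free energy of two coupled copies, and its relation to the overlap. -/

section TwoCopies

variable {ι α : Type*} [Fintype ι] (T : Finset α) (s : ι → α → ℝ) (b : ℝ)

/-- The energy of two configurations with disorders `x` and `x'`. -/
def twoEnergy (z : ι → ℝ × ℝ) (p : α × α) : ℝ :=
  energy s b (fun i => (z i).1) p.1 + energy s b (fun i => (z i).2) p.2

/-- The expected free energy of two coupled copies. -/
def pairFree (ξ : Measure (ℝ × ℝ)) (c : ℝ) : ℝ :=
  ∫ z, logZ (T ×ˢ T) (pairEnergy (fun i p => s i p.1) (fun i p => s i p.2) b z)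
    ∂Measure.pi fun _ : ι => withConst ξ c

variable {T s b}

lemma pairEnergy_withConst (z : ι → ℝ × ℝ) (c : ℝ) :
    pairEnergy (fun i (p : α × α) => s i p.1) (fun i p => s i p.2) b
        (fun i => ((z i).1, (z i).2, c))
      = fun p => twoEnergy s b z p + b ^ 2 * c * ∑ i, s i p.1 * s i p.2 := by
  ext p
  simp only [pairEnergy, twoEnergy, energy, Finset.mul_sum, ← Finset.sum_add_distrib]
  exact Finset.sum_congr rfl fun i _ => by ring

lemma pairFree_eq (ξ : Measure (ℝ × ℝ)) [IsProbabilityMeasure ξ] (c : ℝ) :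
    pairFree T s b ξ c = ∫ z, logZ (T ×ˢ T)
      (fun p => twoEnergy s b z p + b ^ 2 * c * ∑ i, s i p.1 * s i p.2)
        ∂Measure.pi fun _ : ι => ξ := by
  have hp : IsProbabilityMeasure (ξ.map fun w => (w.1, w.2, c)) :=
    Measure.isProbabilityMeasure_map (measurable_withConst c).aemeasurable
  have h := Measure.pi_map_pi (f := fun (_ : ι) (w : ℝ × ℝ) => (w.1, w.2, c)) (μ := fun _ => ξ)
    (fun i => (measurable_withConst c).aemeasurable)
  simp only [pairFree, withConst]
  rw [← h, integral_map (by fun_prop) measurable_logZ_pairEnergy.aestronglyMeasurable]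
  simp only [pairEnergy_withConst]

lemma sum_exp_twoEnergy_mul (z : ι → ℝ × ℝ) (φ ψ : α → ℝ) :
    ∑ p ∈ T ×ˢ T, Real.exp (twoEnergy s b z p) * (φ p.1 * ψ p.2)
      = (∑ σ ∈ T, Real.exp (energy s b (fun i => (z i).1) σ) * φ σ)
        * ∑ τ ∈ T, Real.exp (energy s b (fun i => (z i).2) τ) * ψ τ := by
  rw [Finset.sum_mul_sum, Finset.sum_product]
  refine Finset.sum_congr rfl fun σ _ => Finset.sum_congr rfl fun τ _ => ?_
  simp only [twoEnergy, Real.exp_add]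
  ring

lemma sum_exp_twoEnergy (z : ι → ℝ × ℝ) :
    ∑ p ∈ T ×ˢ T, Real.exp (twoEnergy s b z p)
      = (∑ σ ∈ T, Real.exp (energy s b (fun i => (z i).1) σ))
        * ∑ τ ∈ T, Real.exp (energy s b (fun i => (z i).2) τ) := by
  simpa using sum_exp_twoEnergy_mul (T := T) (s := s) (b := b) z (fun _ => 1) (fun _ => 1)

lemma gibbs_twoEnergy_mul (z : ι → ℝ × ℝ) (i : ι) :
    gibbs (T ×ˢ T) (twoEnergy s b z) (fun p => s i p.1 * s i p.2)
      = spin T s b i (fun j => (z j).1) * spin T s b i (fun j => (z j).2) := by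
  rw [gibbs, sum_exp_twoEnergy_mul z (s i) (s i), sum_exp_twoEnergy, spin, spin, gibbs, gibbs,
    div_mul_div_comm]

variable (hT : T.Nonempty) (hs : ∀ i, ∀ σ ∈ T, |s i σ| ≤ 1) (hb : 0 ≤ b)

include hT in
lemma logZ_twoEnergy (z : ι → ℝ × ℝ) :
    logZ (T ×ˢ T) (twoEnergy s b z)
      = free T s b (fun j => (z j).1) + free T s b (fun j => (z j).2) := by
  rw [logZ, sum_exp_twoEnergy, Real.log_mul (partition_pos hT _).ne' (partition_pos hT _).ne']
  rfl

include hT hs hb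

/-- Without coupling the partition function factorizes, so only the marginals of `ξ` matter. In
particular the value is the same for all `coupl μ r` with `0 ≤ r ≤ 1`. -/
lemma pairFree_zero {ξ : Measure (ℝ × ℝ)} (h : SecondMoment ξ) :
    pairFree T s b ξ 0 = ∫ x, free T s b x ∂(Measure.pi fun _ => ξ.map Prod.fst)
      + ∫ x, free T s b x ∂(Measure.pi fun _ => ξ.map Prod.snd) := by
  have := h.1
  have hF := growth_free hT hs hb
  have p1 : IsProbabilityMeasure (ξ.map Prod.fst) := Measure.isProbabilityMeasure_map (by fun_prop)
  have p2 : IsProbabilityMeasure (ξ.map Prod.snd) := Measure.isProbabilityMeasure_map (by fun_prop)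
  have h1 := Measure.pi_map_pi (f := fun (_ : ι) (w : ℝ × ℝ) => w.1) (μ := fun _ => ξ)
    (fun i => by fun_prop)
  have h2 := Measure.pi_map_pi (f := fun (_ : ι) (w : ℝ × ℝ) => w.2) (μ := fun _ => ξ)
    (fun i => by fun_prop)
  change Measure.map _ _ = Measure.pi fun _ => ξ.map Prod.fst at h1
  change Measure.map _ _ = Measure.pi fun _ => ξ.map Prod.snd at h2
  have m1 : Measurable fun (z : ι → ℝ × ℝ) i => (z i).1 := by fun_prop
  have m2 : Measurable fun (z : ι → ℝ × ℝ) i => (z i).2 := by fun_prop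
  rw [pairFree_eq, ← h1, ← h2, integral_map m1.aemeasurable hF.1.aestronglyMeasurable,
    integral_map m2.aemeasurable hF.1.aestronglyMeasurable,
    ← integral_add (hF.comp_fst.integrable one_le_two fun _ => h)
      (hF.comp_snd.integrable one_le_two fun _ => h)]
  simp only [mul_zero, zero_mul, add_zero]
  congr 1
  ext z
  exact logZ_twoEnergy hT z

lemma growth_logZ_twoEnergy (c : ℝ) : Growth 1 fun z : ι → ℝ × ℝ => logZ (T ×ˢ T)
    (fun p => twoEnergy s b z p + b ^ 2 * c * ∑ i, s i p.1 * s i p.2) := by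
  have hTT : (T ×ˢ T).Nonempty := hT.product hT
  have h0 : Growth 1 fun z : ι → ℝ × ℝ => logZ (T ×ˢ T) (twoEnergy s b z) := by
    simp only [logZ_twoEnergy hT]
    exact (growth_free hT hs hb).comp_fst.add (growth_free hT hs hb).comp_snd
  have h1 : Growth 1 fun z : ι → ℝ × ℝ => logZ (T ×ˢ T)
    (fun p => twoEnergy s b z p + b ^ 2 * c * ∑ i, s i p.1 * s i p.2)
      - logZ (T ×ˢ T) (twoEnergy s b z) := by
    refine (Growth.of_bounded (C := ∑ p ∈ T ×ˢ T, |b ^ 2 * c * ∑ i, s i p.1 * s i p.2|) ?_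
      fun z => abs_logZ_sub_le hTT _ fun p hp => ?_).mono zero_le_one
    · unfold logZ twoEnergy energy
      fun_prop
    · exact Finset.single_le_sum (f := fun p : α × α => |b ^ 2 * c * ∑ i, s i p.1 * s i p.2|)
        (fun _ _ => abs_nonneg _) hp
  simpa using h1.add h0

/-- Convexity of the coupled free energy in the coupling bounds the overlaps. -/
lemma sum_overlap_le {ξ : Measure (ℝ × ℝ)} (h : SecondMoment ξ) (c : ℝ) :
    b ^ 2 * c * ∑ i, overlap T s b ξ i ≤ pairFree T s b ξ c - pairFree T s b ξ 0 := by
  have := h.1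
  have hTT : (T ×ˢ T).Nonempty := hT.product hT
  have io : ∀ i, Integrable (fun z : ι → ℝ × ℝ => spin T s b i (fun j => (z j).1)
      * spin T s b i (fun j => (z j).2)) (Measure.pi fun _ => ξ) := fun i =>
    ((growth_spin hT hs i).comp_fst.mul (growth_spin hT hs i).comp_snd).integrable zero_le_two
      fun _ => h
  have ic := (growth_logZ_twoEnergy hT hs hb c).integrable one_le_two fun _ => h
  have i0 := (growth_logZ_twoEnergy hT hs hb 0).integrable one_le_two fun _ => h
  rw [pairFree_eq, pairFree_eq, ← integral_sub ic i0]
  simp only [overlap]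
  rw [← integral_finsetSum _ fun i _ => io i, ← integral_const_mul]
  refine integral_mono ((integrable_finsetSum _ fun i _ => io i).const_mul _) (ic.sub i0)
    fun z => ?_
  simp only [mul_zero, zero_mul, add_zero]
  refine le_of_eq_of_le ?_ (gibbs_le_logZ_sub hTT (twoEnergy s b z)
    fun p => b ^ 2 * c * ∑ i, s i p.1 * s i p.2)
  rw [gibbs_const_mul, gibbs_sum]
  simp only [gibbs_twoEnergy_mul]

lemma pairFree_sub_le {ξ : Measure (ℝ × ℝ)} (h : SecondMoment ξ) {c C : ℝ} (hC : 0 < C)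
    (hle : ∫ z, gibbs (T ×ˢ T) (twoEnergy s b z)
      (fun p => Real.exp (b ^ 2 * c * ∑ i, s i p.1 * s i p.2)) ∂(Measure.pi fun _ => ξ) ≤ C) :
    pairFree T s b ξ c - pairFree T s b ξ 0 ≤ Real.log C := by
  have := h.1
  have hTT : (T ×ˢ T).Nonempty := hT.product hT
  have ic := (growth_logZ_twoEnergy hT hs hb c).integrable one_le_two fun _ => h
  have i0 := (growth_logZ_twoEnergy hT hs hb 0).integrable one_le_two fun _ => h
  have ig : Integrable (fun z : ι → ℝ × ℝ => gibbs (T ×ˢ T) (twoEnergy s b z)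
      (fun p => Real.exp (b ^ 2 * c * ∑ i, s i p.1 * s i p.2))) (Measure.pi fun _ => ξ) := by
    refine (Growth.of_bounded
      (C := ∑ p ∈ T ×ˢ T, |Real.exp (b ^ 2 * c * ∑ i, s i p.1 * s i p.2)|) ?_
      fun z => abs_gibbs_le hTT _ fun p hp => ?_).integrable zero_le_two fun _ => h
    · unfold gibbs twoEnergy energy
      fun_prop
    · exact Finset.single_le_sum
        (f := fun p : α × α => |Real.exp (b ^ 2 * c * ∑ i, s i p.1 * s i p.2)|)
        (fun _ _ => abs_nonneg _) hp
  rw [pairFree_eq, pairFree_eq, ← integral_sub ic i0]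
  refine (integral_mono (ic.sub i0)
    ((ig.div_const C).add (integrable_const (Real.log C - 1))) fun z => ?_).trans ?_
  · simp only [mul_zero, zero_mul, add_zero, Pi.add_apply]
    rw [← add_sub_assoc]
    exact logZ_sub_le hTT (twoEnergy s b z) _ hC
  · simp only [Pi.add_apply]
    rw [integral_add (ig.div_const C) (integrable_const _), integral_div]
    simp only [integral_const, probReal_univ, smul_eq_mul, one_mul]
    have := (div_le_one hC).2 hle
    linarith

end TwoCopies

/-! ### Spin configurations, bonds, and exponential moments of the magnetization. -/

section Configs

variable {N : ℕ}

lemma mem_configs {σ : Fin N → ℝ} : σ ∈ configs N ↔ ∀ i, σ i = -1 ∨ σ i = 1 := by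
  simp [configs]

lemma configs_nonempty : (configs N).Nonempty := ⟨fun _ => 1, mem_configs.2 fun _ => Or.inr rfl⟩

lemma mul_self_of_mem_configs {σ : Fin N → ℝ} (h : σ ∈ configs N) (i : Fin N) :
    σ i * σ i = 1 := by
  rcases mem_configs.1 h i with h | h <;> simp [h]

lemma mul_mem_configs {σ τ : Fin N → ℝ} (hσ : σ ∈ configs N) (hτ : τ ∈ configs N) :
    σ * τ ∈ configs N := by
  refine mem_configs.2 fun i => ?_
  rcases mem_configs.1 hσ i with h | h <;> rcases mem_configs.1 hτ i with h' | h' <;> simp [h, h']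

lemma mul_mul_cancel_configs {σ : Fin N → ℝ} (h : σ ∈ configs N) (τ : Fin N → ℝ) :
    σ * (σ * τ) = τ := by
  ext i
  simp [← mul_assoc, mul_self_of_mem_configs h]

lemma sum_configs_mul {η : Fin N → ℝ} (h : η ∈ configs N) (φ : (Fin N → ℝ) → ℝ) :
    ∑ σ ∈ configs N, φ (η * σ) = ∑ σ ∈ configs N, φ σ :=
  Finset.sum_nbij' (fun σ => η * σ) (fun σ => η * σ) (fun _ hσ => mul_mem_configs h hσ)
    (fun _ hσ => mul_mem_configs h hσ) (fun _ _ => mul_mul_cancel_configs h _)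
    (fun _ _ => mul_mul_cancel_configs h _) (fun _ _ => rfl)

/-- The interaction of a pair of spins. -/
def bond (e : Fin N × Fin N) (σ : Fin N → ℝ) : ℝ := σ e.1 * σ e.2

lemma bond_eq {σ : Fin N → ℝ} (h : σ ∈ configs N) (e : Fin N × Fin N) :
    bond e σ = 1 ∨ bond e σ = -1 := by
  unfold bond
  rcases mem_configs.1 h e.1 with h | h <;> rcases mem_configs.1 ‹_› e.2 with h' | h' <;>
    simp [h, h']

lemma abs_bond_le (e : Fin N × Fin N) : ∀ σ ∈ configs N, |bond e σ| ≤ 1 := fun σ h => by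
  rcases bond_eq h e with h | h <;> simp [h]

lemma sum_bond_mul (σ τ : Fin N → ℝ) : ∑ e, bond e σ * bond e τ = (∑ i, σ i * τ i) ^ 2 := by
  rw [sq, Finset.sum_mul_sum, Fintype.sum_prod_type]
  refine Finset.sum_congr rfl fun i _ => Finset.sum_congr rfl fun j _ => ?_
  simp only [bond]
  ring

/-- With two independent draws `q, p` from the Gibbs measure of the pair, the sum is the average of
`∑_e bond e q.1 * bond e p.2`, which is a perfect square. This is the sign condition `hpos` of the
interpolation. -/
lemma sum_gibbs_bond_nonneg (E : (Fin N → ℝ) × (Fin N → ℝ) → ℝ) :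
    0 ≤ ∑ e, gibbs (configs N ×ˢ configs N) E (fun p => bond e p.1)
      * gibbs (configs N ×ˢ configs N) E (fun p => bond e p.2) := by
  have h : ∑ e, gibbs (configs N ×ˢ configs N) E (fun p => bond e p.1)
      * gibbs (configs N ×ˢ configs N) E (fun p => bond e p.2)
      = gibbs (configs N ×ˢ configs N) E fun p => gibbs (configs N ×ˢ configs N) E fun q =>
        (∑ i, q.1 i * p.2 i) ^ 2 := by
    simp only [← sum_bond_mul, gibbs_sum]
    refine Finset.sum_congr rfl fun e _ => ?_
    rw [← gibbs_const_mul]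
    congr 1
    ext p
    rw [mul_comm, ← gibbs_const_mul]
    simp only [mul_comm]
  rw [h]
  have h0 : ∀ φ : (Fin N → ℝ) × (Fin N → ℝ) → ℝ, (∀ p, 0 ≤ φ p) →
      0 ≤ gibbs (configs N ×ˢ configs N) E φ := fun φ hφ =>
    div_nonneg (Finset.sum_nonneg fun p _ => mul_nonneg (Real.exp_pos _).le (hφ p))
      (Finset.sum_nonneg fun p _ => (Real.exp_pos _).le)
  exact h0 _ fun p => h0 _ fun q => sq_nonneg _

lemma freeEnergy_eq (β : ℝ) (x : Fin N → Fin N → ℝ) :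
    freeEnergy β N x = free (configs N) bond (β / Real.sqrt N) fun e => x e.1 e.2 := by
  unfold freeEnergy free logZ hamiltonian energy
  simp only [neg_neg, Fintype.sum_prod_type, bond, mul_assoc]

lemma sum_configs_exp_le (t : ℝ) :
    ∑ σ ∈ configs N, Real.exp (t * ∑ i, σ i) ≤ (configs N).card * Real.exp (N * t ^ 2 / 2) := by
  have h1 : ∀ σ : Fin N → ℝ, Real.exp (t * ∑ i, σ i) = ∏ i, Real.exp (t * σ i) := fun σ => by
    rw [Finset.mul_sum, Real.exp_sum]
  have h2 : ∑ a ∈ ({-1, 1} : Finset ℝ), Real.exp (t * a) = 2 * Real.cosh t := by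
    rw [Finset.sum_pair (by norm_num), Real.cosh_eq]
    ring_nf
  have h3 : ((configs N).card : ℝ) = 2 ^ N := by
    have : ({-1, 1} : Finset ℝ).card = 2 := Finset.card_pair (by norm_num)
    simp [configs, Fintype.card_piFinset, this]
  have h4 := Finset.prod_univ_sum (fun _ : Fin N => ({-1, 1} : Finset ℝ))
    fun _ a => Real.exp (t * a)
  change _ = ∑ σ ∈ configs N, ∏ i, Real.exp (t * σ i) at h4
  simp only [h1]
  rw [← h4, h3]
  simp only [h2, Finset.prod_const, Finset.card_univ, Fintype.card_fin, mul_pow]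
  refine mul_le_mul_of_nonneg_left ?_ (by positivity)
  calc Real.cosh t ^ N ≤ Real.exp (t ^ 2 / 2) ^ N :=
        pow_le_pow_left₀ (Real.cosh_pos t).le (Real.cosh_le_exp_half_sq t) N
    _ = Real.exp (N * t ^ 2 / 2) := by
        rw [← Real.exp_nat_mul]
        ring_nf

lemma exists_int_sum {σ : Fin N → ℝ} (h : σ ∈ configs N) :
    ∃ k ∈ Finset.Icc (-N : ℤ) N, ∑ i, σ i = k := by
  have : ∀ i, ∃ k : ℤ, |k| ≤ 1 ∧ σ i = k := fun i => by
    rcases mem_configs.1 h i with h | h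
    · exact ⟨-1, by simp, by simp [h]⟩
    · exact ⟨1, by simp, by simp [h]⟩
  choose k hk hσ using this
  refine ⟨∑ i, k i, ?_, by simp [hσ]⟩
  rw [Finset.mem_Icc, ← abs_le]
  refine (Finset.abs_sum_le_sum_abs _ _).trans ((Finset.sum_le_sum fun i _ => hk i).trans ?_)
  simp

/-- Subgaussian bound for the square of the magnetization. -/
lemma sum_configs_exp_sq_le (hN : 0 < N) {κ : ℝ} (h0 : 0 ≤ κ) (h1 : κ ≤ 1 / 2) :
    ∑ σ ∈ configs N, Real.exp (κ / N * (∑ i, σ i) ^ 2)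
      ≤ (configs N).card * (2 * N + 1) := by
  have hN' : (0 : ℝ) < N := by exact_mod_cast hN
  -- A discrete linearization of the square: the magnetization is an integer `k` in `[-N, N]`, and
  -- `k² = -k² + 2k ∑ σ i` for that value. Summing over all `k` leaves only linear exponents, at the
  -- price of a factor `2N + 1`.
  calc ∑ σ ∈ configs N, Real.exp (κ / N * (∑ i, σ i) ^ 2)
      ≤ ∑ σ ∈ configs N, ∑ k ∈ Finset.Icc (-N : ℤ) N,
          Real.exp (-(κ / N * k ^ 2)) * Real.exp (2 * κ / N * k * ∑ i, σ i) := by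
        refine Finset.sum_le_sum fun σ hσ => ?_
        obtain ⟨k, hk, hs⟩ := exists_int_sum hσ
        refine le_of_eq_of_le ?_ (Finset.single_le_sum
          (f := fun k : ℤ => Real.exp (-(κ / N * k ^ 2)) * Real.exp (2 * κ / N * k * ∑ i, σ i))
          (fun _ _ => by positivity) hk)
        rw [← Real.exp_add, hs]
        ring_nf
    _ = ∑ k ∈ Finset.Icc (-N : ℤ) N, Real.exp (-(κ / N * k ^ 2))
          * ∑ σ ∈ configs N, Real.exp (2 * κ / N * k * ∑ i, σ i) := by
        rw [Finset.sum_comm]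
        simp only [Finset.mul_sum]
    _ ≤ ∑ k ∈ Finset.Icc (-N : ℤ) N, ((configs N).card : ℝ) := by
        refine Finset.sum_le_sum fun k _ => ?_
        refine (mul_le_mul_of_nonneg_left (sum_configs_exp_le _) (Real.exp_pos _).le).trans ?_
        rw [mul_left_comm, ← Real.exp_add]
        refine mul_le_of_le_one_right (by positivity) (Real.exp_le_one_iff.2 ?_)
        -- The condition `κ ≤ 1/2` is exactly what makes the combined exponent nonpositive for every
        -- `k`.
        have : -(κ / N * (k : ℝ) ^ 2) + N * (2 * κ / N * k) ^ 2 / 2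
            = -(κ * (1 - 2 * κ) * (k : ℝ) ^ 2 / N) := by
          field_simp
          ring
        rw [this, neg_nonpos]
        have : 0 ≤ 1 - 2 * κ := by linarith
        positivity
    _ = (configs N).card * (2 * N + 1) := by
        rw [Finset.sum_const, Int.card_Icc, nsmul_eq_mul]
        have : ((N : ℤ) + 1 - -N).toNat = 2 * N + 1 := by omega
        rw [this]
        push_cast
        ring

end Configs

/-! ### Gauge symmetry of the second copy. -/

section Gauge

variable {N : ℕ} {b : ℝ}

/-- The change of signs of the second disorder induced by the configuration `η`. -/
def gauge (η : Fin N → ℝ) (z : Fin N × Fin N → ℝ × ℝ) (e : Fin N × Fin N) : ℝ × ℝ :=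
  ((z e).1, bond e η * (z e).2)

/-- Bonds are multiplicative in the configuration, so signs put on the second disorder can be moved
onto the second configuration. -/
lemma twoEnergy_gauge (η : Fin N → ℝ) (z : Fin N × Fin N → ℝ × ℝ)
    (p : (Fin N → ℝ) × (Fin N → ℝ)) :
    twoEnergy bond b (gauge η z) p = twoEnergy bond b z (p.1, η * p.2) := by
  simp only [twoEnergy, energy, gauge]
  congr 2
  refine Finset.sum_congr rfl fun e _ => ?_
  simp only [bond, Pi.mul_apply]
  ring

lemma sum_prod_configs_mul {η : Fin N → ℝ} (h : η ∈ configs N)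
    (φ : (Fin N → ℝ) × (Fin N → ℝ) → ℝ) :
    ∑ p ∈ configs N ×ˢ configs N, φ (p.1, η * p.2) = ∑ p ∈ configs N ×ˢ configs N, φ p := by
  rw [Finset.sum_product, Finset.sum_product]
  exact Finset.sum_congr rfl fun σ _ => sum_configs_mul h fun τ => φ (σ, τ)

lemma gibbs_gauge {η : Fin N → ℝ} (h : η ∈ configs N) (z : Fin N × Fin N → ℝ × ℝ)
    (φ : (Fin N → ℝ) × (Fin N → ℝ) → ℝ) :
    gibbs (configs N ×ˢ configs N) (twoEnergy bond b (gauge η z)) φ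
      = gibbs (configs N ×ˢ configs N) (twoEnergy bond b z) fun p => φ (p.1, η * p.2) := by
  simp only [gibbs, twoEnergy_gauge]
  rw [← sum_prod_configs_mul h fun p => Real.exp (twoEnergy bond b z (p.1, η * p.2)) * φ p,
    ← sum_prod_configs_mul h fun p => Real.exp (twoEnergy bond b z (p.1, η * p.2))]
  simp only [mul_mul_cancel_configs h]

lemma measurePreserving_gauge (μ : Measure ℝ) [IsProbabilityMeasure μ] {η : Fin N → ℝ}
    (h : η ∈ configs N) :
    MeasurePreserving (gauge η) (Measure.pi fun _ : Fin N × Fin N => μ.prod rademacher)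
      (Measure.pi fun _ => μ.prod rademacher) := by
  have : IsProbabilityMeasure rademacher := (isLaw_rademacher le_rfl).prob
  exact measurePreserving_pi (fun _ : Fin N × Fin N => μ.prod rademacher)
    (fun _ => μ.prod rademacher) (f := fun e w => (w.1, bond e η * w.2))
    fun e => ⟨by fun_prop, map_prod_rademacher μ (bond_eq h e)⟩

lemma measurable_gibbs_twoEnergy (φ : (Fin N → ℝ) × (Fin N → ℝ) → ℝ) :
    Measurable fun z => gibbs (configs N ×ˢ configs N) (twoEnergy bond b z) φ := by
  unfold gibbs twoEnergy energy
  fun_prop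

/-- For a symmetric second disorder, the overlap has the exponential moments of the magnetization
of uniform spins. -/
lemma integral_gibbs_exp_le (hN : 0 < N) {μ : Measure ℝ} {M : ℝ} (hμ : IsLaw μ M) {κ : ℝ}
    (h0 : 0 ≤ κ) (h1 : κ ≤ 1 / 2) :
    ∫ z, gibbs (configs N ×ˢ configs N) (twoEnergy bond b z)
      (fun p => Real.exp (κ / N * ∑ e, bond e p.1 * bond e p.2))
        ∂(Measure.pi fun _ => μ.prod rademacher) ≤ 2 * N + 1 := by
  have := hμ.prob
  have hr := (isLaw_rademacher hμ.one_le)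
  have := hr.prob
  have hs := hμ.secondMoment.prod hr.secondMoment
  set T := configs N
  have hT : (T ×ˢ T).Nonempty := configs_nonempty.product configs_nonempty
  set π := Measure.pi fun _ : Fin N × Fin N => μ.prod rademacher
  set φ : (Fin N → ℝ) × (Fin N → ℝ) → ℝ :=
    fun p => Real.exp (κ / N * ∑ e, bond e p.1 * bond e p.2) with hφ
  have hint : ∀ ψ : (Fin N → ℝ) × (Fin N → ℝ) → ℝ,
      Integrable (fun z => gibbs (T ×ˢ T) (twoEnergy bond b z) ψ) π := fun ψ =>
    (Growth.of_bounded (C := ∑ p ∈ T ×ˢ T, |ψ p|) (measurable_gibbs_twoEnergy ψ)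
      fun z => abs_gibbs_le hT _ fun p hp => Finset.single_le_sum (f := fun p => |ψ p|)
        (fun _ _ => abs_nonneg _) hp).integrable zero_le_two fun _ => hs
  have hg : ∀ η ∈ T, ∫ z, gibbs (T ×ˢ T) (twoEnergy bond b z) φ ∂π
      = ∫ z, gibbs (T ×ˢ T) (twoEnergy bond b z) (fun p => φ (p.1, η * p.2)) ∂π := fun η hη => by
    have hm := measurePreserving_gauge μ hη
    have e : ∀ z, gibbs (T ×ˢ T) (twoEnergy bond b z) (fun p => φ (p.1, η * p.2))
        = gibbs (T ×ˢ T) (twoEnergy bond b (gauge η z)) φ := fun z => (gibbs_gauge hη z φ).symm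
    simp only [e]
    have := integral_map (μ := π) (φ := gauge η) hm.measurable.aemeasurable
      (f := fun z => gibbs (T ×ˢ T) (twoEnergy bond b z) φ)
      (measurable_gibbs_twoEnergy φ).aestronglyMeasurable
    rw [hm.map_eq] at this
    exact this
  have hc : (0 : ℝ) < T.card := by exact_mod_cast Finset.card_pos.2 configs_nonempty
  -- The law of the disorder is invariant under every gauge `η`, so the expectation may be averaged
  -- over `η`, which then acts as a uniform configuration independent of the Gibbs weights.
  have hsum : T.card * ∫ z, gibbs (T ×ˢ T) (twoEnergy bond b z) φ ∂π
      = ∫ z, gibbs (T ×ˢ T) (twoEnergy bond b z) (fun p => ∑ η ∈ T, φ (p.1, η * p.2)) ∂π := by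
    simp only [gibbs_sum]
    rw [integral_finsetSum _ fun η _ => hint _, ← Finset.sum_congr rfl hg, Finset.sum_const,
      nsmul_eq_mul]
  have hle : ∀ p ∈ T ×ˢ T, |∑ η ∈ T, φ (p.1, η * p.2)| ≤ T.card * (2 * N + 1) := fun p hp => by
    obtain ⟨hp1, hp2⟩ := Finset.mem_product.1 hp
    rw [abs_of_nonneg (Finset.sum_nonneg fun _ _ => (Real.exp_pos _).le)]
    refine le_of_eq_of_le ?_ (sum_configs_exp_sq_le hN h0 h1)
    -- For fixed `p` the map `η ↦ p.1 * p.2 * η` permutes the configurations and turns the overlap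
    -- of `p.1` and `η * p.2` into a magnetization.
    rw [← sum_configs_mul (mul_mem_configs hp1 hp2)
      fun σ => Real.exp (κ / N * (∑ i, σ i) ^ 2)]
    refine Finset.sum_congr rfl fun η _ => ?_
    simp only [sum_bond_mul, Pi.mul_apply]
    congr 3
    exact Finset.sum_congr rfl fun i _ => by ring
  have hfin : ∫ z, gibbs (T ×ˢ T) (twoEnergy bond b z) (fun p => ∑ η ∈ T, φ (p.1, η * p.2)) ∂π
      ≤ T.card * (2 * N + 1) := by
    refine (integral_mono (hint _) (integrable_const (T.card * (2 * N + 1) : ℝ)) fun z =>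
      (le_abs_self _).trans (abs_gibbs_le hT _ hle)).trans ?_
    simp
  rw [← hsum] at hfin
  exact le_of_mul_le_mul_left hfin hc

end Gauge

/-! ### The noisy sum, and the choice of the cutoff level. -/

section VarianceBound

/-- The noise level at which the overlap is controlled. -/
def noiseLevel (β : ℝ) : ℝ := 1 / (4 * β ^ 2 + 2)

lemma noiseLevel_pos (β : ℝ) : 0 < noiseLevel β := by
  unfold noiseLevel
  positivity

lemma noiseLevel_le (β : ℝ) : noiseLevel β ≤ 1 / 2 := by
  unfold noiseLevel
  gcongr
  nlinarith [sq_nonneg β]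

/-- The bound `1/2` is the threshold for the exponential moment of the overlap under coupling `2ρ`;
it dictates `noiseLevel`. -/
lemma sq_mul_noiseLevel_le (β : ℝ) : β ^ 2 * (2 * noiseLevel β) ≤ 1 / 2 := by
  unfold noiseLevel
  rw [← mul_assoc, mul_one_div, div_le_div_iff₀ (by positivity) (by norm_num)]
  nlinarith [sq_nonneg β]

variable {β : ℝ} {N : ℕ} {μ : Measure ℝ} {M : ℝ}

lemma sum_noise_le (hβ : 0 < β) (hN : 0 < N) (hμ : IsLaw μ M) :
    ∑ e, pairInt (fun _ => coupl μ (noiseLevel β))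
        (dif μ e (free (configs N) bond (β / Real.sqrt N)))
      ≤ Real.log (2 * N + 1)
        + (2 * interpConst β + 40) * (N ^ 2 * ((β / Real.sqrt N) ^ 3 * M)) := by
  have := hμ.prob
  set ρ := noiseLevel β
  have hρ0 : 0 < ρ := noiseLevel_pos β
  have hρ1 : ρ ≤ 1 / 2 := noiseLevel_le β
  have hN' : (0 : ℝ) < N := by exact_mod_cast hN
  have hN1 : (1 : ℝ) ≤ N := by exact_mod_cast hN
  set b := β / Real.sqrt N with hb
  have hb0 : 0 ≤ b := by positivity
  have hbβ : b ≤ β := div_le_self hβ.le (Real.one_le_sqrt.2 hN1)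
  have hb2 : b ^ 2 = β ^ 2 / N := by rw [hb, div_pow, Real.sq_sqrt hN'.le]
  have hT := configs_nonempty (N := N)
  have hTT : (configs N ×ˢ configs N).Nonempty := hT.product hT
  have hs := abs_bond_le (N := N)
  have hξ := isPairLaw_coupl hμ hρ0.le (by linarith : ρ ≤ 1)
  have hξ0 := isPairLaw_coupl hμ le_rfl zero_le_one
  have hr := isPairLaw_prod_rademacher hμ
  have hcard : (Fintype.card (Fin N × Fin N) : ℝ) = N ^ 2 := by
    simp [sq]
  have hu : ∀ e : Fin N × Fin N, ∀ p ∈ configs N ×ˢ configs N, |bond e p.1| ≤ 1 :=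
    fun e p hp => hs e p.1 (Finset.mem_product.1 hp).1
  have hv : ∀ e : Fin N × Fin N, ∀ p ∈ configs N ×ˢ configs N, |bond e p.2| ≤ 1 :=
    fun e p hp => hs e p.2 (Finset.mem_product.1 hp).2
  -- Correlation `ρ` with coupling `ρ` becomes correlation `0` with coupling `2ρ`, the second
  -- disorder becoming a sign at the same time.
  have l1 := integral_pairEnergy_le hTT hu hv hb0 hbβ sum_gibbs_bond_nonneg hρ0.le
    (by linarith : ρ ≤ 1) (by linarith : 0 ≤ 2 * ρ) (by linarith : 2 * ρ ≤ 1) hρ0.le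
    (by ring : ρ + ρ = 2 * ρ + 0) hξ hr
  -- Without coupling, the signs must be exchanged back for `μ`. Correlation and coupling are `0` on
  -- both sides, so this is pure universality. By `e1` and `e2` the result equals the uncoupled
  -- value for `coupl μ ρ`.
  have l2 := integral_pairEnergy_le hTT hu hv hb0 hbβ sum_gibbs_bond_nonneg le_rfl
    zero_le_one le_rfl zero_le_one le_rfl (rfl : (0 : ℝ) + 0 = 0 + 0) hr hξ0
  have l3 := sum_overlap_le hT hs hb0 hξ.secondMoment ρ
  have e1 := pairFree_zero hT hs hb0 hξ.secondMoment
  have e2 := pairFree_zero hT hs hb0 hξ0.secondMoment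
  have marg : ∀ r, 0 ≤ r → r ≤ 1 → (coupl μ r).map Prod.fst = μ ∧ (coupl μ r).map Prod.snd = μ :=
    fun r h0 h1 => ⟨coupl_map_fst h0 h1, coupl_map_snd h0 h1⟩
  rw [(marg ρ hρ0.le (by linarith)).1, (marg ρ hρ0.le (by linarith)).2] at e1
  rw [(marg 0 le_rfl zero_le_one).1, (marg 0 le_rfl zero_le_one).2] at e2
  have l4 : pairFree (configs N) bond b (μ.prod rademacher) (2 * ρ)
      - pairFree (configs N) bond b (μ.prod rademacher) 0 ≤ Real.log (2 * N + 1) := by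
    refine pairFree_sub_le hT hs hb0 hr.secondMoment (by positivity) ?_
    have := integral_gibbs_exp_le (b := b) hN hμ (by positivity : 0 ≤ β ^ 2 * (2 * ρ))
      (sq_mul_noiseLevel_le β)
    rwa [mul_div_right_comm, ← hb2] at this
  have l5 : ∀ e, pairInt (fun _ => coupl μ ρ) (dif μ e (free (configs N) bond b))
      ≤ b ^ 2 * ρ * overlap (configs N) bond b (coupl μ ρ) e + 40 * b ^ 3 * M := fun e =>
    pairInt_dif_free_le hT hs hb0 hμ hρ0.le (by linarith) hξ e
  refine (Finset.sum_le_sum fun e _ => l5 e).trans ?_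
  rw [Finset.sum_add_distrib, ← Finset.mul_sum, Finset.sum_const, Finset.card_univ, nsmul_eq_mul,
    hcard]
  rw [hcard] at l1 l2
  change pairFree (configs N) bond b (coupl μ ρ) ρ
    ≤ pairFree (configs N) bond b (μ.prod rademacher) (2 * ρ) + _ at l1
  change pairFree (configs N) bond b (μ.prod rademacher) 0
    ≤ pairFree (configs N) bond b (coupl μ 0) 0 + _ at l2
  linarith

lemma sum_diag_le (hβ : 0 < β) (hN : 0 < N) (hμ : IsLaw μ M) :
    ∑ e, pairInt (fun _ => coupl μ 1) (dif μ e (free (configs N) bond (β / Real.sqrt N)))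
      ≤ 4 * β ^ 2 * N := by
  have hN' : (0 : ℝ) < N := by exact_mod_cast hN
  refine (Finset.sum_le_sum fun e _ => pairInt_diag_dif_free_le configs_nonempty abs_bond_le
    (by positivity : 0 ≤ β / Real.sqrt N) hμ e).trans_eq ?_
  rw [div_pow, Real.sq_sqrt hN'.le, Finset.sum_const, Finset.card_univ, nsmul_eq_mul]
  simp only [Fintype.card_prod, Fintype.card_fin, Nat.cast_mul]
  field_simp

/-- The constant in the noise stability bound. -/
def noiseConst (β : ℝ) : ℝ := 4 + (2 * interpConst β + 40) * β ^ 3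

lemma noiseConst_pos (hβ : 0 < β) : 0 < noiseConst β := by
  unfold noiseConst interpConst taylorConst
  positivity

/-- The `N²` bonds with error `b³ = β³ N^{-3/2}` give `√N`; the logarithm is bounded crudely by
`4√N`. -/
lemma sum_noise_le_sqrt (hβ : 0 < β) (hN : 0 < N) (hμ : IsLaw μ M) :
    ∑ e, pairInt (fun _ => coupl μ (noiseLevel β))
        (dif μ e (free (configs N) bond (β / Real.sqrt N)))
      ≤ noiseConst β * M * Real.sqrt N := by
  refine (sum_noise_le hβ hN hμ).trans ?_
  have hN1 : (1 : ℝ) ≤ N := by exact_mod_cast hN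
  have hN' : (0 : ℝ) < N := by linarith
  have hM := hμ.one_le
  have hq : 0 < Real.sqrt N := Real.sqrt_pos.2 hN'
  have hqq : Real.sqrt N ^ 2 = N := Real.sq_sqrt hN'.le
  have h1 : (N : ℝ) ^ 2 * ((β / Real.sqrt N) ^ 3 * M) = β ^ 3 * M * Real.sqrt N := by
    rw [div_pow]
    field_simp
    rw [show Real.sqrt N ^ 4 = (Real.sqrt N ^ 2) ^ 2 by ring, hqq]
  have h2 : Real.log (2 * N + 1) ≤ 4 * Real.sqrt N := by
    have h3 : (2 * N + 1 : ℝ) ≤ (2 * Real.sqrt N) ^ 2 := by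
      rw [mul_pow, hqq]
      linarith
    refine (Real.log_le_log (by positivity) h3).trans ?_
    rw [Real.log_pow]
    have := Real.log_le_sub_one_of_pos (by positivity : 0 < 2 * Real.sqrt N)
    push_cast
    linarith
  have h3 : 4 * Real.sqrt N * 1 ≤ 4 * Real.sqrt N * M := by gcongr
  rw [h1, noiseConst]
  linarith

theorem exists_variance_free_le (hβ : 0 < β) :
    ∃ K : ℝ, 0 < K ∧ ∀ (N : ℕ), 2 ≤ N → ∀ (μ : Measure ℝ) (M : ℝ), IsLaw μ M →
      variance (free (configs N) bond (β / Real.sqrt N)) (Measure.pi fun _ => μ)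
        ≤ K * M * (N / Real.log N) := by
  set ρ := noiseLevel β
  have hρ0 : 0 < ρ := noiseLevel_pos β
  have hρ1 : ρ ≤ 1 / 2 := noiseLevel_le β
  set L := -Real.log ρ
  have hL : 0 < L := neg_pos.2 (Real.log_neg hρ0 (by linarith))
  have hA := noiseConst_pos hβ
  refine ⟨4 * noiseConst β / ρ + 16 * L * β ^ 2, by positivity, fun N hN μ M hμ => ?_⟩
  have hN0 : 0 < N := by omega
  have hN2 : (2 : ℝ) ≤ N := by exact_mod_cast hN
  have hN' : (0 : ℝ) < N := by linarith
  have hM := hμ.one_le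
  have hlog : 0 < Real.log N := Real.log_pos (by linarith)
  -- With `L = log(1/ρ)`, this makes `ρ^{-m}` at most `N^{1/4} / ρ`, the factor `1/ρ` paying for the
  -- ceiling. Low levels then cost `N^{1/4} · √N = N^{3/4}`, and high levels `N / m`, of order `N /
  -- log N`.
  set m := ⌈Real.log N / (4 * L)⌉₊
  have hm0 : 0 < m := Nat.ceil_pos.2 (by positivity)
  have hm1 : Real.log N / (4 * L) ≤ m := Nat.le_ceil _
  have hm2 : (m : ℝ) ≤ Real.log N / (4 * L) + 1 := (Nat.ceil_lt_add_one (by positivity)).le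
  have hmpos : (0 : ℝ) < m := by exact_mod_cast hm0
  set q := Real.exp (Real.log N / 4)
  have hq : 0 < q := Real.exp_pos _
  have hq4 : q ^ 4 = N := by
    rw [← Real.exp_nat_mul]
    push_cast
    rw [mul_div_cancel₀ _ (by norm_num), Real.exp_log hN']
  have hsq : Real.sqrt N = q ^ 2 := by
    rw [← hq4, show q ^ 4 = (q ^ 2) ^ 2 by ring, Real.sqrt_sq (by positivity)]
  have hlogq : Real.log N ≤ 4 * q := by
    have := Real.add_one_le_exp (Real.log N / 4)
    linarith
  have hinv : (ρ ^ m)⁻¹ ≤ q / ρ := by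
    have e1 : (ρ ^ m)⁻¹ = Real.exp (m * L) := by
      rw [← Real.exp_log (inv_pos.2 (pow_pos hρ0 m)), Real.log_inv, Real.log_pow]
      congr 1
      simp only [L]
      ring
    have e2 : q / ρ = Real.exp (Real.log N / 4 + L) := by
      rw [Real.exp_add, Real.exp_neg, Real.exp_log hρ0, div_eq_mul_inv]
    rw [e1, e2, Real.exp_le_exp]
    have := mul_le_mul_of_nonneg_right hm2 hL.le
    have e3 : (Real.log N / (4 * L) + 1) * L = Real.log N / 4 + L := by
      field_simp
    linarith
  have hminv : (m : ℝ)⁻¹ ≤ 4 * L / Real.log N := by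
    rw [← inv_div]
    exact inv_anti₀ (by positivity) hm1
  have hvar := variance_le_of_noise (ι := Fin N × Fin N) hμ.secondMoment
    (growth_free configs_nonempty (abs_bond_le (N := N)) (by positivity : 0 ≤ β / Real.sqrt N)) hρ0
    (by linarith) hm0
  refine hvar.trans ?_
  have t1 : (ρ ^ m)⁻¹ * ∑ e, pairInt (fun _ => coupl μ ρ)
      (dif μ e (free (configs N) bond (β / Real.sqrt N)))
      ≤ q / ρ * (noiseConst β * M * q ^ 2) := by
    rw [← hsq]
    exact (mul_le_mul_of_nonneg_left (sum_noise_le_sqrt hβ hN0 hμ) (by positivity)).trans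
      (mul_le_mul_of_nonneg_right hinv (by positivity))
  have t2 : (m : ℝ)⁻¹ * ∑ e, pairInt (fun _ => coupl μ 1)
      (dif μ e (free (configs N) bond (β / Real.sqrt N)))
      ≤ 4 * L / Real.log N * (4 * β ^ 2 * N) :=
    (mul_le_mul_of_nonneg_left (sum_diag_le hβ hN0 hμ) (by positivity)).trans
      (mul_le_mul_of_nonneg_right hminv (by positivity))
  have t3 : q / ρ * (noiseConst β * M * q ^ 2) ≤ 4 * noiseConst β / ρ * M * (N / Real.log N) := by
    have : q ^ 3 ≤ 4 * (N / Real.log N) := by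
      rw [← mul_div_assoc, le_div_iff₀ hlog]
      calc q ^ 3 * Real.log N ≤ q ^ 3 * (4 * q) := by gcongr
        _ = 4 * q ^ 4 := by ring
        _ = 4 * N := by rw [hq4]
    calc q / ρ * (noiseConst β * M * q ^ 2) = noiseConst β / ρ * M * q ^ 3 := by ring
      _ ≤ noiseConst β / ρ * M * (4 * (N / Real.log N)) := by gcongr
      _ = _ := by ring
  have t4 : 4 * L / Real.log N * (4 * β ^ 2 * N) ≤ 16 * L * β ^ 2 * M * (N / Real.log N) := by
    calc 4 * L / Real.log N * (4 * β ^ 2 * N) = 16 * L * β ^ 2 * 1 * (N / Real.log N) := by ring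
      _ ≤ _ := by gcongr
  linarith

end VarianceBound

/-! ### A Gaussian Hardy inequality in `L³` for absolutely continuous functions. -/

open scoped ENNReal

/-- Gaussian envelope controlling ratios of exponentially weighted Gaussian densities. -/
def envelope (t : ℝ) : ℝ := Real.exp 4 * Real.exp (-(1 / 4) * t ^ 2)

lemma lintegral_envelope_lt_top : ∫⁻ t, ENNReal.ofReal (envelope t) < ∞ := by
  have : Integrable envelope := (integrable_exp_neg_mul_sq (by norm_num)).const_mul _
  exact this.lintegral_lt_top

lemma exp_neg_abs_le (t : ℝ) : Real.exp (-|t|) ≤ 2 * (1 + t ^ 2)⁻¹ := by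
  have h := Real.quadratic_le_exp_of_nonneg (abs_nonneg t)
  rw [Real.exp_neg, ← div_eq_mul_inv, inv_le_comm₀ (Real.exp_pos _) (by positivity), inv_div]
  rw [sq_abs] at h
  linarith [abs_nonneg t]

lemma lintegral_exp_neg_abs_lt_top : ∫⁻ t : ℝ, ENNReal.ofReal (Real.exp (-|t|)) < ∞ := by
  refine (lintegral_mono fun t => ENNReal.ofReal_le_ofReal (exp_neg_abs_le t)).trans_lt ?_
  exact (integrable_inv_one_add_sq.const_mul 2).lintegral_lt_top

lemma abs_add_abs_sub_of_mem_uIoc {x y : ℝ} (h : y ∈ Set.uIoc 0 x) :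
    |x| = |y| + |x - y| ∧ 0 ≤ y * (x - y) := by
  rcases Set.mem_uIoc.1 h with ⟨h1, h2⟩ | ⟨h1, h2⟩
  · rw [abs_of_pos h1, abs_of_pos (h1.trans_le h2), abs_of_nonneg (sub_nonneg.2 h2)]
    exact ⟨by ring, mul_nonneg h1.le (sub_nonneg.2 h2)⟩
  · rw [abs_of_nonpos h2, abs_of_neg (h1.trans_le h2), abs_of_nonpos (by linarith)]
    exact ⟨by ring, mul_nonneg_of_nonpos_of_nonpos h2 (by linarith)⟩

/-- For `y` between `0` and `x`, one has `x² ≥ y² + (x-y)²` and `|x| - |y| = |x-y|`. With `t =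
|x-y|`, the remaining `exp(2t - t²/2)` is at most `exp(4 - t²/4)`, because `(t-4)² ≥ 0`. -/
lemma exp_mul_gaussianPDFReal_le {x y : ℝ} (h : y ∈ Set.uIoc 0 x) :
    Real.exp (2 * |x|) * Real.exp (-(2 * |y|)) * gaussianPDFReal 0 1 x
      ≤ gaussianPDFReal 0 1 y * envelope (x - y) := by
  obtain ⟨h1, h2⟩ := abs_add_abs_sub_of_mem_uIoc h
  simp only [gaussianPDFReal, envelope, NNReal.coe_one, mul_one, sub_zero]
  have key : Real.exp (2 * |x|) * Real.exp (-(2 * |y|)) * Real.exp (-x ^ 2 / 2)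
      ≤ Real.exp (-y ^ 2 / 2) * (Real.exp 4 * Real.exp (-(1 / 4) * (x - y) ^ 2)) := by
    rw [← Real.exp_add, ← Real.exp_add, ← Real.exp_add, ← Real.exp_add, Real.exp_le_exp]
    nlinarith [sq_nonneg (|x - y| - 4), sq_abs (x - y)]
  calc _ = (Real.sqrt (2 * Real.pi))⁻¹ *
        (Real.exp (2 * |x|) * Real.exp (-(2 * |y|)) * Real.exp (-x ^ 2 / 2)) := by ring
    _ ≤ _ := mul_le_mul_of_nonneg_left key (by positivity)
    _ = _ := by ring

lemma lintegral_uIoc_exp_abs_le (x : ℝ) :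
    ∫⁻ y in Set.uIoc 0 x, ENNReal.ofReal (Real.exp |y|)
      ≤ ENNReal.ofReal (Real.exp |x|) * ∫⁻ t : ℝ, ENNReal.ofReal (Real.exp (-|t|)) := by
  calc ∫⁻ y in Set.uIoc 0 x, ENNReal.ofReal (Real.exp |y|)
      ≤ ∫⁻ y in Set.uIoc 0 x, ENNReal.ofReal (Real.exp |x|) *
          ENNReal.ofReal (Real.exp (-|x - y|)) := by
        refine setLIntegral_mono' measurableSet_uIoc fun y hy => ?_
        rw [← ENNReal.ofReal_mul (Real.exp_pos _).le, ← Real.exp_add,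
          (abs_add_abs_sub_of_mem_uIoc hy).1]
        simp
    _ ≤ ∫⁻ y, ENNReal.ofReal (Real.exp |x|) * ENNReal.ofReal (Real.exp (-|x - y|)) :=
        setLIntegral_le_lintegral _ _
    _ = _ := by
        rw [lintegral_const_mul _ (by fun_prop)]
        congr 1
        exact lintegral_sub_left_eq_self (fun t => ENNReal.ofReal (Real.exp (-|t|))) x

variable {f : ℝ → ℝ}

lemma AbsCont.continuous (hf : AbsCont f) : Continuous f := by
  rw [continuous_iff_continuousAt]
  intro x
  have := (hf (x - 1) (x + 1)).continuousOn
  rw [Set.uIcc_of_le (by linarith)] at this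
  exact this.continuousAt (Icc_mem_nhds (by linarith) (by linarith))

lemma AbsCont.enorm_sub_le (hf : AbsCont f) (x : ℝ) :
    ‖f x - f 0‖ₑ ≤ ∫⁻ y in Set.uIoc 0 x, ‖deriv f y‖ₑ := by
  rw [← (hf 0 x).integral_deriv_eq_sub]
  rw [← ofReal_norm, intervalIntegral.norm_intervalIntegral_eq, ofReal_norm]
  exact enorm_integral_le_lintegral_enorm _

lemma ofReal_exp_rpow (a p : ℝ) :
    ENNReal.ofReal (Real.exp a) ^ p = ENNReal.ofReal (Real.exp (a * p)) := by
  rw [ENNReal.ofReal_rpow_of_pos (Real.exp_pos _), ← Real.exp_mul]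

lemma AbsCont.enorm_sub_pow_le (hf : AbsCont f) (x : ℝ) :
    ‖f x - f 0‖ₑ ^ 3 ≤ (∫⁻ t : ℝ, ENNReal.ofReal (Real.exp (-|t|))) ^ 2 *
      ∫⁻ y in Set.uIoc 0 x, ‖deriv f y‖ₑ ^ 3 *
        ENNReal.ofReal (Real.exp (2 * |x|) * Real.exp (-(2 * |y|))) := by
  have hm := measurable_deriv f
  have hpq : (3 : ℝ).HolderConjugate (3 / 2) := by
    rw [Real.holderConjugate_iff]
    norm_num
  -- The weight `exp(∓ 2|y|/3)` makes the conjugate factor `∫ exp|y|`, which is comparable to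
  -- `exp|x|` on the interval from `0` to `x`, instead of the length of that interval.
  have holder := ENNReal.lintegral_mul_le_Lp_mul_Lq (volume.restrict (Set.uIoc 0 x)) hpq
    (f := fun y => ‖deriv f y‖ₑ * ENNReal.ofReal (Real.exp (-(2 / 3 * |y|))))
    (g := fun y => ENNReal.ofReal (Real.exp (2 / 3 * |y|))) (by fun_prop) (by fun_prop)
  have e1 : ∀ y, ((fun y => ‖deriv f y‖ₑ * ENNReal.ofReal (Real.exp (-(2 / 3 * |y|)))) *
      fun y => ENNReal.ofReal (Real.exp (2 / 3 * |y|))) y = ‖deriv f y‖ₑ := by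
    intro y
    simp only [Pi.mul_apply]
    rw [mul_assoc, ← ENNReal.ofReal_mul (Real.exp_pos _).le, ← Real.exp_add]
    simp
  have e2 : ∀ y, (‖deriv f y‖ₑ * ENNReal.ofReal (Real.exp (-(2 / 3 * |y|)))) ^ (3 : ℝ)
      = ‖deriv f y‖ₑ ^ 3 * ENNReal.ofReal (Real.exp (-(2 * |y|))) := by
    intro y
    rw [ENNReal.mul_rpow_of_nonneg _ _ (by norm_num), ofReal_exp_rpow,
      show -(2 / 3 * |y|) * 3 = -(2 * |y|) by ring, ENNReal.rpow_ofNat]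
  have e3 : ∀ y : ℝ, ENNReal.ofReal (Real.exp (2 / 3 * |y|)) ^ (3 / 2 : ℝ)
      = ENNReal.ofReal (Real.exp |y|) := by
    intro y
    rw [ofReal_exp_rpow]
    ring_nf
  simp only [e1, e2, e3] at holder
  have h1 := ((hf.enorm_sub_le x).trans holder).trans
    (mul_le_mul_right (ENNReal.rpow_le_rpow (lintegral_uIoc_exp_abs_le x) (by norm_num)) _)
  have h2 := pow_le_pow_left₀ zero_le h1 3
  refine h2.trans_eq ?_
  rw [mul_pow, ← ENNReal.rpow_natCast, ← ENNReal.rpow_natCast, ← ENNReal.rpow_mul,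
    ← ENNReal.rpow_mul]
  have n1 : (1 / 3 : ℝ) * ((3 : ℕ) : ℝ) = 1 := by norm_num
  have n2 : (1 / (3 / 2) : ℝ) * ((3 : ℕ) : ℝ) = ((2 : ℕ) : ℝ) := by norm_num
  rw [n1, n2, ENNReal.rpow_one, ENNReal.rpow_natCast, mul_pow,
    ← ENNReal.ofReal_pow (Real.exp_pos _).le, ← Real.exp_nat_mul]
  simp only [ENNReal.ofReal_mul (Real.exp_pos (2 * |x|)).le, Nat.cast_ofNat]
  simp only [mul_left_comm _ (ENNReal.ofReal (Real.exp (2 * |x|)))]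
  rw [lintegral_const_mul _ (by fun_prop)]
  ring

/-- The constant in the Gaussian Hardy inequality in `L³`. -/
def hardyConst : ℝ≥0∞ :=
  (∫⁻ t : ℝ, ENNReal.ofReal (Real.exp (-|t|))) ^ 2 * ∫⁻ t, ENNReal.ofReal (envelope t)

lemma hardyConst_lt_top : hardyConst < ∞ :=
  ENNReal.mul_lt_top (ENNReal.pow_lt_top lintegral_exp_neg_abs_lt_top) lintegral_envelope_lt_top

/-- Once the density at `x` is traded for the density at `y` times `envelope (x - y)`, the kernel is
a convolution kernel; Tonelli and translation invariance leave its total mass as a constant. -/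
theorem AbsCont.lintegral_enorm_sub_pow_le (hf : AbsCont f) :
    ∫⁻ x, ‖f x - f 0‖ₑ ^ 3 ∂gaussianReal 0 1
      ≤ hardyConst * ∫⁻ x, ‖deriv f x‖ₑ ^ 3 ∂gaussianReal 0 1 := by
  have hm := measurable_deriv f
  have hme : Measurable envelope := by unfold envelope; fun_prop
  have hγ : gaussianReal 0 1 = volume.withDensity (gaussianPDF 0 1) :=
    gaussianReal_of_var_ne_zero 0 one_ne_zero
  have hmp : Measurable (gaussianPDF 0 1) := measurable_gaussianPDF 0 1
  have hcf := hf.continuous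
  rw [hγ, lintegral_withDensity_eq_lintegral_mul _ hmp (by fun_prop),
    lintegral_withDensity_eq_lintegral_mul _ hmp (by fun_prop)]
  simp only [Pi.mul_apply]
  set A := ∫⁻ t : ℝ, ENNReal.ofReal (Real.exp (-|t|))
  have hA : A < ∞ := lintegral_exp_neg_abs_lt_top
  calc ∫⁻ x, gaussianPDF 0 1 x * ‖f x - f 0‖ₑ ^ 3
      ≤ ∫⁻ x, A ^ 2 * ∫⁻ y, gaussianPDF 0 1 y * ‖deriv f y‖ₑ ^ 3 *
          ENNReal.ofReal (envelope (x - y)) := by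
        refine lintegral_mono fun x => ?_
        calc gaussianPDF 0 1 x * ‖f x - f 0‖ₑ ^ 3
            ≤ gaussianPDF 0 1 x * (A ^ 2 * ∫⁻ y in Set.uIoc 0 x, ‖deriv f y‖ₑ ^ 3 *
                ENNReal.ofReal (Real.exp (2 * |x|) * Real.exp (-(2 * |y|)))) :=
              mul_le_mul_right (hf.enorm_sub_pow_le x) _
          _ = A ^ 2 * ∫⁻ y in Set.uIoc 0 x, gaussianPDF 0 1 x * (‖deriv f y‖ₑ ^ 3 *
                ENNReal.ofReal (Real.exp (2 * |x|) * Real.exp (-(2 * |y|)))) := by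
              rw [lintegral_const_mul _ (by fun_prop)]
              ring
          _ ≤ A ^ 2 * ∫⁻ y in Set.uIoc 0 x, gaussianPDF 0 1 y * ‖deriv f y‖ₑ ^ 3 *
                ENNReal.ofReal (envelope (x - y)) := by
              refine mul_le_mul_right (setLIntegral_mono' measurableSet_uIoc fun y hy => ?_) _
              have := ENNReal.ofReal_le_ofReal (exp_mul_gaussianPDFReal_le hy)
              rw [ENNReal.ofReal_mul (by positivity),
                ENNReal.ofReal_mul (gaussianPDFReal_nonneg _ _ _)] at this
              calc _ = ‖deriv f y‖ₑ ^ 3 * (ENNReal.ofReal (Real.exp (2 * |x|) *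
                    Real.exp (-(2 * |y|))) * gaussianPDF 0 1 x) := by ring
                _ ≤ ‖deriv f y‖ₑ ^ 3 * (gaussianPDF 0 1 y * ENNReal.ofReal (envelope (x - y))) :=
                    mul_le_mul_right this _
                _ = _ := by ring
          _ ≤ _ := mul_le_mul_right (setLIntegral_le_lintegral _ _) _
    _ = A ^ 2 * ∫⁻ y, ∫⁻ x, gaussianPDF 0 1 y * ‖deriv f y‖ₑ ^ 3 *
          ENNReal.ofReal (envelope (x - y)) := by
        rw [lintegral_const_mul, lintegral_lintegral_swap]
        · fun_prop
        · refine Measurable.lintegral_prod_right ?_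
          fun_prop
    _ = A ^ 2 * ∫⁻ y, gaussianPDF 0 1 y * ‖deriv f y‖ₑ ^ 3 *
          ∫⁻ t, ENNReal.ofReal (envelope t) := by
        congr 1
        refine lintegral_congr fun y => ?_
        rw [lintegral_const_mul _ (by fun_prop)]
        congr 1
        exact lintegral_sub_right_eq_self (fun t => ENNReal.ofReal (envelope t)) y
    _ = _ := by
        rw [lintegral_mul_const _ (by fun_prop), hardyConst]
        ring

/-! ### From the Gaussian function to the law of the disorder, and from product measures to random
variables. -/

section Transfer

variable {f : ℝ → ℝ}

lemma ofReal_abs_pow (a : ℝ) : ENNReal.ofReal (|a| ^ 3) = ‖a‖ₑ ^ 3 := by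
  rw [ENNReal.ofReal_pow (abs_nonneg a), ← Real.norm_eq_abs, ofReal_norm]

lemma AbsCont.integral_abs_sub_pow_le (hf : AbsCont f)
    (hd : Integrable (fun x => |deriv f x| ^ 3) (gaussianReal 0 1)) :
    Integrable (fun x => |f x - f 0| ^ 3) (gaussianReal 0 1) ∧
      ∫ x, |f x - f 0| ^ 3 ∂gaussianReal 0 1
        ≤ hardyConst.toReal * ∫ x, |deriv f x| ^ 3 ∂gaussianReal 0 1 := by
  have hc := hf.continuous
  have hm : AEStronglyMeasurable (fun x => |f x - f 0| ^ 3) (gaussianReal 0 1) := by fun_prop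
  have h := hf.lintegral_enorm_sub_pow_le
  simp only [← ofReal_abs_pow] at h
  have hlt : hardyConst * ∫⁻ x, ENNReal.ofReal (|deriv f x| ^ 3) ∂gaussianReal 0 1 < ∞ :=
    ENNReal.mul_lt_top hardyConst_lt_top hd.lintegral_lt_top
  refine ⟨⟨hm, ?_⟩, ?_⟩
  · rw [hasFiniteIntegral_iff_ofReal (.of_forall fun x => by positivity)]
    exact h.trans_lt hlt
  · rw [integral_eq_lintegral_of_nonneg_ae (.of_forall fun x => by positivity) hm,
      integral_eq_lintegral_of_nonneg_ae (.of_forall fun x => by positivity)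
        hd.aestronglyMeasurable, ← ENNReal.toReal_mul]
    exact ENNReal.toReal_mono hlt.ne h

/-- A function with mean zero has third absolute moment at most eight times that of any of its
translates. -/
lemma integral_abs_pow_le_of_integral_eq_zero {α : Type*} [MeasurableSpace α] {ν : Measure α}
    [IsProbabilityMeasure ν] {u : α → ℝ} (c : ℝ) (hu : Integrable u ν)
    (hc : Integrable (fun x => |u x - c| ^ 3) ν) (h0 : ∫ x, u x ∂ν = 0) :
    Integrable (fun x => |u x| ^ 3) ν ∧ ∫ x, |u x| ^ 3 ∂ν ≤ 8 * ∫ x, |u x - c| ^ 3 ∂ν := by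
  have hb : ∀ x, |u x| ^ 3 ≤ 4 * |u x - c| ^ 3 + 4 * |c| ^ 3 := fun x => by
    have h1 : |u x| ≤ |u x - c| + |c| := by simpa using abs_add_le (u x - c) c
    have h2 := pow_le_pow_left₀ (abs_nonneg _) h1 3
    nlinarith [mul_nonneg (add_nonneg (abs_nonneg (u x - c)) (abs_nonneg c))
      (sq_nonneg (|u x - c| - |c|))]
  have hi : Integrable (fun x => 4 * |u x - c| ^ 3 + 4 * |c| ^ 3) ν :=
    (hc.const_mul 4).add (integrable_const _)
  have hcube : Integrable (fun x => |u x| ^ 3) ν :=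
    hi.mono' (hu.aestronglyMeasurable.norm.pow 3) (.of_forall fun x => by
      rw [Real.norm_of_nonneg (by positivity)]
      exact hb x)
  refine ⟨hcube, ?_⟩
  have habs : Integrable (fun x => |u x - c|) ν := (hu.sub (integrable_const c)).abs
  have hcm : |c| ≤ ∫ x, |u x - c| ∂ν := by
    have : ∫ x, (u x - c) ∂ν = -c := by
      rw [integral_sub hu (integrable_const _), h0]
      simp
    calc |c| = |∫ x, (u x - c) ∂ν| := by rw [this, abs_neg]
      _ ≤ _ := abs_integral_le_integral_abs
  have ht : |c| ^ 3 ≤ ∫ x, |u x - c| ^ 3 ∂ν := by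
    have h1 : ∫ x, (3 * |c| ^ 2 * |u x - c| + -2 * |c| ^ 3) ∂ν ≤ ∫ x, |u x - c| ^ 3 ∂ν := by
      -- Jensen for the cube, through its tangent at `|c|`: `t³ ≥ 3|c|²t - 2|c|³` for `t ≥ 0`.
      refine integral_mono ((habs.const_mul _).add (integrable_const _)) hc fun x => ?_
      have := abs_nonneg (u x - c)
      have := abs_nonneg c
      nlinarith [mul_nonneg (by positivity : 0 ≤ |u x - c| + 2 * |c|)
        (sq_nonneg (|u x - c| - |c|))]
    rw [integral_add (habs.const_mul _) (integrable_const _), integral_const_mul] at h1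
    simp only [integral_const, probReal_univ, one_smul] at h1
    have := mul_le_mul_of_nonneg_left hcm (by positivity : 0 ≤ 3 * |c| ^ 2)
    linarith
  refine (integral_mono hcube hi hb).trans ?_
  rw [integral_add (hc.const_mul _) (integrable_const _), integral_const_mul]
  simp only [integral_const, probReal_univ, one_smul]
  linarith

theorem AbsCont.isLaw_map (hf : AbsCont f) (h0 : ∫ x, f x ∂gaussianReal 0 1 = 0)
    (h1 : ∫ x, f x ^ 2 ∂gaussianReal 0 1 = 1)
    (hd : Integrable (fun x => |deriv f x| ^ 3) (gaussianReal 0 1)) :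
    IsLaw ((gaussianReal 0 1).map f)
      (8 * hardyConst.toReal * ∫ x, |deriv f x| ^ 3 ∂gaussianReal 0 1) := by
  have hc := hf.continuous
  have hm : AEMeasurable f (gaussianReal 0 1) := hc.aemeasurable
  have h2 : MemLp f 2 (gaussianReal 0 1) := by
    refine (memLp_two_iff_integrable_sq hc.aestronglyMeasurable).2 ?_
    -- A nonintegrable square would have Bochner integral `0` by convention, contradicting the value
    -- `1`; square integrability is thus hidden in the variance hypothesis.
    by_contra h
    rw [integral_undef h] at h1
    exact zero_ne_one h1
  obtain ⟨i1, i2⟩ := hf.integral_abs_sub_pow_le hd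
  obtain ⟨j1, j2⟩ := integral_abs_pow_le_of_integral_eq_zero (f 0) (h2.integrable one_le_two) i1 h0
  refine ⟨Measure.isProbabilityMeasure_map hm, ?_, ?_, ?_, ?_⟩
  · rwa [integrable_map_measure (by fun_prop) hm]
  · rw [integral_map hm (by fun_prop)]
    linarith
  · rwa [integral_map hm (by fun_prop)]
  · rwa [integral_map hm (by fun_prop)]

variable {ι Ω : Type*} [Fintype ι] [MeasurableSpace Ω] {P : Measure Ω} [IsProbabilityMeasure P]
  {μ : Measure ℝ} {h : ι → Ω → ℝ} {F : (ι → ℝ) → ℝ}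

lemma Growth.memLp_two (hF : Growth 1 F) (hμ : SecondMoment μ) :
    MemLp F 2 (Measure.pi fun _ => μ) := by
  refine (memLp_two_iff_integrable_sq hF.1.aestronglyMeasurable).2 ?_
  simpa [sq] using (hF.mul hF).integrable le_rfl (fun _ : ι => hμ)

lemma Growth.memLp_and_variance_comp (hF : Growth 1 F) (hμ : SecondMoment μ)
    (hm : ∀ i, AEMeasurable (h i) P) (hlaw : ∀ i, P.map (h i) = μ) (hind : iIndepFun h P) :
    MemLp (fun ω => F fun i => h i ω) 2 P ∧
      variance (fun ω => F fun i => h i ω) P = variance F (Measure.pi fun _ => μ) := by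
  have hmap := hind.map_fun_eq_pi_map hm
  simp only [hlaw] at hmap
  have hmm : AEMeasurable (fun ω i => h i ω) P := aemeasurable_pi_lambda _ hm
  have hLp := hF.memLp_two hμ
  rw [← hmap] at hLp ⊢
  exact ⟨hLp.comp_of_map hmm, (variance_map hF.1.aemeasurable hmm).symm⟩

end Transfer

end SK

end

theorem theorem2 (β : ℝ) (hβ : 0 < β) :
    ∃ K : ℝ, 0 < K ∧
      ∀ (f : ℝ → ℝ), SK.AbsCont f →
      -- a standard Gaussian random variable `g`, with `h = f(g)`
      ∀ {Ω₀ : Type*} [MeasurableSpace Ω₀] (P₀ : Measure Ω₀) [IsProbabilityMeasure P₀]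
        (g : Ω₀ → ℝ), HasLaw g (gaussianReal 0 1) P₀ →
      ∫ ω, f (g ω) ∂P₀ = 0 →
      ∫ ω, f (g ω) ^ 2 ∂P₀ = 1 →
      Integrable (fun ω => |deriv f (g ω)| ^ 3) P₀ →
      ∀ N : ℕ, 2 ≤ N →
      -- i.i.d. copies `h_{ij}` of `h = f(g)`
      ∀ {Ω : Type*} [MeasurableSpace Ω] (P : Measure Ω) [IsProbabilityMeasure P]
        (h : Fin N → Fin N → Ω → ℝ),
        iIndepFun (fun p : Fin N × Fin N => h p.1 p.2) P →
        (∀ i j, IdentDistrib (h i j) (fun ω => f (g ω)) P P₀) →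
        MemLp (fun ω => SK.freeEnergy β N (fun i j => h i j ω)) 2 P ∧
        variance (fun ω => SK.freeEnergy β N (fun i j => h i j ω)) P ≤
          K * (1 + (∫ ω, |deriv f (g ω)| ^ 3 ∂P₀) ^ 2) * ((N : ℝ) / Real.log (N : ℝ)) := by
  obtain ⟨K, hK, hbound⟩ := SK.exists_variance_free_le hβ
  have hC : 0 ≤ 8 * SK.hardyConst.toReal := by positivity
  -- The factor `8 * hardyConst` converts `E|f'(g)|³` into a bound for `E|h|³`; the `+ 1` only
  -- ensures positivity without a lower bound on the Hardy constant.
  refine ⟨K * (8 * SK.hardyConst.toReal + 1), by positivity, ?_⟩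
  intro f hf Ω₀ _ P₀ _ g hg h0 h1 hd N hN Ω _ P _ h hind hid
  have hc := hf.continuous
  have hdm := measurable_deriv f
  have hmap : P₀.map (fun ω => f (g ω)) = (gaussianReal 0 1).map f := by
    rw [← hg.map_eq, AEMeasurable.map_map_of_aemeasurable hc.aemeasurable hg.aemeasurable]
    rfl
  have tr : ∀ u : ℝ → ℝ, Measurable u → ∫ ω, u (g ω) ∂P₀ = ∫ x, u x ∂gaussianReal 0 1 := by
    intro u hu
    rw [← hg.map_eq, integral_map hg.aemeasurable hu.aestronglyMeasurable]
  have hd' : Integrable (fun x => |deriv f x| ^ 3) (gaussianReal 0 1) := by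
    rw [← hg.map_eq, integrable_map_measure (by fun_prop) hg.aemeasurable]
    exact hd
  have hlaw := hf.isLaw_map ((tr f hc.measurable).symm.trans h0)
    ((tr (fun x => f x ^ 2) (by fun_prop)).symm.trans h1) hd'
  rw [tr (fun x => |deriv f x| ^ 3) (by fun_prop)]
  set D := ∫ x, |deriv f x| ^ 3 ∂gaussianReal 0 1
  have hD : 0 ≤ D := integral_nonneg fun x => by positivity
  have hlogN : 0 ≤ (N : ℝ) / Real.log N := div_nonneg (by positivity)
    (Real.log_nonneg (by exact_mod_cast (by omega : 1 ≤ N)))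
  obtain ⟨t1, t2⟩ := (SK.growth_free SK.configs_nonempty (SK.abs_bond_le (N := N))
    (by positivity : 0 ≤ β / Real.sqrt N)).memLp_and_variance_comp hlaw.secondMoment
    (fun e : Fin N × Fin N => (hid e.1 e.2).aemeasurable_fst)
    (fun e => (hid e.1 e.2).map_eq.trans hmap) hind
  simp only [SK.freeEnergy_eq]
  refine ⟨t1, t2.trans_le ((hbound N hN _ _ hlaw).trans ?_)⟩
  refine mul_le_mul_of_nonneg_right ?_ hlogN
  rw [mul_assoc K (_ + 1)]
  refine mul_le_mul_of_nonneg_left ?_ hK.le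
  -- The bound obtained is linear in `D = E|f'(g)|³`, which is stronger than the quadratic form
  -- required.
  have : D ≤ 1 + D ^ 2 := by nlinarith [sq_nonneg (D - 1)]
  nlinarith [mul_le_mul_of_nonneg_left this hC, sq_nonneg D]
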